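/- **Setting.** Let $J>0$, $0<\zeta<\pi$, $\eta=-i\zeta$ (massless regime) and $0<h<h_c=8J\cos^2(\zeta/2)$. Put $$K(\omega)=\frac{\sin 2\zeta}{\sinh(\omega+i\zeta)\sinh(\omega-i\zeta)},\qquad e_0(\lambda)=h-\frac{2J\sin^2\zeta}{\sinh(\lambda+i\zeta/2)\sinh(\lambda-i\zeta/2)} .$$ For each small $T>0$ let $\mathscr C=\mathscr C_T$ be the counterclockwise contour $(\mathbb R-i\alpha_\downarrow)\cup(-\mathbb R+i\alpha_\uparrow)$, where $\alpha_\downarrow>0$, $0<\alpha_\uparrow<\zeta/2$, $\alpha_\downarrow+\alpha_\uparrow<\min(\zeta,\pi-\zeta)$ may depend on $T$, and let $\mathfrak a=\mathfrak a_T=e^{\ln\mathfrak a}$ be a solution of $$\ln\mathfrak a(\omega)=-\frac hT+\frac{2J\sinh\eta}{T}\{\coth(\omega+\eta)-\coth\omega\}+\oint_{\mathscr C}K(\omega-\mu)\ln[1+\mathfrak a(\mu)]\frac{d\mu}{2\pi}$$ in the closed strip bounded by $\mathscr C$, with $\ln\mathfrak a$ analytic for $-\alpha_\downarrow\le\Im\omega\le\zeta/2$,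 $\omega\neq0$, and $\ln[1+\mathfrak a]$ continuous on the two lines of $\mathscr C$ with $\ln[1+\mathfrak a]-\ln[1+e^{-h/T}]$ integrable there. Here $\ln[1+\mathfrak a]$ is $\ln\mathfrak a+\operatorname{Log}(1+\mathfrak a^{-1})$ where $\Re\ln\mathfrak a>0$ and $\operatorname{Log}(1+\mathfrak a)$ elsewhere. The boundary-field dependent function is $$\mathcal B(\xi)=T\beta\coth\xi-T\delta_\xi\ln[1+\mathfrak a(-\xi)]+T\oint_{\mathscr C}\ln[1+\mathfrak a(\omega)]\coth(\omega+\xi)\frac{d\omega}{2i\pi},\qquad \beta=\frac{J\sinh\eta}{T},$$ with $\delta_\xi=1$ if $-\xi$ is inside $\mathscr C$ and $0$ otherwise. Set $\varepsilon(\lambda)=\varepsilon_T(\lambda)=-T\ln\mathfrak a(\lambda+i\zeta/2)$. Write $O(T^\infty)$ for "$O(T^n)$ for every $n$", as $T\to0^+$. **Standing assumptions (contour deformation and existence of the low-$T$ expansion).** 1. $\ln[1+\mathfrak a]$ is holomorphic on $\alpha_\uparrow\le\Im\omega\le\zeta/2$, and $\ln\mathfrak a\to-h/T$ there as $|\Re\omega|\to\infty$.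 On the line $\mathbb R-i\alpha_\downarrow$, $\ln[1+\mathfrak a]$ is $O(T^\infty)$ in $L^\infty$, and $\ln[1+\mathfrak a]-\ln[1+e^{-h/T}]$ is $O(T^\infty)$ in $L^1$. 2. Uniformly in $\lambda\in\mathbb R$: $\varepsilon(\lambda)=e_0(\lambda)+T\int_{\mathbb R}K(\lambda-\mu)\ln[1+e^{-\varepsilon(\mu)/T}]\frac{d\mu}{2\pi}+O(T^\infty)$. 3. On $\mathbb R$, $\varepsilon=\varepsilon_0+T\varepsilon_1+T^2\varepsilon_2+O(T^3)$ in $L^1\cap L^\infty$, for some real functions $\varepsilon_0,\varepsilon_1,\varepsilon_2$ with $\varepsilon_1,\varepsilon_2\in L^1\cap L^\infty$. For some $q>0$, $\varepsilon_0<0$ on $(-q,q)$, $\varepsilon_0>0$ on $\mathbb R\setminus[-q,q]$, and $\varepsilon_0'(q)\ne0$. **Proposition.** Then $\varepsilon_0$ is the dressed energy and $q$ its Fermi point: $$\varepsilon_0(\lambda)+\int_{-q}^{q}K(\lambda-\mu)\varepsilon_0(\mu)\frac{d\mu}{2\pi}=e_0(\lambda)\quad(\lambda\in\mathbb R),\qquad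 \varepsilon_0(\pm q)=0 .$$ Moreover, let $\xi\neq0$ with $-\pi/2<\Im\xi\le\pi/2$ and $\Im\xi\ne-\zeta/2$, such that for small $T$ the point $-\xi$ is not on the upper line of $\mathscr C$ and stays at a distance bounded below from its lower line. Suppose that, for some $c>0$ and all small $T$, $\Re\varepsilon(-i\zeta/2-\xi)\le-c$ if $0<-\Im\xi<\zeta/2$, and $\Re\varepsilon(-i\zeta/2-\xi)\ge c$ whenever $-\alpha_\downarrow<-\Im\xi\le0$. Then, as $T\to0^+$, $$\mathcal B(\xi)=T\beta\coth\xi+\int_{\mathcal C_\xi}\coth(\lambda+\xi+i\zeta/2)\,\varepsilon(\lambda)\frac{d\lambda}{2i\pi}-\frac{i\pi T^2}{12\,\varepsilon_0'(q)}\cdot\frac{\sinh(2\xi+i\zeta)}{\sinh(q+\xi+i\zeta/2)\sinh(q-\xi-i\zeta/2)}+O(T^4),$$ where $\mathcal C_\xi=[-q,q]\cup\Gamma(-i\zeta/2-\xi)$ if $0<-\Im\xi<\zeta/2$ and $\mathcal C_\xi=[-q,q]$ otherwise, $\Gamma(z)$ being a sufficiently small counterclockwise circle around $z$, of radius independent of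 $T$. -/

import Mathlib

open Complex Filter Topology MeasureTheory Set
open scoped Real

noncomputable section

/-- Hyperbolic cotangent. -/
def ccoth (z : ℂ) : ℂ := cosh z / sinh z

/-! ### The function `𝔞` at finite temperature

Throughout, a solution of the non-linear integral equation is encoded by its logarithm
`loga = ln 𝔞`, so that `𝔞 = exp ∘ loga`. -/

/-- The branch of `ln (1 + e^u)` that equals `u + o(1)` as `Re u → +∞` and `o(1)` as
`Re u → -∞`; it takes real values on the real line. -/
def logOneAddExp (u : ℂ) : ℂ :=
  if 0 < u.re then u + log (1 + exp (-u)) else log (1 + exp u)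

/-- `ln [1 + 𝔞(ω)]`. -/
def logOneAdd (loga : ℂ → ℂ) (ω : ℂ) : ℂ := logOneAddExp (loga ω)

/-- The kernel `K = θ'` for the anisotropy parameter `η`. -/
def kernelK (η ω : ℂ) : ℂ := I * sinh (2 * η) / (sinh (ω - η) * sinh (ω + η))

/-- `∮_𝒞 F(ω) dω` for the counterclockwise contour `𝒞 = (ℝ - i αd) ∪ (-ℝ + i αu)`. The two lines
are integrated together, since only the combination need decay at infinity. -/
def contourInt (αd αu : ℝ) (F : ℂ → ℂ) : ℂ :=
  ∫ x : ℝ, (F ((x : ℂ) - I * αd) - F ((x : ℂ) + I * αu))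

/-- The heights of the two lines of `𝒞` are admissible in the massless regime `η = -iζ`:
`𝒞` encircles `0` but not `iζ/2`, and `K(ω - μ)` has no pole for `ω, μ` in the closed strip
bounded by `𝒞`. For `αd = αu = α` this is `0 < α < min (ζ/2) ((π - ζ)/2)`. -/
def AdmissibleContour (ζ αd αu : ℝ) : Prop :=
  0 < αd ∧ 0 < αu ∧ αu < ζ / 2 ∧ αd + αu < min ζ (π - ζ)

/-- The common limit `ln (1 + e^{-h/T})` of `ln [1 + 𝔞(ω)]` at the two ends of the strip. -/
def logOneAddInfty (h T : ℝ) : ℝ := Real.log (1 + Real.exp (-h / T))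

/-- `loga` is (the logarithm of) a solution `𝔞` at temperature `T` of the non-linear integral
equation on the contour `𝒞`, analytically continued from the strip bounded by `𝒞` up to the
line `ℝ + iζ/2`. -/
structure IsNLIESolution (J h ζ T αd αu : ℝ) (loga : ℂ → ℂ) : Prop where
  analytic : AnalyticOnNhd ℂ loga {ω | ω ≠ 0 ∧ -αd ≤ ω.im ∧ ω.im ≤ ζ / 2}
  nlie : ∀ ω : ℂ, ω ≠ 0 → -αd ≤ ω.im → ω.im ≤ αu →
    loga ω = -(h : ℂ) / T
      + 2 * J * sinh (-I * ζ) / T * (ccoth (ω + -I * ζ) - ccoth ω)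
      + contourInt αd αu (fun μ => kernelK (-I * ζ) (ω - μ) * logOneAdd loga μ) / (2 * π)
  continuous_down : Continuous fun x : ℝ => logOneAdd loga ((x : ℂ) - I * αd)
  continuous_up : Continuous fun x : ℝ => logOneAdd loga ((x : ℂ) + I * αu)
  integrable_down : Integrable fun x : ℝ =>
    logOneAdd loga ((x : ℂ) - I * αd) - (logOneAddInfty h T : ℂ)
  integrable_up : Integrable fun x : ℝ =>
    logOneAdd loga ((x : ℂ) + I * αu) - (logOneAddInfty h T : ℂ)

open Classical in
/-- `δ_ξ = 1` if `-ξ` lies inside `𝒞` and `0` otherwise. Everything is `iπ`-periodic; `ξ` is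
meant to be taken in the fundamental strip `-π/2 < Im ξ ≤ π/2`. -/
def deltaXi (αd αu : ℝ) (ξ : ℂ) : ℂ :=
  if -αd < (-ξ).im ∧ (-ξ).im < αu then 1 else 0

/-- The boundary-field dependent function
`ℬ(ξ) = T β coth ξ - T δ_ξ ln [1 + 𝔞(-ξ)] + T ∮_𝒞 ln [1 + 𝔞(ω)] coth (ω + ξ) dω / 2iπ`,
where `β = J sinh η / T`. -/
def boundaryB (J : ℝ) (η : ℂ) (T αd αu : ℝ) (loga : ℂ → ℂ) (ξ : ℂ) : ℂ :=
  T * (J * sinh η / T) * ccoth ξ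
    - T * deltaXi αd αu ξ * logOneAdd loga (-ξ)
    + T * (contourInt αd αu (fun ω => logOneAdd loga ω * ccoth (ω + ξ)) / (2 * I * π))

/-! ### Energies in the massless regime -/

/-- The bare energy `e₀`. -/
def bareEnergy (J h ζ : ℝ) (z : ℂ) : ℂ :=
  h - 2 * J * Real.sin ζ ^ 2 / (sinh (z + I * ζ / 2) * sinh (z - I * ζ / 2))

/-- `ε(λ) = -T ln 𝔞(λ + iζ/2)`. -/
def epsT (ζ T : ℝ) (loga : ℂ → ℂ) (z : ℂ) : ℂ := -T * loga (z + I * ζ / 2)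

/-- `ε₀` is the dressed energy with Fermi point `q`. -/
def IsDressedEnergy (J h ζ q : ℝ) (ε₀ : ℝ → ℝ) : Prop :=
  (∀ x : ℝ, (ε₀ x : ℂ) + (∫ y in (-q)..q, kernelK (-I * ζ) (x - y) * (ε₀ y : ℂ)) / (2 * π)
      = bareEnergy J h ζ x) ∧
    ε₀ q = 0 ∧ ε₀ (-q) = 0

/-- `∫_{𝒞_ξ} coth (λ + ξ + iζ/2) ε(λ) dλ / 2iπ`, where `𝒞_ξ` is `[-q, q]`, together with the
counterclockwise circle of radius `r` about `-iζ/2 - ξ` when `0 < -Im ξ < ζ/2`. -/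
def intCxi (ζ q : ℝ) (ε : ℂ → ℂ) (ξ : ℂ) (r : ℝ) : ℂ :=
  ((∫ x in (-q)..q, ccoth (x + ξ + I * ζ / 2) * ε x)
    + (if 0 < -ξ.im ∧ -ξ.im < ζ / 2 then
        ∮ z in C(-(I * ζ / 2) - ξ, r), ccoth (z + ξ + I * ζ / 2) * ε z else 0)) / (2 * I * π)

/-! ### The standing low-temperature assumptions on a family of solutions

A family is given by `loga T` and the contour heights `αd T`, `αu T`, for small `T > 0`. -/

/-- The upper line of `𝒞` can be deformed to `ℝ + iζ/2`: `ln [1 + 𝔞]` is holomorphic on the closed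
strip between the two lines, and `𝔞 → e^{-h/T}` at both of its ends. -/
def UpperLineDeformable (h ζ T αu : ℝ) (loga : ℂ → ℂ) : Prop :=
  AnalyticOnNhd ℂ (logOneAdd loga) {ω | αu ≤ ω.im ∧ ω.im ≤ ζ / 2} ∧
  Tendsto loga (comap (fun ω : ℂ => |ω.re|) atTop ⊓ 𝓟 {ω | αu ≤ ω.im ∧ ω.im ≤ ζ / 2})
    (𝓝 (-(h : ℂ) / T))

/-- On the lower line of `𝒞`, `ln [1 + 𝔞]` is `O(T^∞)` in `L^∞`, and its difference with its limit
at infinity is `O(T^∞)` in `L¹`. -/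
def LowerLineNegligible (h : ℝ) (αd : ℝ → ℝ) (loga : ℝ → ℂ → ℂ) : Prop :=
  ∀ n : ℕ, ∃ C : ℝ, ∀ᶠ T in 𝓝[>] (0 : ℝ),
    (∀ x : ℝ, ‖logOneAdd (loga T) ((x : ℂ) - I * αd T)‖ ≤ C * T ^ n) ∧
    ∫ x : ℝ, ‖logOneAdd (loga T) ((x : ℂ) - I * αd T) - (logOneAddInfty h T : ℂ)‖ ≤ C * T ^ n

/-- `ε` satisfies on `ℝ` the Yang-Yang type equation
`ε(λ) = e₀(λ) + T ∫_ℝ K(λ - μ) ln [1 + e^{-ε(μ)/T}] dμ/2π + O(T^∞)`. -/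
def YangYangUpToInfinity (J h ζ : ℝ) (loga : ℝ → ℂ → ℂ) : Prop :=
  ∀ n : ℕ, ∃ C : ℝ, ∀ᶠ T in 𝓝[>] (0 : ℝ), ∀ x : ℝ,
    ‖epsT ζ T (loga T) x - (bareEnergy J h ζ x
      + T * ((∫ y : ℝ, kernelK (-I * ζ) (x - y) * logOneAddExp (-epsT ζ T (loga T) y / T))
          / (2 * π)))‖ ≤ C * T ^ n

/-- `ε` admits the low-temperature expansion `ε = ε₀ + T ε₁ + T² ε₂ + O(T³)` on `ℝ`, with real
coefficients, where `ε₁`, `ε₂` and the remainder are controlled in `L¹ ∩ L^∞`. -/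
def HasLowTExpansion (ζ : ℝ) (loga : ℝ → ℂ → ℂ) (ε₀ ε₁ ε₂ : ℝ → ℝ) : Prop :=
  Integrable ε₁ ∧ Integrable ε₂ ∧ (∃ M : ℝ, ∀ x, |ε₁ x| ≤ M ∧ |ε₂ x| ≤ M) ∧
  ∃ C : ℝ, ∀ᶠ T in 𝓝[>] (0 : ℝ),
    (∀ x : ℝ, ‖epsT ζ T (loga T) x
        - ((ε₀ x : ℂ) + T * (ε₁ x : ℂ) + (T : ℂ) ^ 2 * (ε₂ x : ℂ))‖ ≤ C * T ^ 3) ∧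
    Integrable (fun x : ℝ => epsT ζ T (loga T) x
        - ((ε₀ x : ℂ) + T * (ε₁ x : ℂ) + (T : ℂ) ^ 2 * (ε₂ x : ℂ))) ∧
    ∫ x : ℝ, ‖epsT ζ T (loga T) x
        - ((ε₀ x : ℂ) + T * (ε₁ x : ℂ) + (T : ℂ) ^ 2 * (ε₂ x : ℂ))‖ ≤ C * T ^ 3

/-- `ξ` is in the fundamental strip, `coth ξ` is finite, `-ξ` is not on `ℝ + iζ/2` nor on `𝒞`,
and it stays away from the lower line of `𝒞`. -/
def AdmissibleXi (ζ : ℝ) (αd αu : ℝ → ℝ) (ξ : ℂ) : Prop :=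
  -(π / 2) < ξ.im ∧ ξ.im ≤ π / 2 ∧ ξ ≠ 0 ∧ ξ.im ≠ -(ζ / 2) ∧
  (∀ᶠ T in 𝓝[>] (0 : ℝ), -ξ.im ≠ αu T) ∧
  ∃ d > 0, ∀ᶠ T in 𝓝[>] (0 : ℝ), d ≤ |ξ.im - αd T|

/-- `Re ε(-iζ/2 - ξ)` is negative if `0 < -Im ξ < ζ/2`, and positive if `-ξ` lies in the part
`Im ≤ 0` of the interior of `𝒞`, uniformly for small `T`. -/
def SignCondition (ζ : ℝ) (αd : ℝ → ℝ) (loga : ℝ → ℂ → ℂ) (ξ : ℂ) : Prop :=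
  ∃ c > 0, ∀ᶠ T in 𝓝[>] (0 : ℝ),
    (0 < -ξ.im ∧ -ξ.im < ζ / 2 → (epsT ζ T (loga T) (-(I * ζ / 2) - ξ)).re ≤ -c) ∧
    (-αd T < -ξ.im ∧ -ξ.im ≤ 0 → c ≤ (epsT ζ T (loga T) (-(I * ζ / 2) - ξ)).re)

end

/-!
The representation of `ℬ(ξ)` as a contour integral reduces, up to `O(T^∞)`, to one integral over the
line `ℝ + iζ/2`, where `ln [1 + 𝔞] = ln [1 + e^{-ε/T}]`: the lower line of `𝒞` is negligible
(`isBigO_lower_line`), and the upper line can be moved to `ℝ + iζ/2`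
(`integral_sub_mul_ccoth`, `contourInt_logOneAdd_mul_ccoth`). The shift collects the residue
`ln [1 + 𝔞(-ξ)]` of `coth (ω + ξ)` if `-ξ` lies in between, and contributions of the two ends
of the strip, where `coth → ±1` and `ln [1 + 𝔞] → ln (1 + e^{-h/T})`, which is exponentially small.
Together with the explicit term `-T δ_ξ ln [1 + 𝔞(-ξ)]`, the residue is `ε(-iζ/2 - ξ)` when
`0 < -Im ξ < ζ/2`, up to an exponentially small error, which is the integral over the small circle;
otherwise it is exponentially small or absent (`norm_residue_add_energy_le`).

What remains is a Sommerfeld expansion: for bounded `f` of class `C²`,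
`T ∫ ln [1 + e^{-ε/T}] f = -∫_{-q}^q f ε + π² T² / (6 ε₀'(q)) (f(q) + f(-q)) + O(T⁴)`
(`LowTempFamily.sommerfeld_log_isBigO`), where the divergent constant `ln (1 + e^{-h/T})` is
subtracted on the left. The integral over `[-q, q]` involves the full `ε` at temperature `T` but
the Fermi point `q` of `ε₀`. The expansion is only as good as the information on `ε` near `±q`:

* In the limit `T → 0` the Yang-Yang type equation is the linear equation for the dressed energy
  `ε₀`. Its operator `1 + K / 2π` on `[-q, q]` is injective on bounded functions, because the kernel
  has total mass less than `2π` there (`exists_kernel_contraction`). Hence `ε₀` is even and smooth,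
  and its simple zeros at `±q` localize `ln [1 + e^{-ε/T}]` to the scale `T`.
* At order `T` the same injectivity gives `ε₁ = 0` (`LowTempFamily.one_eq_zero`), and at order `T²`
  the equation shows that `ε₂` is Lipschitz (`LowTempFamily.exists_lipschitz_two`). So near `±q` the
  function `ε` is the second Taylor polynomial of `ε₀` plus the constant `T² ε₂(±q)`, with an error
  of third order in `T` and the distance to `±q`.
* Pairing the points `q + t` and `q - t`, the terms of order `T³` cancel by parity, and the leading
  term is the Fermi integral `∫₀^∞ ln (1 + e^{-u}) du = π²/12`.
-/

/-! ### Elementary estimates -/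

lemma exp_neg_div_le (n : ℕ) {m T : ℝ} (hm : 0 < m) (hT : 0 < T) :
    Real.exp (-(m / T)) ≤ (n.factorial / m ^ n) * T ^ n := by
  have h := Real.pow_div_factorial_le_exp (m / T) (div_nonneg hm.le hT.le) n
  have hf : (0 : ℝ) < n.factorial := by exact_mod_cast n.factorial_pos
  have h2 : 0 < (m / T) ^ n / n.factorial := by positivity
  rw [Real.exp_neg]
  refine (inv_anti₀ h2 h).trans (le_of_eq ?_)
  rw [div_pow]
  field_simp

lemma exp_neg_div_isBigO (n : ℕ) {m : ℝ} (hm : 0 < m) :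
    (fun T : ℝ => Real.exp (-(m / T))) =O[𝓝[>] 0] (fun T : ℝ => T ^ n) := by
  refine Asymptotics.IsBigO.of_bound (n.factorial / m ^ n) ?_
  filter_upwards [self_mem_nhdsWithin] with T hT
  have hT : 0 < T := hT
  rw [Real.norm_of_nonneg (Real.exp_pos _).le, Real.norm_of_nonneg (by positivity)]
  exact exp_neg_div_le n hm hT

/-! ### The function `ln (1 + e^{-v})` near the real axis -/

lemma exp_re_nonneg_of_abs_im_le {v : ℂ} (hv : |v.im| ≤ 1) : 0 ≤ (exp v).re := by
  rw [exp_re]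
  have := abs_le.1 hv
  have hp := Real.one_le_pi_div_two
  exact mul_nonneg (Real.exp_pos _).le
    (Real.cos_nonneg_of_neg_pi_div_two_le_of_le (by linarith) (by linarith))

lemma norm_le_norm_one_add {w : ℂ} (hw : 0 ≤ w.re) : ‖w‖ ≤ ‖1 + w‖ := by
  rw [← abs_of_nonneg (norm_nonneg w), ← abs_of_nonneg (norm_nonneg (1 + w)), ← sq_le_sq,
    ← normSq_eq_norm_sq, ← normSq_eq_norm_sq, normSq_apply, normSq_apply]
  simp; nlinarith

lemma one_le_norm_one_add {w : ℂ} (hw : 0 ≤ w.re) : 1 ≤ ‖1 + w‖ := by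
  refine le_trans ?_ (re_le_norm _)
  simp [hw]

lemma norm_log_one_add_le_of_re_nonneg {w : ℂ} (hw : 0 ≤ w.re) : ‖log (1 + w)‖ ≤ ‖w‖ := by
  have hd : ∀ x ∈ {z : ℂ | 0 ≤ z.re},
      HasDerivWithinAt (fun z : ℂ => log (1 + z)) (1 / (1 + x)) {z : ℂ | 0 ≤ z.re} x := by
    intro x hx
    have hx' : 0 < (1 + x).re := by have : 0 ≤ x.re := hx; simp; linarith
    exact (((hasDerivAt_id x).const_add 1).clog (Or.inl hx')).hasDerivWithinAt
  have hb : ∀ x ∈ {z : ℂ | 0 ≤ z.re}, ‖1 / (1 + x)‖ ≤ 1 := by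
    intro x hx
    rw [norm_div, norm_one]
    exact div_le_one_of_le₀ (one_le_norm_one_add hx) (norm_nonneg _)
  have := Convex.norm_image_sub_le_of_norm_hasDerivWithin_le hd hb
    (convex_halfSpace_re_ge 0) (show (0 : ℂ) ∈ _ by simp) (show w ∈ _ from hw)
  simpa using this

/-- The principal branch of `ln (1 + e^{-v})`. -/
noncomputable def logOneAddExpNeg (v : ℂ) : ℂ := log (1 + exp (-v))

lemma norm_logOneAddExpNeg_le {v : ℂ} (hv : |v.im| ≤ 1) :
    ‖logOneAddExpNeg v‖ ≤ Real.exp (-v.re) := by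
  have h := norm_log_one_add_le_of_re_nonneg (exp_re_nonneg_of_abs_im_le (v := -v) (by simpa))
  rwa [norm_exp, neg_re] at h

lemma one_add_exp_re_pos {v : ℂ} (hv : |v.im| ≤ 1) : 0 < (1 + exp v).re := by
  have := exp_re_nonneg_of_abs_im_le hv
  simp only [add_re, one_re]; linarith

lemma one_add_exp_ne_zero {v : ℂ} (hv : |v.im| ≤ 1) : 1 + exp v ≠ 0 := fun h => by
  have := one_add_exp_re_pos hv
  rw [h] at this
  simp at this

/-- Near the real axis the two branches `u + ln (1 + e^{-u})` and `ln (1 + e^u)` agree. -/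
lemma log_one_add_exp_eq {u : ℂ} (hu : |u.im| ≤ 1) :
    log (1 + exp u) = u + log (1 + exp (-u)) := by
  have h1 : 1 + exp u = exp u * (1 + exp (-u)) := by
    rw [mul_add, mul_one, ← exp_add, add_neg_cancel, exp_zero, add_comm]
  have hw' : 0 < (1 + exp (-u)).re := one_add_exp_re_pos (by simpa)
  have harg : |(1 + exp (-u)).arg| < π / 2 :=
    abs_arg_lt_pi_div_two_iff.2 (Or.inl hw')
  have hp := Real.one_le_pi_div_two
  have ha := abs_lt.1 harg
  have hb := abs_le.1 hu
  have hexp : log (exp u) = u := log_exp (by linarith) (by linarith)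
  have hargu : (exp u).arg = u.im := by rw [← log_im, hexp]
  rw [h1, log_mul (exp_ne_zero u) (one_add_exp_ne_zero (by simpa)), hexp]
  rw [hargu]
  constructor <;> linarith [hb.1, hb.2, ha.1, ha.2]

lemma logOneAddExp_neg_eq {v : ℂ} (hv : |v.im| ≤ 1) :
    logOneAddExp (-v) = logOneAddExpNeg v := by
  unfold logOneAddExp logOneAddExpNeg
  split_ifs
  · rw [log_one_add_exp_eq (u := -v) (by simpa)]
  · rfl

lemma logOneAddExpNeg_eq_neg_add {v : ℂ} (hv : |v.im| ≤ 1) :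
    logOneAddExpNeg v = -v + logOneAddExpNeg (-v) := by
  unfold logOneAddExpNeg
  exact log_one_add_exp_eq (u := -v) (by simpa)

lemma hasDerivAt_logOneAddExpNeg {v : ℂ} (hv : |v.im| ≤ 1) :
    HasDerivAt logOneAddExpNeg (-(1 + exp v)⁻¹) v := by
  have h1 := (((hasDerivAt_id v).neg.cexp).const_add 1).clog
    (Or.inl (one_add_exp_re_pos (v := -v) (by simpa)))
  refine h1.congr_deriv ?_
  have h2 := one_add_exp_ne_zero hv
  have h3 := one_add_exp_ne_zero (v := -v) (by simpa)
  have h4 : exp v * exp (-v) = 1 := by rw [← exp_add, add_neg_cancel, exp_zero]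
  simp only [id, Pi.neg_apply]
  rw [div_eq_iff h3, ← mul_right_inj' h2]
  field_simp
  linear_combination -h4

lemma norm_inv_one_add_exp_le {v : ℂ} (hv : |v.im| ≤ 1) :
    ‖(1 + exp v)⁻¹‖ ≤ Real.exp (-v.re) := by
  have h := norm_le_norm_one_add (exp_re_nonneg_of_abs_im_le hv)
  rw [norm_inv, Real.exp_neg, ← norm_exp]
  exact inv_anti₀ (norm_pos_iff.2 (exp_ne_zero v)) h

lemma hasDerivAt_inv_one_add_exp {v : ℂ} (hv : |v.im| ≤ 1) :
    HasDerivAt (fun v => -(1 + exp v)⁻¹) (exp v / (1 + exp v) ^ 2) v := by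
  have h := (((hasDerivAt_exp v).const_add 1).inv (one_add_exp_ne_zero hv)).neg
  exact h.congr_deriv (by ring)

lemma norm_exp_div_one_add_exp_sq_le {v : ℂ} (hv : |v.im| ≤ 1) :
    ‖exp v / (1 + exp v) ^ 2‖ ≤ Real.exp (-v.re) := by
  have h1 := norm_le_norm_one_add (exp_re_nonneg_of_abs_im_le hv)
  have h2 := norm_inv_one_add_exp_le hv
  have h3 : 0 < ‖1 + exp v‖ := norm_pos_iff.2 (one_add_exp_ne_zero hv)
  calc ‖exp v / (1 + exp v) ^ 2‖ = (‖exp v‖ / ‖1 + exp v‖) * ‖(1 + exp v)⁻¹‖ := by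
        rw [norm_div, norm_pow, norm_inv]; field_simp
    _ ≤ 1 * Real.exp (-v.re) := by
        gcongr
        exact div_le_one_of_le₀ h1 h3.le
    _ = _ := one_mul _

/-- The half strip on which `ln (1 + e^{-v})` and its derivatives are at most `e^{-m}`. -/
def halfStrip (m : ℝ) : Set ℂ := {v | m ≤ v.re ∧ |v.im| ≤ 1}

lemma convex_halfStrip (m : ℝ) : Convex ℝ (halfStrip m) := by
  have : halfStrip m = {v : ℂ | m ≤ v.re} ∩ ({v : ℂ | -1 ≤ v.im} ∩ {v : ℂ | v.im ≤ 1}) := by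
    ext v; simp [halfStrip, abs_le]
  rw [this]
  exact (convex_halfSpace_re_ge m).inter
    ((convex_halfSpace_im_ge (-1)).inter (convex_halfSpace_im_le 1))

lemma norm_logOneAddExpNeg_sub_le {m : ℝ} {u v : ℂ} (hu : u ∈ halfStrip m)
    (hv : v ∈ halfStrip m) :
    ‖logOneAddExpNeg u - logOneAddExpNeg v‖ ≤ Real.exp (-m) * ‖u - v‖ := by
  refine Convex.norm_image_sub_le_of_norm_hasDerivWithin_le
    (fun x hx => (hasDerivAt_logOneAddExpNeg hx.2).hasDerivWithinAt) (fun x hx => ?_)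
    (convex_halfStrip m) hv hu
  rw [norm_neg]
  exact (norm_inv_one_add_exp_le hx.2).trans (Real.exp_le_exp.2 (neg_le_neg hx.1))

lemma norm_logOneAddExpNeg_taylor_le {m : ℝ} {u v : ℂ} (hu : u ∈ halfStrip m)
    (hv : v ∈ halfStrip m) :
    ‖logOneAddExpNeg u - logOneAddExpNeg v - -(1 + exp v)⁻¹ * (u - v)‖
      ≤ Real.exp (-m) * ‖u - v‖ ^ 2 := by
  have hseg : segment ℝ v u ⊆ halfStrip m := (convex_halfStrip m).segment_subset hv hu
  have h := Convex.norm_image_sub_le_of_norm_hasDerivWithin_le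
    (f := fun z => logOneAddExpNeg z - -(1 + exp v)⁻¹ * z)
    (f' := fun z => -(1 + exp z)⁻¹ - -(1 + exp v)⁻¹ * 1) (C := Real.exp (-m) * ‖u - v‖)
    (s := segment ℝ v u)
    (fun x hx => ((hasDerivAt_logOneAddExpNeg (hseg hx).2).sub
      ((hasDerivAt_id x).const_mul _)).hasDerivWithinAt)
    (fun x hx => ?_) (convex_segment v u) (left_mem_segment ℝ v u) (right_mem_segment ℝ v u)
  · rw [show logOneAddExpNeg u - logOneAddExpNeg v - -(1 + exp v)⁻¹ * (u - v)
      = logOneAddExpNeg u - -(1 + exp v)⁻¹ * u - (logOneAddExpNeg v - -(1 + exp v)⁻¹ * v) by ring]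
    refine h.trans (le_of_eq (by ring))
  · have h2 := Convex.norm_image_sub_le_of_norm_hasDerivWithin_le
      (f := fun z => -(1 + exp z)⁻¹) (C := Real.exp (-m))
      (fun x hx => (hasDerivAt_inv_one_add_exp (v := x)
        (show x ∈ halfStrip m from hx).2).hasDerivWithinAt)
      (fun x hx => (norm_exp_div_one_add_exp_sq_le hx.2).trans
        (Real.exp_le_exp.2 (neg_le_neg hx.1)))
      (convex_halfStrip m) hv (hseg hx)
    rw [mul_one]
    refine h2.trans ?_
    gcongr
    exact norm_sub_le_of_mem_segment hx

lemma logOneAddExpNeg_ofReal (x : ℝ) :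
    logOneAddExpNeg x = (Real.log (1 + Real.exp (-x)) : ℝ) := by
  rw [logOneAddExpNeg, ofReal_log (by positivity)]
  push_cast; rfl

lemma measurable_logOneAddExp : Measurable logOneAddExp := by
  refine Measurable.ite (measurableSet_lt measurable_const measurable_re) ?_ ?_ <;> fun_prop

/-! ### The Fermi integral and Taylor expansions -/

lemma hasSum_alternating_inv_sq :
    HasSum (fun n : ℕ => (-1 : ℝ) ^ n / ((n : ℝ) + 1) ^ 2) (π ^ 2 / 12) := by
  have h := hasSum_one_div_nat_pow_mul_cos one_ne_zero (x := 1 / 2) (by norm_num)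
  have h1 := (hasSum_nat_add_iff' 1).2 h
  convert! h1.neg using 1
  · funext n
    have : 2 * π * ((n + 1 : ℕ) : ℝ) * (1 / 2) = ((n + 1 : ℕ) : ℝ) * π := by ring
    rw [this, Real.cos_nat_mul_pi]
    push_cast
    ring
  · norm_num [Polynomial.bernoulli, Finset.sum_range_succ, bernoulli_two, bernoulli_one,
      bernoulli_zero, Nat.factorial]
    ring

lemma integral_exp_neg_mul_Ioi {c : ℝ} (hc : 0 < c) :
    ∫ u in Ioi (0 : ℝ), Real.exp (-(c * u)) = 1 / c := by
  have := integral_exp_mul_Ioi (neg_neg_of_pos hc) 0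
  simp only [neg_mul] at this
  rw [this]; simp

lemma integrableOn_exp_neg_mul_Ioi {c : ℝ} (hc : 0 < c) (a : ℝ) :
    IntegrableOn (fun u => Real.exp (-(c * u))) (Ioi a) := by
  have := integrableOn_exp_mul_Ioi (neg_neg_of_pos hc) a
  simpa only [neg_mul] using this

/-- The Fermi integral `∫₀^∞ ln (1 + e^{-u}) du = π² / 12`, by expanding the logarithm. -/
lemma integral_log_one_add_exp_neg :
    ∫ u in Ioi (0 : ℝ), Real.log (1 + Real.exp (-u)) = π ^ 2 / 12 := by
  set F : ℕ → ℝ → ℝ := fun n u => (-1) ^ n / ((n : ℝ) + 1) * Real.exp (-(((n : ℝ) + 1) * u))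
    with hF
  have hpos : ∀ n : ℕ, (0 : ℝ) < (n : ℝ) + 1 := fun n => by positivity
  have hint : ∀ n, Integrable (F n) (volume.restrict (Ioi 0)) := fun n =>
    (integrableOn_exp_neg_mul_Ioi (hpos n) 0).const_mul _
  have hval : ∀ n, ∫ u in Ioi (0 : ℝ), F n u = (-1 : ℝ) ^ n / ((n : ℝ) + 1) ^ 2 := fun n => by
    rw [hF, integral_const_mul, integral_exp_neg_mul_Ioi (hpos n)]
    field_simp
  have hnorm : ∀ n, ∫ u in Ioi (0 : ℝ), ‖F n u‖ = 1 / ((n : ℝ) + 1) ^ 2 := fun n => by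
    have : ∀ u, ‖F n u‖ = 1 / ((n : ℝ) + 1) * Real.exp (-(((n : ℝ) + 1) * u)) := fun u => by
      rw [hF, norm_mul, norm_div, norm_pow, norm_neg, norm_one, one_pow,
        Real.norm_of_nonneg (hpos n).le, Real.norm_of_nonneg (Real.exp_pos _).le]
    simp only [this]
    rw [integral_const_mul, integral_exp_neg_mul_Ioi (hpos n)]
    field_simp
  have hsum : Summable fun n => ∫ u in Ioi (0 : ℝ), ‖F n u‖ := by
    simp only [hnorm]
    have := (summable_nat_add_iff 1).2 (Real.summable_one_div_nat_pow.2 one_lt_two)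
    simpa using this
  have h := hasSum_integral_of_summable_integral_norm hint hsum
  simp only [hval] at h
  rw [← h.unique hasSum_alternating_inv_sq]
  refine setIntegral_congr_fun measurableSet_Ioi fun u hu => ?_
  have hu : 0 < u := hu
  have hlt : Real.exp (-u) < 1 := by rw [Real.exp_lt_one_iff]; linarith
  have hs := Real.hasSum_pow_div_log_of_abs_lt_one (x := -Real.exp (-u))
    (by rw [abs_neg, abs_of_pos (Real.exp_pos _)]; exact hlt)
  rw [sub_neg_eq_add] at hs
  have hs := hs.neg
  rw [neg_neg] at hs
  rw [← hs.tsum_eq]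
  refine tsum_congr fun n => ?_
  rw [hF, neg_pow, ← Real.exp_nat_mul]
  push_cast
  rw [show -(((n : ℝ) + 1) * u) = ((n : ℝ) + 1) * -u by ring, pow_succ]
  ring

lemma norm_sub_le_pow_of_norm_deriv_le {E : Type*} [NormedAddCommGroup E] [NormedSpace ℝ E]
    {G G' : ℝ → E} {C δ : ℝ} {n : ℕ} (hC : 0 ≤ C)
    (hG : ∀ t, |t| ≤ δ → HasDerivAt G (G' t) t) (hG' : ∀ t, |t| ≤ δ → ‖G' t‖ ≤ C * |t| ^ n)
    {t : ℝ} (ht : |t| ≤ δ) : ‖G t - G 0‖ ≤ C * |t| ^ (n + 1) := by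
  have hs : ∀ x ∈ segment ℝ 0 t, |x| ≤ |t| := fun x hx => by
    simpa using norm_sub_le_of_mem_segment hx
  have := Convex.norm_image_sub_le_of_norm_hasDerivWithin_le (f := G) (f' := G')
    (C := C * |t| ^ n) (s := segment ℝ 0 t)
    (fun x hx => (hG x ((hs x hx).trans ht)).hasDerivWithinAt)
    (fun x hx => (hG' x ((hs x hx).trans ht)).trans
      (mul_le_mul_of_nonneg_left (pow_le_pow_left₀ (abs_nonneg _) (hs x hx) n) hC))
    (convex_segment 0 t) (left_mem_segment ℝ 0 t) (right_mem_segment ℝ 0 t)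
  rw [sub_zero, Real.norm_eq_abs] at this
  rw [pow_succ, ← mul_assoc]
  exact this

lemma exists_norm_iteratedDeriv_le {E : Type*} [NormedAddCommGroup E] [NormedSpace ℝ E]
    {g : ℝ → E} {n : ℕ} (hg : ContDiff ℝ n g) (x : ℝ) :
    ∃ C, 0 ≤ C ∧ ∀ t, |t| ≤ 1 → ‖iteratedDeriv n g (x + t)‖ ≤ C := by
  have hc := hg.continuous_iteratedDeriv n le_rfl
  obtain ⟨C, hC⟩ := (isCompact_Icc (a := x - 1) (b := x + 1)).exists_bound_of_continuousOn
    hc.continuousOn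
  refine ⟨C, (norm_nonneg _).trans (hC x ⟨by linarith, by linarith⟩), fun t ht => hC _ ?_⟩
  have := abs_le.1 ht
  constructor <;> linarith

lemma hasDerivAt_iteratedDeriv_add {E : Type*} [NormedAddCommGroup E] [NormedSpace ℝ E]
    {g : ℝ → E} {n : ℕ} (hg : ContDiff ℝ (n + 1 : ℕ) g) (x t : ℝ) :
    HasDerivAt (fun s => iteratedDeriv n g (x + s)) (iteratedDeriv (n + 1) g (x + t)) t := by
  have hd := hg.differentiable_iteratedDeriv n (by exact_mod_cast Nat.lt_succ_self n)
  have := (hd (x + t)).hasDerivAt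
  rw [iteratedDeriv_succ]
  exact this.comp_const_add x t

lemma exists_taylor_two {E : Type*} [NormedAddCommGroup E] [NormedSpace ℝ E]
    {g : ℝ → E} (hg : ContDiff ℝ 2 g) (x : ℝ) :
    ∃ C, 0 ≤ C ∧ ∀ t, |t| ≤ 1 → ‖g (x + t) - g x - t • deriv g x‖ ≤ C * |t| ^ 2 := by
  obtain ⟨C, hC0, hC⟩ := exists_norm_iteratedDeriv_le (n := 2) hg x
  refine ⟨C, hC0, fun t ht => ?_⟩
  have h1 : ∀ t, |t| ≤ 1 → ‖deriv g (x + t) - deriv g x‖ ≤ C * |t| ^ 1 := fun t ht => by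
    have := norm_sub_le_pow_of_norm_deriv_le (n := 0) (δ := 1) hC0
      (fun t _ => hasDerivAt_iteratedDeriv_add (n := 1) hg x t) (by simpa using hC) ht
    simpa [iteratedDeriv_one] using this
  have h0 := norm_sub_le_pow_of_norm_deriv_le (n := 1) (δ := 1)
    (G := fun t => g (x + t) - t • deriv g x) (G' := fun t => deriv g (x + t) - (1 : ℝ) • deriv g x)
    hC0 (fun t _ => ?_) (by simpa using h1) ht
  · simp only [add_zero, zero_smul, sub_zero] at h0
    rwa [sub_right_comm]
  · have := hasDerivAt_iteratedDeriv_add (n := 0) (hg.of_le (by norm_num)) x t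
    simp only [iteratedDeriv_zero, zero_add, iteratedDeriv_one] at this
    exact this.sub ((hasDerivAt_id t).smul_const _)

lemma exists_taylor_three {E : Type*} [NormedAddCommGroup E] [NormedSpace ℝ E]
    {g : ℝ → E} (hg : ContDiff ℝ 3 g) (x : ℝ) :
    ∃ b : E, ∃ C, 0 ≤ C ∧ ∀ t, |t| ≤ 1 →
      ‖g (x + t) - g x - t • deriv g x - t ^ 2 • b‖ ≤ C * |t| ^ 3 := by
  have hg' : ContDiff ℝ 2 (deriv g) := by
    have : ContDiff ℝ (2 + 1) g := by exact_mod_cast hg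
    exact (contDiff_succ_iff_deriv.1 this).2.2
  obtain ⟨C, hC0, hC⟩ := exists_taylor_two hg' x
  refine ⟨(1 / 2 : ℝ) • deriv (deriv g) x, C, hC0, fun t ht => ?_⟩
  have h0 := norm_sub_le_pow_of_norm_deriv_le (n := 2) (δ := 1)
    (G := fun t => g (x + t) - t • deriv g x - t ^ 2 • ((1 / 2 : ℝ) • deriv (deriv g) x))
    (G' := fun t => deriv g (x + t) - (1 : ℝ) • deriv g x
      - (2 * t) • ((1 / 2 : ℝ) • deriv (deriv g) x))
    hC0 (fun t _ => ?_) (fun t ht => ?_) ht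
  · simp only [add_zero, zero_smul, sub_zero, ne_eq, OfNat.ofNat_ne_zero, not_false_eq_true,
      zero_pow] at h0
    convert h0 using 2
    abel
  · have := hasDerivAt_iteratedDeriv_add (n := 0) (hg.of_le (by norm_num)) x t
    simp only [iteratedDeriv_zero, zero_add, iteratedDeriv_one] at this
    refine (this.sub ((hasDerivAt_id t).smul_const _)).sub (HasDerivAt.smul_const ?_ _)
    simpa using hasDerivAt_pow 2 t
  · have := hC t ht
    rw [one_smul, smul_smul, show 2 * t * (1 / 2) = t by ring]
    exact this

/-! ### The kernel on the real line -/

lemma sinh_add_mul_sinh_sub (a b : ℂ) :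
    sinh (a + b) * sinh (a - b) = sinh a ^ 2 - sinh b ^ 2 := by
  rw [sinh_add, sinh_sub]
  linear_combination sinh a ^ 2 * cosh_sq b - sinh b ^ 2 * cosh_sq a

lemma sinh_add_I_mul_sinh_sub_I (x y : ℝ) :
    sinh ((x : ℂ) + I * y) * sinh ((x : ℂ) - I * y)
      = ((Real.sinh x ^ 2 + Real.sin y ^ 2 : ℝ) : ℂ) := by
  rw [sinh_add_mul_sinh_sub, mul_comm I, sinh_mul_I]
  push_cast
  linear_combination -(sin (y : ℂ)) ^ 2 * I_sq

/-- The kernel `K` as a real function. -/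
noncomputable def realKernel (ζ x : ℝ) : ℝ :=
  Real.sin (2 * ζ) / (Real.sinh x ^ 2 + Real.sin ζ ^ 2)

lemma kernelK_ofReal (ζ x : ℝ) : kernelK (-I * ζ) x = (realKernel ζ x : ℂ) := by
  have h := sinh_add_I_mul_sinh_sub_I x ζ
  unfold kernelK realKernel
  rw [show (x : ℂ) - -I * ζ = x + I * ζ by ring, show (x : ℂ) + -I * ζ = x - I * ζ by ring, h,
    show 2 * (-I * (ζ : ℂ)) = -((2 * ζ : ℝ) : ℂ) * I by push_cast; ring, sinh_mul_I, sin_neg]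
  push_cast
  linear_combination (-sin (2 * (ζ : ℂ)) / (sinh (x : ℂ) ^ 2 + sin (ζ : ℂ) ^ 2)) * I_sq

lemma kernelK_ofReal_sub (ζ x y : ℝ) :
    kernelK (-I * ζ) ((x : ℂ) - y) = (realKernel ζ (x - y) : ℂ) := by
  rw [← ofReal_sub, kernelK_ofReal]

/-- The bare energy as a real function. -/
noncomputable def realBareEnergy (J h ζ x : ℝ) : ℝ :=
  h - 2 * J * Real.sin ζ ^ 2 / (Real.sinh x ^ 2 + Real.sin (ζ / 2) ^ 2)

lemma bareEnergy_ofReal (J h ζ x : ℝ) :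
    bareEnergy J h ζ x = (realBareEnergy J h ζ x : ℂ) := by
  have h := sinh_add_I_mul_sinh_sub_I x (ζ / 2)
  unfold bareEnergy realBareEnergy
  rw [show (x : ℂ) + I * ζ / 2 = x + I * ((ζ / 2 : ℝ) : ℂ) by push_cast; ring,
    show (x : ℂ) - I * ζ / 2 = x - I * ((ζ / 2 : ℝ) : ℂ) by push_cast; ring, h]
  push_cast
  rfl

lemma sq_le_sinh_sq (x : ℝ) : x ^ 2 ≤ Real.sinh x ^ 2 := by
  rw [sq_le_sq, Real.abs_sinh]
  exact Real.self_le_sinh_iff.2 (abs_nonneg x)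

lemma sinh_sq_add_sq_pos {s : ℝ} (hs : s ≠ 0) (x : ℝ) : 0 < Real.sinh x ^ 2 + s ^ 2 := by
  positivity

lemma inv_sinh_sq_add_sq_le {s : ℝ} (hs : s ≠ 0) (x : ℝ) :
    (Real.sinh x ^ 2 + s ^ 2)⁻¹ ≤ (1 + (s ^ 2)⁻¹) * (1 + x ^ 2)⁻¹ := by
  have h1 := sq_le_sinh_sq x
  have hs2 : 0 < s ^ 2 := by positivity
  rw [← div_eq_mul_inv, inv_le_comm₀ (sinh_sq_add_sq_pos hs x) (by positivity), inv_div,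
    div_le_iff₀ (by positivity)]
  have h2 : (x ^ 2 + s ^ 2) * (1 + (s ^ 2)⁻¹) = x ^ 2 + 1 + s ^ 2 + x ^ 2 * (s ^ 2)⁻¹ := by
    field_simp; ring
  calc 1 + x ^ 2 ≤ (x ^ 2 + s ^ 2) * (1 + (s ^ 2)⁻¹) := by
        rw [h2]; have : 0 ≤ x ^ 2 * (s ^ 2)⁻¹ := by positivity
        linarith
    _ ≤ _ := by gcongr

lemma continuous_inv_sinh_sq_add_sq {s : ℝ} (hs : s ≠ 0) :
    Continuous fun x => (Real.sinh x ^ 2 + s ^ 2)⁻¹ :=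
  Continuous.inv₀ (by fun_prop) fun x => (sinh_sq_add_sq_pos hs x).ne'

lemma integrable_inv_sinh_sq_add_sq {s : ℝ} (hs : s ≠ 0) :
    Integrable fun x => (Real.sinh x ^ 2 + s ^ 2)⁻¹ := by
  refine (integrable_inv_one_add_sq.const_mul (1 + (s ^ 2)⁻¹)).mono'
    (continuous_inv_sinh_sq_add_sq hs).aestronglyMeasurable (Eventually.of_forall fun x => ?_)
  rw [Real.norm_of_nonneg (inv_nonneg.2 (sinh_sq_add_sq_pos hs x).le)]
  exact inv_sinh_sq_add_sq_le hs x

lemma contDiff_realKernel {ζ : ℝ} (hs : Real.sin ζ ≠ 0) {n : WithTop ℕ∞} :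
    ContDiff ℝ n (realKernel ζ) := by
  refine ContDiff.div contDiff_const ?_ fun x => (sinh_sq_add_sq_pos hs x).ne'
  exact (Real.contDiff_sinh.pow 2).add contDiff_const

lemma contDiff_realBareEnergy (J h : ℝ) {ζ : ℝ} (hs : Real.sin (ζ / 2) ≠ 0) {n : WithTop ℕ∞} :
    ContDiff ℝ n (realBareEnergy J h ζ) := by
  refine contDiff_const.sub
    (ContDiff.div contDiff_const ?_ fun x => (sinh_sq_add_sq_pos hs x).ne')
  exact (Real.contDiff_sinh.pow 2).add contDiff_const

lemma abs_realKernel_le {ζ : ℝ} (hs : Real.sin ζ ≠ 0) (x : ℝ) :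
    |realKernel ζ x| ≤ (1 + (Real.sin ζ ^ 2)⁻¹) * (1 + x ^ 2)⁻¹ := by
  rw [realKernel, abs_div, abs_of_pos (sinh_sq_add_sq_pos hs x), div_eq_mul_inv]
  calc _ ≤ 1 * (Real.sinh x ^ 2 + Real.sin ζ ^ 2)⁻¹ := by
        gcongr
        exact Real.abs_sin_le_one _
    _ ≤ _ := by rw [one_mul]; exact inv_sinh_sq_add_sq_le hs x

lemma abs_realKernel_le_const {ζ : ℝ} (hs : Real.sin ζ ≠ 0) (x : ℝ) :
    |realKernel ζ x| ≤ 1 + (Real.sin ζ ^ 2)⁻¹ := by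
  refine (abs_realKernel_le hs x).trans (mul_le_of_le_one_right (by positivity) ?_)
  exact inv_le_one_of_one_le₀ (by nlinarith [sq_nonneg x])

lemma integrable_realKernel {ζ : ℝ} (hs : Real.sin ζ ≠ 0) : Integrable (realKernel ζ) := by
  have : realKernel ζ = fun x => Real.sin (2 * ζ) * (Real.sinh x ^ 2 + Real.sin ζ ^ 2)⁻¹ :=
    funext fun x => div_eq_mul_inv _ _
  rw [this]
  exact (integrable_inv_sinh_sq_add_sq hs).const_mul _

lemma realKernel_neg (ζ x : ℝ) : realKernel ζ (-x) = realKernel ζ x := by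
  simp [realKernel]

lemma realBareEnergy_neg (J h ζ x : ℝ) : realBareEnergy J h ζ (-x) = realBareEnergy J h ζ x := by
  simp [realBareEnergy]

lemma exists_lipschitz_realKernel {ζ : ℝ} (hs : Real.sin ζ ≠ 0) :
    ∃ C, 0 ≤ C ∧ ∀ x y, |realKernel ζ x - realKernel ζ y| ≤ C * |x - y| := by
  set s := Real.sin ζ
  refine ⟨(2 + (s ^ 2)⁻¹) * (s ^ 2)⁻¹, by positivity, fun x y => ?_⟩
  have hd : ∀ x, HasDerivAt (realKernel ζ) (-(Real.sin (2 * ζ) * (2 * Real.sinh x * Real.cosh x))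
      / (Real.sinh x ^ 2 + s ^ 2) ^ 2) x := fun x => by
    have h1 := ((Real.hasDerivAt_sinh x).pow 2).add_const (s ^ 2)
    refine ((hasDerivAt_const x (Real.sin (2 * ζ))).div h1
      (sinh_sq_add_sq_pos hs x).ne').congr_deriv ?_
    simp
  refine Convex.norm_image_sub_le_of_norm_hasDerivWithin_le
    (fun x _ => (hd x).hasDerivWithinAt) (fun x _ => ?_) convex_univ (mem_univ y) (mem_univ x)
  have hw := sinh_sq_add_sq_pos hs x
  have hs2 : 0 < s ^ 2 := by positivity
  have h1 : |2 * Real.sinh x * Real.cosh x| ≤ 1 + 2 * Real.sinh x ^ 2 := by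
    have := Real.cosh_sq x
    rw [abs_le]
    constructor <;> nlinarith [sq_nonneg (Real.sinh x + Real.cosh x),
      sq_nonneg (Real.sinh x - Real.cosh x)]
  have h2 : 1 + 2 * Real.sinh x ^ 2 ≤ (2 + (s ^ 2)⁻¹) * (Real.sinh x ^ 2 + s ^ 2) := by
    have : (2 + (s ^ 2)⁻¹) * (Real.sinh x ^ 2 + s ^ 2)
      = 2 * Real.sinh x ^ 2 + 2 * s ^ 2 + (s ^ 2)⁻¹ * Real.sinh x ^ 2 + 1 := by field_simp; ring
    rw [this]
    have : 0 ≤ (s ^ 2)⁻¹ * Real.sinh x ^ 2 := by positivity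
    linarith
  rw [norm_div, norm_neg, norm_mul, Real.norm_eq_abs, Real.norm_eq_abs, Real.norm_eq_abs,
    abs_of_pos (pow_pos hw 2), div_le_iff₀ (pow_pos hw 2)]
  calc |Real.sin (2 * ζ)| * |2 * Real.sinh x * Real.cosh x|
      ≤ 1 * ((2 + (s ^ 2)⁻¹) * (Real.sinh x ^ 2 + s ^ 2)) := by
        gcongr
        · exact Real.abs_sin_le_one _
        · exact h1.trans h2
    _ = (2 + (s ^ 2)⁻¹) * (s ^ 2)⁻¹ * (s ^ 2 * (Real.sinh x ^ 2 + s ^ 2)) := by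
        field_simp
    _ ≤ _ := by
        rw [sq (Real.sinh x ^ 2 + s ^ 2)]
        gcongr
        nlinarith [sq_nonneg (Real.sinh x)]

/-- The kernel has the bounded primitive `2 arctan (cot ζ tanh x)`. -/
lemma hasDerivAt_two_mul_arctan_cot_mul_tanh {ζ : ℝ} (hs : Real.sin ζ ≠ 0) (x : ℝ) :
    HasDerivAt (fun x => 2 * Real.arctan (Real.cos ζ / Real.sin ζ * Real.tanh x))
      (realKernel ζ x) x := by
  have hc := (Real.cosh_pos x).ne'
  have h1 : HasDerivAt Real.tanh (1 / Real.cosh x ^ 2) x := by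
    have : Real.tanh = fun x => Real.sinh x / Real.cosh x := funext Real.tanh_eq_sinh_div_cosh
    rw [this]
    refine ((Real.hasDerivAt_sinh x).div (Real.hasDerivAt_cosh x) hc).congr_deriv ?_
    congr 1
    linear_combination Real.cosh_sq x
  refine ((h1.const_mul (Real.cos ζ / Real.sin ζ)).arctan.const_mul 2).congr_deriv ?_
  have hw := sinh_sq_add_sq_pos hs x
  have hkey : Real.sin ζ ^ 2 * Real.cosh x ^ 2 + Real.cos ζ ^ 2 * Real.sinh x ^ 2
      = Real.sinh x ^ 2 + Real.sin ζ ^ 2 := by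
    linear_combination Real.sin ζ ^ 2 * Real.cosh_sq x
      + Real.sinh x ^ 2 * Real.sin_sq_add_cos_sq ζ
  have hkey2 : 1 + (Real.cos ζ / Real.sin ζ * Real.tanh x) ^ 2
      = (Real.sinh x ^ 2 + Real.sin ζ ^ 2) / (Real.sin ζ ^ 2 * Real.cosh x ^ 2) := by
    rw [← hkey, Real.tanh_eq_sinh_div_cosh]
    field_simp
  rw [hkey2, realKernel, Real.sin_two_mul]
  field_simp

lemma abs_arctan_cot_mul_tanh_le (ζ x : ℝ) :
    |Real.arctan (Real.cos ζ / Real.sin ζ * Real.tanh x)|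
      ≤ Real.arctan |Real.cos ζ / Real.sin ζ| := by
  have h : |Real.cos ζ / Real.sin ζ * Real.tanh x| ≤ |Real.cos ζ / Real.sin ζ| := by
    rw [abs_mul]
    refine mul_le_of_le_one_right (abs_nonneg _) (abs_le.2 ⟨?_, ?_⟩)
    · exact (Real.neg_one_lt_tanh x).le
    · exact (Real.tanh_lt_one x).le
  have := abs_le.1 h
  rw [abs_le, ← Real.arctan_neg]
  exact ⟨Real.arctan_strictMono.monotone this.1, Real.arctan_strictMono.monotone this.2⟩

/-- The operator with kernel `K / 2π` on `[-q, q]` is a contraction for the sup norm. -/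
lemma exists_kernel_contraction {ζ : ℝ} (hs : Real.sin ζ ≠ 0) :
    ∃ ρ : ℝ, 0 ≤ ρ ∧ ρ < 1 ∧ ∀ q, 0 < q → ∀ x,
      ∫ y in (-q)..q, |realKernel ζ (x - y)| ≤ 2 * π * ρ := by
  set A := Real.arctan |Real.cos ζ / Real.sin ζ| with hA
  have hA0 : 0 ≤ A := Real.arctan_nonneg.2 (abs_nonneg _)
  have hA1 : A < π / 2 := Real.arctan_lt_pi_div_two _
  have hπ := Real.pi_pos
  refine ⟨4 * A / (2 * π), by positivity, by rw [div_lt_one (by positivity)]; linarith,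
    fun q hq x => ?_⟩
  rw [mul_div_cancel₀ _ (by positivity)]
  have hcont : Continuous (realKernel ζ) := (contDiff_realKernel hs (n := 0)).continuous
  have habs : ∫ y in (-q)..q, |realKernel ζ (x - y)| = |∫ y in (-q)..q, realKernel ζ (x - y)| := by
    have hk : ∀ z, realKernel ζ z = Real.sin (2 * ζ) * (Real.sinh z ^ 2 + Real.sin ζ ^ 2)⁻¹ :=
      fun z => div_eq_mul_inv _ _
    have hk2 : ∀ z, |realKernel ζ z| = |Real.sin (2 * ζ)| * (Real.sinh z ^ 2 + Real.sin ζ ^ 2)⁻¹ :=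
      fun z => by rw [hk, abs_mul, abs_of_nonneg (inv_nonneg.2 (sinh_sq_add_sq_pos hs z).le)]
    simp only [hk2]
    simp only [hk, intervalIntegral.integral_const_mul, abs_mul]
    congr 1
    refine (abs_of_nonneg ?_).symm
    exact intervalIntegral.integral_nonneg (by linarith)
      fun u _ => inv_nonneg.2 (sinh_sq_add_sq_pos hs _).le
  rw [habs, intervalIntegral.integral_comp_sub_left (fun z => realKernel ζ z) x,
    intervalIntegral.integral_eq_sub_of_hasDerivAt
      (fun z _ => hasDerivAt_two_mul_arctan_cot_mul_tanh hs z) (hcont.intervalIntegrable _ _)]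
  have h1 := abs_le.1 (abs_arctan_cot_mul_tanh_le ζ (x - q))
  have h2 := abs_le.1 (abs_arctan_cot_mul_tanh_le ζ (x - -q))
  rw [abs_le]
  constructor <;> linarith [h1.1, h1.2, h2.1, h2.2]

/-- Uniqueness for the dressing equation: `1 + K / 2π` on `[-q, q]` is injective on bounded
functions. -/
lemma eq_zero_of_kernel_equation {ζ q : ℝ} (hs : Real.sin ζ ≠ 0) (hq : 0 < q) {u : ℝ → ℝ} {M : ℝ}
    (hM : ∀ x, |u x| ≤ M)
    (hu : ∀ x, u x + (∫ y in (-q)..q, realKernel ζ (x - y) * u y) / (2 * π) = 0) (x : ℝ) :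
    u x = 0 := by
  obtain ⟨ρ, hρ0, hρ1, hρ⟩ := exists_kernel_contraction hs
  have hcont : Continuous (realKernel ζ) := (contDiff_realKernel hs (n := 0)).continuous
  have hM0 : 0 ≤ M := (abs_nonneg _).trans (hM 0)
  have hπ := Real.pi_pos
  have hstep : ∀ N : ℝ, 0 ≤ N → (∀ x, |u x| ≤ N) → ∀ x, |u x| ≤ ρ * N := fun N hN0 hN x => by
    have h1 : ‖∫ y in (-q)..q, realKernel ζ (x - y) * u y‖
        ≤ ∫ y in (-q)..q, |realKernel ζ (x - y)| * N := by
      refine intervalIntegral.norm_integral_le_of_norm_le (by linarith)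
        (Eventually.of_forall fun y _ => ?_)
        (Continuous.intervalIntegrable (by fun_prop) _ _)
      rw [norm_mul, Real.norm_eq_abs, Real.norm_eq_abs]
      exact mul_le_mul_of_nonneg_left (hN y) (abs_nonneg _)
    rw [intervalIntegral.integral_mul_const] at h1
    have h2 : ‖∫ y in (-q)..q, realKernel ζ (x - y) * u y‖ ≤ 2 * π * ρ * N :=
      h1.trans (mul_le_mul_of_nonneg_right (hρ q hq x) hN0)
    rw [eq_neg_of_add_eq_zero_left (hu x), abs_neg, abs_div, abs_of_pos (a := 2 * π) (by positivity),
      div_le_iff₀ (by positivity)]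
    rw [Real.norm_eq_abs] at h2
    linarith
  have hiter : ∀ n : ℕ, ∀ x, |u x| ≤ ρ ^ n * M := fun n => by
    induction n with
    | zero => simpa using hM
    | succ n ih =>
      intro x
      rw [pow_succ', mul_assoc]
      exact hstep _ (by positivity) ih x
  have hlim : Tendsto (fun n : ℕ => ρ ^ n * M) atTop (𝓝 0) := by
    simpa using (tendsto_pow_atTop_nhds_zero_of_lt_one hρ0 hρ1).mul_const M
  exact abs_nonpos_iff.1 (ge_of_tendsto' hlim fun n => hiter n x)

lemma contDiff_intervalIntegral_comp_sub_mul {k u : ℝ → ℝ} {a b : ℝ} (hu : Continuous u) (n : ℕ) :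
    ContDiff ℝ n k → ContDiff ℝ n fun x => ∫ y in a..b, k (x - y) * u y := by
  induction n generalizing k with
  | zero =>
    intro hk
    have hk := hk.continuous
    refine contDiff_zero.2 ?_
    exact intervalIntegral.continuous_parametric_intervalIntegral_of_continuous' (by fun_prop) a b
  | succ n ih =>
    intro hk
    have hk1 : ContDiff ℝ (n + 1) k := by exact_mod_cast hk
    obtain ⟨hd, -, hk'⟩ := contDiff_succ_iff_deriv.1 hk1
    have hkc := hk.continuous
    have hkc' := hk'.continuous
    have hder : ∀ x, HasDerivAt (fun x => ∫ y in a..b, k (x - y) * u y)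
        (∫ y in a..b, deriv k (x - y) * u y) x := fun x => by
      have hc2 : Continuous fun p : ℝ × ℝ => deriv k (p.1 - p.2) * u p.2 := by fun_prop
      obtain ⟨C, hC⟩ := ((isCompact_Icc (a := x - 1) (b := x + 1)).prod
        (isCompact_uIcc (a := a) (b := b))).exists_bound_of_continuousOn hc2.continuousOn
      refine (intervalIntegral.hasDerivAt_integral_of_dominated_loc_of_deriv_le
        (F := fun x y => k (x - y) * u y) (F' := fun x y => deriv k (x - y) * u y)
        (bound := fun _ => C) (s := Icc (x - 1) (x + 1))
        (Icc_mem_nhds (by linarith) (by linarith)) (Eventually.of_forall fun x => ?_) ?_ ?_ ?_ ?_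
        ?_).2
      · exact Continuous.aestronglyMeasurable (by fun_prop)
      · exact Continuous.intervalIntegrable (by fun_prop) _ _
      · exact Continuous.aestronglyMeasurable (by fun_prop)
      · exact Eventually.of_forall fun y hy x hx => hC (x, y) ⟨hx, uIoc_subset_uIcc hy⟩
      · exact Continuous.intervalIntegrable (by fun_prop) _ _
      · exact Eventually.of_forall fun y _ x _ =>
          ((hd (x - y)).hasDerivAt.comp_sub_const x y).mul_const _
    have : ContDiff ℝ (n + 1) fun x => ∫ y in a..b, k (x - y) * u y := by
      refine contDiff_succ_iff_deriv.2 ⟨fun x => (hder x).differentiableAt, by simp, ?_⟩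
      rw [show deriv (fun x => ∫ y in a..b, k (x - y) * u y)
        = fun x => ∫ y in a..b, deriv k (x - y) * u y from funext fun x => (hder x).deriv]
      exact ih hk'
    exact_mod_cast this

/-! ### The dressed energy -/

/-- The remainder of the low-temperature expansion of `E T` up to order `T²`. -/
noncomputable def expansionRem (E : ℝ → ℝ → ℂ) (ε₀ ε₁ ε₂ : ℝ → ℝ) (T x : ℝ) : ℂ :=
  E T x - ((ε₀ x : ℂ) + T * (ε₁ x : ℂ) + (T : ℂ) ^ 2 * (ε₂ x : ℂ))

/-- The properties of a family `E T` of energy functions on the real line used for the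
low-temperature analysis: the expansion, the Yang-Yang type equation up to `O(T^∞)`, and the
signs of the leading term. -/
structure LowTempFamily (J h ζ q : ℝ) (E : ℝ → ℝ → ℂ) (ε₀ ε₁ ε₂ : ℝ → ℝ) : Prop where
  sin_ne : Real.sin ζ ≠ 0
  sin_half_ne : Real.sin (ζ / 2) ≠ 0
  h_pos : 0 < h
  q_pos : 0 < q
  continuous : ∀ᶠ T : ℝ in 𝓝[>] (0 : ℝ), Continuous (E T)
  integrable_one : Integrable ε₁
  integrable_two : Integrable ε₂
  bounded : ∃ M : ℝ, ∀ x, |ε₁ x| ≤ M ∧ |ε₂ x| ≤ M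
  expansion : ∃ C : ℝ, ∀ᶠ T : ℝ in 𝓝[>] (0 : ℝ),
    (∀ x, ‖expansionRem E ε₀ ε₁ ε₂ T x‖ ≤ C * T ^ 3) ∧
    Integrable (expansionRem E ε₀ ε₁ ε₂ T) ∧
    ∫ x, ‖expansionRem E ε₀ ε₁ ε₂ T x‖ ≤ C * T ^ 3
  yangYang : ∃ C : ℝ, ∀ᶠ T : ℝ in 𝓝[>] (0 : ℝ), ∀ x : ℝ,
    ‖E T x - ((realBareEnergy J h ζ x : ℂ) + T * ((∫ y : ℝ, (realKernel ζ (x - y) : ℂ)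
      * logOneAddExp (-E T y / T)) / (2 * π)))‖ ≤ C * T ^ 3
  neg : ∀ x : ℝ, |x| < q → ε₀ x < 0
  pos : ∀ x : ℝ, q < |x| → 0 < ε₀ x
  deriv_ne : deriv ε₀ q ≠ 0

/-- The difference between `T ln (1 + e^{-E/T})` and its zero-temperature limit, the negative
part of `E`; the latter is cut off at the Fermi points `±q` of the limit. -/
noncomputable def thermalExcess (q : ℝ) (E : ℝ → ℝ → ℂ) (T y : ℝ) : ℂ :=
  T * logOneAddExp (-E T y / T) + (Icc (-q) q).indicator (E T) y

/-- The zero-temperature operator `1 + K / 2π` on `[-q, q]`. -/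
noncomputable def dressOp (ζ q : ℝ) (g : ℝ → ℂ) (x : ℝ) : ℂ :=
  g x + (∫ y in (-q)..q, (realKernel ζ (x - y) : ℂ) * g y) / (2 * π)

lemma continuous_realKernel {ζ : ℝ} (hs : Real.sin ζ ≠ 0) : Continuous (realKernel ζ) :=
  (contDiff_realKernel hs (n := 0)).continuous

lemma continuous_ofReal_realKernel_sub {ζ : ℝ} (hs : Real.sin ζ ≠ 0) (x : ℝ) :
    Continuous fun y => (realKernel ζ (x - y) : ℂ) := by
  have := continuous_realKernel hs
  fun_prop

lemma norm_dressOp_le {ζ q : ℝ} (hs : Real.sin ζ ≠ 0) (hq : 0 < q) {g : ℝ → ℂ} {M : ℝ}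
    (hM : ∀ x, ‖g x‖ ≤ M) (x : ℝ) : ‖dressOp ζ q g x‖ ≤ 2 * M := by
  obtain ⟨ρ, hρ0, hρ1, hρ⟩ := exists_kernel_contraction hs
  have hcont := continuous_realKernel hs
  have hM0 : 0 ≤ M := (norm_nonneg _).trans (hM 0)
  have hπ := Real.pi_pos
  have h1 : ‖∫ y in (-q)..q, (realKernel ζ (x - y) : ℂ) * g y‖
      ≤ ∫ y in (-q)..q, |realKernel ζ (x - y)| * M := by
    refine intervalIntegral.norm_integral_le_of_norm_le (by linarith)
      (Eventually.of_forall fun y _ => ?_) (Continuous.intervalIntegrable (by fun_prop) _ _)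
    rw [norm_mul, norm_real, Real.norm_eq_abs]
    exact mul_le_mul_of_nonneg_left (hM y) (abs_nonneg _)
  rw [intervalIntegral.integral_mul_const] at h1
  have h2 : ‖(∫ y in (-q)..q, (realKernel ζ (x - y) : ℂ) * g y) / (2 * π)‖ ≤ M := by
    rw [norm_div, show ‖(2 * π : ℂ)‖ = 2 * π by
      rw [norm_mul, norm_real, Real.norm_of_nonneg hπ.le]; norm_num, div_le_iff₀ (by positivity)]
    refine h1.trans ?_
    have h3 := mul_le_mul_of_nonneg_right (hρ q hq x) hM0
    have h4 : 2 * π * ρ * M ≤ 2 * π * 1 * M := by gcongr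
    linarith
  calc _ ≤ ‖g x‖ + M := (norm_add_le _ _).trans (by gcongr)
    _ ≤ _ := by linarith [hM x]

lemma intervalIntegrable_kernel_mul {ζ q : ℝ} (hs : Real.sin ζ ≠ 0) (x : ℝ) {g : ℝ → ℂ}
    (hg : IntervalIntegrable g volume (-q) q) :
    IntervalIntegrable (fun y => (realKernel ζ (x - y) : ℂ) * g y) volume (-q) q :=
  hg.continuousOn_mul (continuous_ofReal_realKernel_sub hs x).continuousOn

lemma dressOp_add {ζ q : ℝ} (hs : Real.sin ζ ≠ 0) {f g : ℝ → ℂ}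
    (hf : IntervalIntegrable f volume (-q) q) (hg : IntervalIntegrable g volume (-q) q) (x : ℝ) :
    dressOp ζ q (fun y => f y + g y) x = dressOp ζ q f x + dressOp ζ q g x := by
  simp only [dressOp, mul_add]
  rw [intervalIntegral.integral_add (intervalIntegrable_kernel_mul hs x hf)
    (intervalIntegrable_kernel_mul hs x hg)]
  ring

lemma dressOp_const_mul (ζ q : ℝ) (c : ℂ) (f : ℝ → ℂ) (x : ℝ) :
    dressOp ζ q (fun y => c * f y) x = c * dressOp ζ q f x := by
  simp only [dressOp, mul_left_comm _ c, intervalIntegral.integral_const_mul]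
  ring

lemma dressOp_ofReal (ζ q : ℝ) (u : ℝ → ℝ) (x : ℝ) :
    dressOp ζ q (fun y => (u y : ℂ)) x
      = ((u x + (∫ y in (-q)..q, realKernel ζ (x - y) * u y) / (2 * π) : ℝ) : ℂ) := by
  simp only [dressOp]
  push_cast
  rw [← intervalIntegral.integral_ofReal]
  push_cast
  rfl

namespace LowTempFamily

variable {J h ζ q : ℝ} {E : ℝ → ℝ → ℂ} {ε₀ ε₁ ε₂ : ℝ → ℝ}

lemma exists_close (H : LowTempFamily J h ζ q E ε₀ ε₁ ε₂) :
    ∃ C : ℝ, 0 ≤ C ∧ ∀ᶠ T : ℝ in 𝓝[>] (0 : ℝ), 0 < T ∧ T ≤ 1 ∧ Continuous (E T) ∧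
      (∀ x, ‖E T x - ε₀ x‖ ≤ C * T) ∧ (∀ x, |(E T x / T).im| ≤ 1) ∧
      (∀ x, ‖expansionRem E ε₀ ε₁ ε₂ T x‖ ≤ C * T ^ 3) ∧
      Integrable (expansionRem E ε₀ ε₁ ε₂ T) ∧
      ∫ x, ‖expansionRem E ε₀ ε₁ ε₂ T x‖ ≤ C := by
  obtain ⟨C, hC⟩ := H.expansion
  obtain ⟨M, hM⟩ := H.bounded
  have hM0 : 0 ≤ M := (abs_nonneg _).trans (hM 0).1
  refine ⟨2 * M + |C|, by positivity, ?_⟩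
  have hsmall : ∀ᶠ T : ℝ in 𝓝[>] (0 : ℝ), T < 1 / (1 + |C|) :=
    mem_nhdsWithin_of_mem_nhds (Iio_mem_nhds (by positivity))
  have hsmall1 : ∀ᶠ T : ℝ in 𝓝[>] (0 : ℝ), T < 1 :=
    mem_nhdsWithin_of_mem_nhds (Iio_mem_nhds (by positivity))
  filter_upwards [hC, H.continuous, self_mem_nhdsWithin, hsmall, hsmall1]
    with T ⟨h1, h2, h3⟩ hcont hT hTs hT1
  have hT : 0 < T := hT
  have hCT : C * T ^ 3 ≤ |C| * T ^ 3 := by gcongr; exact le_abs_self C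
  have hT2 : T ^ 2 ≤ T := by nlinarith
  have hT3 : T ^ 3 ≤ T := by nlinarith [pow_pos hT 2]
  have hT3' : T ^ 3 ≤ 1 := hT3.trans hT1.le
  have hdecomp : ∀ x, E T x - ε₀ x
      = expansionRem E ε₀ ε₁ ε₂ T x + (T * (ε₁ x : ℂ) + (T : ℂ) ^ 2 * (ε₂ x : ℂ)) :=
    fun x => by rw [expansionRem]; ring
  have hbd : ∀ x, ‖(T * (ε₁ x : ℂ) + (T : ℂ) ^ 2 * (ε₂ x : ℂ))‖ ≤ 2 * M * T := fun x => by
    refine (norm_add_le _ _).trans ?_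
    rw [norm_mul, norm_mul, norm_pow, norm_real, norm_real, norm_real, Real.norm_of_nonneg hT.le,
      Real.norm_eq_abs, Real.norm_eq_abs]
    have := hM x
    have h5 : T * |ε₁ x| ≤ T * M := by gcongr; exact this.1
    have h6 : T ^ 2 * |ε₂ x| ≤ T * M := by gcongr; exact this.2
    linarith
  refine ⟨hT, hT1.le, hcont, fun x => ?_, fun x => ?_, fun x => ?_, h2, ?_⟩
  · rw [hdecomp]
    refine (norm_add_le _ _).trans ?_
    have h4 : |C| * T ^ 3 ≤ |C| * T := by gcongr
    linarith [h1 x, hbd x]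
  · rw [div_ofReal_im, abs_div, abs_of_pos hT, div_le_one hT]
    have him : (E T x).im = (expansionRem E ε₀ ε₁ ε₂ T x).im := by
      have : (E T x) = expansionRem E ε₀ ε₁ ε₂ T x
        + ((ε₀ x + T * ε₁ x + T ^ 2 * ε₂ x : ℝ) : ℂ) := by
        rw [expansionRem]; push_cast; ring
      rw [this, add_im, ofReal_im, add_zero]
    rw [him]
    refine (abs_im_le_norm _).trans ((h1 x).trans (hCT.trans ?_))
    have h5 : |C| * T ≤ 1 := by
      rw [lt_div_iff₀ (by positivity)] at hTs
      nlinarith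
    calc |C| * T ^ 3 = (|C| * T) * T ^ 2 := by ring
      _ ≤ 1 * T := by gcongr
      _ = T := one_mul T
  · refine (h1 x).trans (hCT.trans ?_)
    gcongr
    linarith
  · refine h3.trans (hCT.trans ?_)
    have : |C| * T ^ 3 ≤ |C| * 1 := by gcongr
    linarith

lemma continuous_zero (H : LowTempFamily J h ζ q E ε₀ ε₁ ε₂) : Continuous ε₀ := by
  obtain ⟨C, hC0, hC⟩ := H.exists_close
  have hu : TendstoUniformly E (fun x => (ε₀ x : ℂ)) (𝓝[>] 0) := by
    rw [Metric.tendstoUniformly_iff]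
    intro δ hδ
    have hlim : Tendsto (fun T : ℝ => C * T) (𝓝[>] 0) (𝓝 0) := by
      have : Tendsto (fun T : ℝ => C * T) (𝓝 0) (𝓝 (C * 0)) :=
        (continuous_const.mul continuous_id).tendsto 0
      rw [mul_zero] at this
      exact this.mono_left nhdsWithin_le_nhds
    filter_upwards [hC, hlim.eventually (gt_mem_nhds hδ)] with T hT hTδ x
    rw [dist_comm, dist_eq_norm]
    exact (hT.2.2.2.1 x).trans_lt hTδ
  have hc := hu.continuous (hC.mono fun T hT => hT.2.2.1).frequently
  have : ε₀ = fun x => ((ε₀ x : ℂ)).re := by simp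
  rw [this]
  exact continuous_re.comp hc

lemma zero_at_fermi (H : LowTempFamily J h ζ q E ε₀ ε₁ ε₂) {p : ℝ} (hp : |p| = q) :
    ε₀ p = 0 := by
  have hq := H.q_pos
  have hp0 : p ≠ 0 := fun h => by rw [h, abs_zero] at hp; linarith
  have hlim : ∀ c : ℝ, Tendsto (fun t : ℝ => ε₀ ((1 + c * t) * p)) (𝓝[>] 0) (𝓝 (ε₀ p)) := by
    intro c
    have hc : Continuous fun t : ℝ => ε₀ ((1 + c * t) * p) := by
      have := H.continuous_zero
      fun_prop
    have := hc.tendsto 0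
    simp only [mul_zero, add_zero, one_mul] at this
    exact this.mono_left nhdsWithin_le_nhds
  have h1 : ∀ᶠ t in 𝓝[>] (0 : ℝ), 0 < t ∧ t < 1 := by
    filter_upwards [self_mem_nhdsWithin, mem_nhdsWithin_of_mem_nhds (Iio_mem_nhds one_pos)]
      with t h1 h2 using ⟨h1, h2⟩
  refine le_antisymm (le_of_tendsto (hlim (-1)) (h1.mono fun t ht => (H.neg _ ?_).le))
    (ge_of_tendsto (hlim 1) (h1.mono fun t ht => (H.pos _ ?_).le))
  · rw [abs_mul, hp, abs_of_pos (by linarith [ht.2])]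
    nlinarith [ht.1]
  · rw [abs_mul, hp, abs_of_pos (by linarith [ht.1])]
    nlinarith [ht.1]

lemma nonpos_of_mem (H : LowTempFamily J h ζ q E ε₀ ε₁ ε₂) {x : ℝ} (hx : |x| ≤ q) :
    ε₀ x ≤ 0 := by
  rcases hx.lt_or_eq with h | h
  · exact (H.neg x h).le
  · exact (H.zero_at_fermi h).le

/-- The thermal excess is concentrated near the Fermi points. -/
lemma exists_norm_thermalExcess_le (H : LowTempFamily J h ζ q E ε₀ ε₁ ε₂) :
    ∃ C : ℝ, 0 ≤ C ∧ ∀ᶠ T : ℝ in 𝓝[>] (0 : ℝ), ∀ x,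
      ‖thermalExcess q E T x‖ ≤ C * T * Real.exp (-(|ε₀ x| / T)) := by
  obtain ⟨C, hC0, hC⟩ := H.exists_close
  refine ⟨Real.exp C, (Real.exp_pos _).le, hC.mono fun T ⟨hT, _, _, hcl, him, _⟩ x => ?_⟩
  have hT0 : (T : ℂ) ≠ 0 := ofReal_ne_zero.2 hT.ne'
  have hre : |(E T x / T).re - ε₀ x / T| ≤ C := by
    rw [div_ofReal_re, ← sub_div, abs_div, abs_of_pos hT, div_le_iff₀ hT]
    have := (abs_re_le_norm (E T x - ε₀ x)).trans (hcl x)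
    simpa using this
  have hre := abs_le.1 hre
  have hneg : -E T x / T = -(E T x / T) := neg_div _ _
  rw [thermalExcess, hneg, logOneAddExp_neg_eq (him x)]
  have hfin : ∀ v : ℂ, |v.im| ≤ 1 → -v.re ≤ C - |ε₀ x| / T →
      ‖(T : ℂ) * logOneAddExpNeg v‖ ≤ Real.exp C * T * Real.exp (-(|ε₀ x| / T)) := by
    intro v hv hv'
    rw [norm_mul, norm_real, Real.norm_of_nonneg hT.le]
    calc T * ‖logOneAddExpNeg v‖ ≤ T * Real.exp (C - |ε₀ x| / T) := by
          gcongr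
          exact (norm_logOneAddExpNeg_le hv).trans (Real.exp_le_exp.2 hv')
      _ = _ := by rw [sub_eq_add_neg, Real.exp_add]; ring
  by_cases hx : x ∈ Icc (-q) q
  · rw [indicator_of_mem hx, logOneAddExpNeg_eq_neg_add (him x)]
    have habs : |ε₀ x| = -ε₀ x := abs_of_nonpos (H.nonpos_of_mem (abs_le.2 hx))
    have : (T : ℂ) * (-(E T x / T) + logOneAddExpNeg (-(E T x / T))) + E T x
        = T * logOneAddExpNeg (-(E T x / T)) := by
      field_simp; ring
    rw [this]
    refine hfin _ (by simpa using him x) ?_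
    rw [habs, neg_re, neg_neg, neg_div]
    linarith [hre.2]
  · rw [indicator_of_notMem hx, add_zero]
    have habs : |ε₀ x| = ε₀ x :=
      abs_of_pos (H.pos x (lt_of_not_ge fun h => hx (abs_le.1 h)))
    refine hfin _ (him x) ?_
    rw [habs]
    linarith [hre.1]

lemma measurable_thermalExcess {T : ℝ} (hE : Continuous (E T)) :
    Measurable (thermalExcess q E T) := by
  have h1 : Measurable fun y => -E T y / (T : ℂ) := by fun_prop
  exact ((measurable_logOneAddExp.comp h1).const_mul _).add
    (hE.measurable.indicator measurableSet_Icc)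

lemma integrable_ofReal_realKernel_sub (hs : Real.sin ζ ≠ 0) (x : ℝ) :
    Integrable fun y => (realKernel ζ (x - y) : ℂ) :=
  ((integrable_realKernel hs).comp_sub_left x).ofReal

lemma integrable_kernel_mul_thermalExcess (H : LowTempFamily J h ζ q E ε₀ ε₁ ε₂) :
    ∀ᶠ T : ℝ in 𝓝[>] (0 : ℝ), ∀ x,
      Integrable fun y => (realKernel ζ (x - y) : ℂ) * thermalExcess q E T y := by
  obtain ⟨C, hC0, hC⟩ := H.exists_norm_thermalExcess_le
  filter_upwards [hC, H.continuous, self_mem_nhdsWithin] with T hT hcont hT0 x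
  have hT0 : 0 < T := hT0
  refine (integrable_ofReal_realKernel_sub H.sin_ne x).mul_bdd (c := C * T)
    (measurable_thermalExcess hcont).aestronglyMeasurable (Eventually.of_forall fun y => ?_)
  refine (hT y).trans (mul_le_of_le_one_right (by positivity) (Real.exp_le_one_iff.2 ?_))
  rw [neg_nonpos]
  positivity

/-- The Yang-Yang type equation in terms of the zero-temperature operator: the thermal excess
acts as a source. -/
lemma exists_dressOp_expansion (H : LowTempFamily J h ζ q E ε₀ ε₁ ε₂) :
    ∃ C : ℝ, 0 ≤ C ∧ ∀ᶠ T : ℝ in 𝓝[>] (0 : ℝ), ∀ x,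
      ‖(dressOp ζ q (fun y => (ε₀ y : ℂ)) x - realBareEnergy J h ζ x)
        + T * dressOp ζ q (fun y => (ε₁ y : ℂ)) x
        + (T : ℂ) ^ 2 * dressOp ζ q (fun y => (ε₂ y : ℂ)) x
        - (∫ y, (realKernel ζ (x - y) : ℂ) * thermalExcess q E T y) / (2 * π)‖ ≤ C * T ^ 3 := by
  obtain ⟨C, hC⟩ := H.yangYang
  obtain ⟨C₁, hC₁0, hC₁⟩ := H.exists_close
  refine ⟨|C| + 2 * C₁, by positivity, ?_⟩
  filter_upwards [hC, hC₁, H.integrable_kernel_mul_thermalExcess]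
    with T hyy ⟨hT, _, hcont, hcl, him, hrem, hremint, _⟩ hint x
  have hs := H.sin_ne
  have hT0 : (T : ℂ) ≠ 0 := ofReal_ne_zero.2 hT.ne'
  have hind : ∀ y, (Icc (-q) q).indicator (fun y => (realKernel ζ (x - y) : ℂ) * E T y) y
      = (realKernel ζ (x - y) : ℂ) * (Icc (-q) q).indicator (E T) y := fun y => by
    by_cases hy : y ∈ Icc (-q) q <;> simp [hy]
  have hEint : IntervalIntegrable (E T) volume (-q) q := hcont.intervalIntegrable _ _
  have hindint : Integrable fun y => (realKernel ζ (x - y) : ℂ) * (Icc (-q) q).indicator (E T) y := by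
    simp only [← hind]
    rw [integrable_indicator_iff measurableSet_Icc]
    exact (Continuous.continuousOn ((continuous_ofReal_realKernel_sub hs x).mul
      hcont)).integrableOn_compact isCompact_Icc
  have hval : ∫ y, (realKernel ζ (x - y) : ℂ) * (Icc (-q) q).indicator (E T) y
      = ∫ y in (-q)..q, (realKernel ζ (x - y) : ℂ) * E T y := by
    simp only [← hind]
    rw [integral_indicator measurableSet_Icc, integral_Icc_eq_integral_Ioc,
      intervalIntegral.integral_of_le (by linarith [H.q_pos])]
  -- the Yang-Yang integral is the excess minus the zero-temperature part
  have hsplit : (T : ℂ) * (∫ y, (realKernel ζ (x - y) : ℂ) * logOneAddExp (-E T y / T))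
      = (∫ y, (realKernel ζ (x - y) : ℂ) * thermalExcess q E T y)
        - ∫ y in (-q)..q, (realKernel ζ (x - y) : ℂ) * E T y := by
    rw [← hval, ← integral_sub (hint x) hindint, ← integral_const_mul]
    refine integral_congr_ae (Eventually.of_forall fun y => ?_)
    simp only [thermalExcess]
    ring
  have hone : IntervalIntegrable (fun y => (ε₁ y : ℂ)) volume (-q) q :=
    H.integrable_one.ofReal.intervalIntegrable
  have htwo : IntervalIntegrable (fun y => (ε₂ y : ℂ)) volume (-q) q :=
    H.integrable_two.ofReal.intervalIntegrable
  have hzero : IntervalIntegrable (fun y => (ε₀ y : ℂ)) volume (-q) q :=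
    (continuous_ofReal.comp H.continuous_zero).intervalIntegrable _ _
  have hlin : dressOp ζ q (E T) x = dressOp ζ q (fun y => (ε₀ y : ℂ)) x
      + T * dressOp ζ q (fun y => (ε₁ y : ℂ)) x
      + (T : ℂ) ^ 2 * dressOp ζ q (fun y => (ε₂ y : ℂ)) x
      + dressOp ζ q (expansionRem E ε₀ ε₁ ε₂ T) x := by
    rw [← dressOp_const_mul, ← dressOp_const_mul, ← dressOp_add hs hzero (hone.const_mul _),
      ← dressOp_add hs (hzero.add (hone.const_mul _)) (htwo.const_mul _),
      ← dressOp_add hs ((hzero.add (hone.const_mul _)).add (htwo.const_mul _))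
        hremint.intervalIntegrable]
    congr 1
    funext y
    rw [expansionRem]
    ring
  have hkey : (dressOp ζ q (fun y => (ε₀ y : ℂ)) x - realBareEnergy J h ζ x)
        + T * dressOp ζ q (fun y => (ε₁ y : ℂ)) x
        + (T : ℂ) ^ 2 * dressOp ζ q (fun y => (ε₂ y : ℂ)) x
        - (∫ y, (realKernel ζ (x - y) : ℂ) * thermalExcess q E T y) / (2 * π)
      = (E T x - ((realBareEnergy J h ζ x : ℂ) + T * ((∫ y : ℝ, (realKernel ζ (x - y) : ℂ)
      * logOneAddExp (-E T y / T)) / (2 * π)))) - dressOp ζ q (expansionRem E ε₀ ε₁ ε₂ T) x := by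
    have h1 : dressOp ζ q (E T) x
      = E T x + (∫ y in (-q)..q, (realKernel ζ (x - y) : ℂ) * E T y) / (2 * π) := rfl
    linear_combination h1 - hlin + hsplit / (2 * π)
  rw [hkey]
  refine (norm_sub_le _ _).trans ?_
  have h1 := norm_dressOp_le hs H.q_pos hrem x
  have h2 := hyy x
  have h3 : C * T ^ 3 ≤ |C| * T ^ 3 := by gcongr; exact le_abs_self C
  nlinarith

lemma norm_dressOp_ofReal_le (H : LowTempFamily J h ζ q E ε₀ ε₁ ε₂) : ∃ M, 0 ≤ M ∧
    ∀ x, ‖dressOp ζ q (fun y => (ε₁ y : ℂ)) x‖ ≤ M ∧ ‖dressOp ζ q (fun y => (ε₂ y : ℂ)) x‖ ≤ M := by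
  obtain ⟨M, hM⟩ := H.bounded
  refine ⟨2 * M, ?_, fun x => ⟨?_, ?_⟩⟩
  · linarith [(abs_nonneg _).trans (hM 0).1]
  · exact norm_dressOp_le H.sin_ne H.q_pos (fun y => by simpa using (hM y).1) x
  · exact norm_dressOp_le H.sin_ne H.q_pos (fun y => by simpa using (hM y).2) x

lemma eq_zero_of_eventually_norm_le {z : ℂ} {C : ℝ} (hz : ∀ᶠ T : ℝ in 𝓝[>] (0 : ℝ), ‖z‖ ≤ C * T) :
    z = 0 := by
  have hlim : Tendsto (fun T : ℝ => C * T) (𝓝[>] 0) (𝓝 0) := by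
    have : Tendsto (fun T : ℝ => C * T) (𝓝 0) (𝓝 (C * 0)) :=
      (continuous_const.mul continuous_id).tendsto 0
    rw [mul_zero] at this
    exact this.mono_left nhdsWithin_le_nhds
  exact norm_le_zero_iff.1 (ge_of_tendsto hlim hz)

lemma norm_two_mul_pi : ‖(2 * π : ℂ)‖ = 2 * π := by
  rw [norm_mul, norm_real, Real.norm_of_nonneg Real.pi_pos.le]; norm_num

/-- The leading order `ε₀` solves the dressing equation. -/
lemma dressing_equation (H : LowTempFamily J h ζ q E ε₀ ε₁ ε₂) (x : ℝ) :
    ε₀ x + (∫ y in (-q)..q, realKernel ζ (x - y) * ε₀ y) / (2 * π) = realBareEnergy J h ζ x := by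
  obtain ⟨C, hC0, hC⟩ := H.exists_dressOp_expansion
  obtain ⟨C₁, hC₁0, hC₁⟩ := H.exists_norm_thermalExcess_le
  obtain ⟨M, hM0, hM⟩ := H.norm_dressOp_ofReal_le
  set B := ∫ y, ‖(realKernel ζ (x - y) : ℂ)‖ with hB
  have hB0 : 0 ≤ B := integral_nonneg fun _ => norm_nonneg _
  have hπ := Real.pi_pos
  have key : dressOp ζ q (fun y => (ε₀ y : ℂ)) x - realBareEnergy J h ζ x = 0 := by
    refine eq_zero_of_eventually_norm_le (C := C + M + M + B * C₁ / (2 * π)) ?_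
    filter_upwards [hC, hC₁, self_mem_nhdsWithin,
      mem_nhdsWithin_of_mem_nhds (Iio_mem_nhds one_pos)] with T h1 h2 hT hT1
    have hT : 0 < T := hT
    have hT1 : T < 1 := hT1
    have h3 : ‖∫ y, (realKernel ζ (x - y) : ℂ) * thermalExcess q E T y‖ ≤ B * (C₁ * T) := by
      rw [hB, ← integral_mul_const]
      refine norm_integral_le_of_norm_le
        ((integrable_ofReal_realKernel_sub H.sin_ne x).norm.mul_const _)
        (Eventually.of_forall fun y => ?_)
      rw [norm_mul]
      gcongr
      refine (h2 y).trans (mul_le_of_le_one_right (by positivity) (Real.exp_le_one_iff.2 ?_))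
      rw [neg_nonpos]
      positivity
    have h4 : ‖(∫ y, (realKernel ζ (x - y) : ℂ) * thermalExcess q E T y) / (2 * π)‖
        ≤ B * C₁ / (2 * π) * T := by
      rw [norm_div, norm_two_mul_pi, div_mul_eq_mul_div]
      gcongr
      linarith
    have h5 : ‖(T : ℂ) * dressOp ζ q (fun y => (ε₁ y : ℂ)) x‖ ≤ M * T := by
      rw [norm_mul, norm_real, Real.norm_of_nonneg hT.le, mul_comm]
      exact mul_le_mul_of_nonneg_right (hM x).1 hT.le
    have h6 : ‖(T : ℂ) ^ 2 * dressOp ζ q (fun y => (ε₂ y : ℂ)) x‖ ≤ M * T := by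
      rw [norm_mul, norm_pow, norm_real, Real.norm_of_nonneg hT.le, mul_comm]
      exact mul_le_mul (hM x).2 (by nlinarith) (by positivity) hM0
    have h7 : C * T ^ 3 ≤ C * T := by
      gcongr
      nlinarith [pow_pos hT 2]
    have h8 := h1 x
    set A := dressOp ζ q (fun y => (ε₀ y : ℂ)) x - realBareEnergy J h ζ x
    set b := (T : ℂ) * dressOp ζ q (fun y => (ε₁ y : ℂ)) x
    set c := (T : ℂ) ^ 2 * dressOp ζ q (fun y => (ε₂ y : ℂ)) x
    set d := (∫ y, (realKernel ζ (x - y) : ℂ) * thermalExcess q E T y) / (2 * π)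
    calc ‖A‖ = ‖(A + b + c - d) - b - c + d‖ := by congr 1; ring
      _ ≤ ‖A + b + c - d‖ + ‖b‖ + ‖c‖ + ‖d‖ :=
        (norm_add_le _ _).trans (add_le_add_left ((norm_sub_le _ _).trans
          (add_le_add_left (norm_sub_le _ _) _)) _)
      _ ≤ _ := by linarith
  rw [sub_eq_zero, dressOp_ofReal] at key
  exact_mod_cast key

end LowTempFamily

/-! ### Regularity of the coefficients of the low-temperature expansion -/

lemma integral_exp_neg_mul_abs_sub {k : ℝ} (hk : 0 < k) (p : ℝ) :
    ∫ y : ℝ, Real.exp (-(k * |y - p|)) = 2 / k := by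
  rw [integral_sub_right_eq_self (fun y => Real.exp (-(k * |y|))) p,
    integral_comp_abs (f := fun y => Real.exp (-(k * y))), integral_exp_neg_mul_Ioi hk]
  ring

lemma integrable_exp_neg_mul_abs_sub {k : ℝ} (hk : 0 < k) (p : ℝ) :
    Integrable fun y : ℝ => Real.exp (-(k * |y - p|)) := by
  refine Integrable.of_integral_ne_zero ?_
  rw [integral_exp_neg_mul_abs_sub hk]
  positivity

lemma logOneAddInfty_nonneg (h T : ℝ) : 0 ≤ logOneAddInfty h T :=
  Real.log_nonneg (by linarith [Real.exp_pos (-h / T)])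

lemma logOneAddInfty_le (h T : ℝ) : logOneAddInfty h T ≤ Real.exp (-(h / T)) := by
  have := Real.log_le_sub_one_of_pos (x := 1 + Real.exp (-h / T)) (by positivity)
  rw [logOneAddInfty, ← neg_div]
  linarith

lemma ofReal_logOneAddInfty (h T : ℝ) :
    (logOneAddInfty h T : ℂ) = logOneAddExpNeg ((h / T : ℝ) : ℂ) := by
  rw [logOneAddExpNeg_ofReal, logOneAddInfty, neg_div]

lemma le_of_eventually_le_mul_add {a b C : ℝ} (hz : ∀ᶠ T : ℝ in 𝓝[>] (0 : ℝ), a ≤ C * T + b) :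
    a ≤ b := by
  have hlim : Tendsto (fun T : ℝ => C * T + b) (𝓝[>] 0) (𝓝 b) := by
    have : Tendsto (fun T : ℝ => C * T + b) (𝓝 0) (𝓝 (C * 0 + b)) :=
      Continuous.tendsto (by fun_prop) 0
    rw [mul_zero, zero_add] at this
    exact this.mono_left nhdsWithin_le_nhds
  exact ge_of_tendsto hlim hz

/-- The thermal excess with its limit at infinity subtracted. -/
noncomputable def thermalDensity (h q : ℝ) (E : ℝ → ℝ → ℂ) (T y : ℝ) : ℂ :=
  thermalExcess q E T y - T * logOneAddInfty h T

/-- An integrable bound on `E T - h`. -/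
noncomputable def energyWeight (h : ℝ) (E : ℝ → ℝ → ℂ) (ε₀ ε₁ ε₂ : ℝ → ℝ) (T y : ℝ) : ℝ :=
  |ε₀ y - h| + |ε₁ y| + |ε₂ y| + ‖expansionRem E ε₀ ε₁ ε₂ T y‖

namespace LowTempFamily

variable {J h ζ q : ℝ} {E : ℝ → ℝ → ℂ} {ε₀ ε₁ ε₂ : ℝ → ℝ}

lemma zero_eq (H : LowTempFamily J h ζ q E ε₀ ε₁ ε₂) :
    ε₀ = fun x => realBareEnergy J h ζ x
      - (∫ y in (-q)..q, realKernel ζ (x - y) * ε₀ y) / (2 * π) :=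
  funext fun x => by rw [← H.dressing_equation x]; ring

lemma contDiff_zero (H : LowTempFamily J h ζ q E ε₀ ε₁ ε₂) (n : ℕ) : ContDiff ℝ n ε₀ := by
  rw [H.zero_eq]
  exact (contDiff_realBareEnergy J h H.sin_half_ne).sub
    ((contDiff_intervalIntegral_comp_sub_mul H.continuous_zero n
      (contDiff_realKernel H.sin_ne)).div_const _)

lemma exists_abs_zero_sub_le (H : LowTempFamily J h ζ q E ε₀ ε₁ ε₂) :
    ∃ C, 0 ≤ C ∧ ∀ x, |ε₀ x - h| ≤ C * (1 + x ^ 2)⁻¹ := by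
  have hs := H.sin_ne
  have hs2 := H.sin_half_ne
  have hq := H.q_pos
  have hπ := Real.pi_pos
  obtain ⟨N, hN⟩ := (isCompact_Icc (a := -q) (b := q)).exists_bound_of_continuousOn
    H.continuous_zero.continuousOn
  have hN0 : 0 ≤ N := (norm_nonneg _).trans (hN 0 ⟨by linarith, by linarith⟩)
  set A := |2 * J * Real.sin ζ ^ 2| * (1 + (Real.sin (ζ / 2) ^ 2)⁻¹) with hA
  set B := (1 + (Real.sin ζ ^ 2)⁻¹) * (2 * (1 + q ^ 2)) * N * (2 * q) / (2 * π) with hB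
  have hA0 : 0 ≤ A := by positivity
  have hB0 : 0 ≤ B := by positivity
  refine ⟨A + B, by positivity, fun x => ?_⟩
  have h1 : |realBareEnergy J h ζ x - h| ≤ A * (1 + x ^ 2)⁻¹ := by
    rw [realBareEnergy, sub_sub_cancel_left, abs_neg, abs_div,
      abs_of_pos (sinh_sq_add_sq_pos hs2 x), div_eq_mul_inv, hA]
    exact (mul_le_mul_of_nonneg_left (inv_sinh_sq_add_sq_le hs2 x) (abs_nonneg _)).trans
      (le_of_eq (by ring))
  have h2 : |(∫ y in (-q)..q, realKernel ζ (x - y) * ε₀ y) / (2 * π)| ≤ B * (1 + x ^ 2)⁻¹ := by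
    have hb : ∀ y ∈ uIoc (-q) q, ‖realKernel ζ (x - y) * ε₀ y‖
        ≤ (1 + (Real.sin ζ ^ 2)⁻¹) * (2 * (1 + q ^ 2) * (1 + x ^ 2)⁻¹) * N := by
      intro y hy
      rw [uIoc_of_le (by linarith)] at hy
      rw [norm_mul]
      have hy2 : y ^ 2 ≤ q ^ 2 := sq_le_sq' hy.1.le hy.2
      have hinv : (1 + (x - y) ^ 2)⁻¹ ≤ 2 * (1 + q ^ 2) * (1 + x ^ 2)⁻¹ := by
        rw [← div_eq_mul_inv, inv_le_comm₀ (by positivity) (by positivity), inv_div,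
          div_le_iff₀ (by positivity)]
        nlinarith [sq_nonneg (x - 2 * y), sq_nonneg (x - y), sq_nonneg q,
          mul_nonneg (sq_nonneg (x - y)) (sq_nonneg q)]
      gcongr
      · exact (abs_realKernel_le hs _).trans (by gcongr)
      · exact hN y ⟨hy.1.le, hy.2⟩
    have h3 := intervalIntegral.norm_integral_le_of_norm_le_const hb
    rw [abs_div, abs_of_pos (a := 2 * π) (by positivity), div_le_iff₀ (by positivity)]
    rw [Real.norm_eq_abs, show q - -q = 2 * q by ring, abs_of_pos (a := 2 * q) (by linarith)] at h3
    refine h3.trans (le_of_eq ?_)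
    rw [hB]
    field_simp
  have h3 : ε₀ x - h = (realBareEnergy J h ζ x - h)
      - (∫ y in (-q)..q, realKernel ζ (x - y) * ε₀ y) / (2 * π) := by
    rw [← H.dressing_equation x]; ring
  rw [h3, add_mul]
  exact (abs_sub _ _).trans (add_le_add h1 h2)

/-- The dressed energy is even, by uniqueness for the dressing equation. -/
lemma zero_neg (H : LowTempFamily J h ζ q E ε₀ ε₁ ε₂) (x : ℝ) : ε₀ (-x) = ε₀ x := by
  have hs := H.sin_ne
  obtain ⟨C, hC0, hC⟩ := H.exists_abs_zero_sub_le
  have hk := continuous_realKernel hs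
  have hc := H.continuous_zero
  have hle : ∀ x, |ε₀ x - h| ≤ C := fun x =>
    (hC x).trans (mul_le_of_le_one_right hC0
      (inv_le_one_of_one_le₀ (by nlinarith [sq_nonneg x])))
  have key := eq_zero_of_kernel_equation (u := fun x => ε₀ x - ε₀ (-x)) (M := 2 * C) hs H.q_pos
    (fun x => ?_) (fun x => ?_) x
  · linarith
  · have h1 := abs_le.1 (hle x)
    have h2 := abs_le.1 (hle (-x))
    rw [abs_le]
    constructor <;> linarith [h1.1, h1.2, h2.1, h2.2]
  · have hrefl : ∫ y in (-q)..q, realKernel ζ (x - y) * ε₀ (-y)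
        = ∫ y in (-q)..q, realKernel ζ (-x - y) * ε₀ y := by
      have := intervalIntegral.integral_comp_neg (a := -q) (b := q)
        (fun y => realKernel ζ (-x - y) * ε₀ y)
      rw [neg_neg] at this
      rw [← this]
      refine intervalIntegral.integral_congr fun y _ => ?_
      rw [show -x - -y = -(x - y) by ring, realKernel_neg]
    simp only [mul_sub]
    rw [intervalIntegral.integral_sub (Continuous.intervalIntegrable (by fun_prop) _ _)
      (Continuous.intervalIntegrable (by fun_prop) _ _), hrefl]
    have e1 := H.dressing_equation x
    have e2 := H.dressing_equation (-x)
    rw [realBareEnergy_neg] at e2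
    rw [sub_div]
    linarith

lemma zero_abs (H : LowTempFamily J h ζ q E ε₀ ε₁ ε₂) (x : ℝ) : ε₀ |x| = ε₀ x := by
  rcases abs_choice x with h | h <;> rw [h]
  exact H.zero_neg x

lemma zero_fermi (H : LowTempFamily J h ζ q E ε₀ ε₁ ε₂) : ε₀ q = 0 :=
  H.zero_at_fermi (abs_of_pos H.q_pos)

lemma exists_taylor_fermi (H : LowTempFamily J h ζ q E ε₀ ε₁ ε₂) :
    ∃ C, 0 ≤ C ∧ ∀ t, |t| ≤ 1 → |ε₀ (q + t) - t * deriv ε₀ q| ≤ C * |t| ^ 2 := by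
  obtain ⟨C, hC0, hC⟩ := exists_taylor_two (H.contDiff_zero 2) q
  refine ⟨C, hC0, fun t ht => ?_⟩
  simpa [H.zero_fermi] using hC t ht

lemma deriv_pos (H : LowTempFamily J h ζ q E ε₀ ε₁ ε₂) : 0 < deriv ε₀ q := by
  refine lt_of_le_of_ne ?_ H.deriv_ne.symm
  obtain ⟨C, hC0, hC⟩ := H.exists_taylor_fermi
  have hq := H.q_pos
  have : -deriv ε₀ q ≤ 0 := by
    refine le_of_eventually_le_mul_add (C := C) ?_
    filter_upwards [self_mem_nhdsWithin, mem_nhdsWithin_of_mem_nhds (Iio_mem_nhds one_pos)]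
      with t h0 h1
    have h0 : 0 < t := h0
    have h1 : t < 1 := h1
    have h2 := hC t (by rw [abs_of_pos h0]; exact h1.le)
    have h3 : 0 < ε₀ (q + t) := H.pos _ (by rw [abs_of_pos (by linarith)]; linarith)
    rw [abs_of_pos h0] at h2
    have h4 := (abs_le.1 h2).2
    by_contra hcon
    nlinarith
  linarith

/-- The dressed energy vanishes linearly at the Fermi points and is bounded below by a positive
constant outside a neighbourhood of the Fermi sea. -/
lemma exists_coercive (H : LowTempFamily J h ζ q E ε₀ ε₁ ε₂) :
    ∃ c, 0 < c ∧ c ≤ h ∧ (∀ y, |y| ≤ q + 1 → c * |(|y| - q)| ≤ |ε₀ y|) ∧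
      ∀ y, q + 1 ≤ |y| → c ≤ ε₀ y := by
  obtain ⟨C, hC0, hC⟩ := H.exists_taylor_fermi
  obtain ⟨C', hC'0, hC'⟩ := H.exists_abs_zero_sub_le
  have ha := H.deriv_pos
  have hq := H.q_pos
  have hh := H.h_pos
  set a := deriv ε₀ q
  set δ := min 1 (a / (2 * (C + 1)))
  have hδ : 0 < δ := lt_min one_pos (by positivity)
  have hδ1 : δ ≤ 1 := min_le_left _ _
  have hδ2 : C * δ ≤ a / 2 := by
    have : δ * (2 * (C + 1)) ≤ a := (le_div_iff₀ (by positivity)).1 (min_le_right _ _)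
    nlinarith
  set R := q + 1 + 2 * C' / h
  have hR : q + 1 ≤ R := le_add_of_nonneg_right (by positivity)
  set S : Set ℝ := Icc 0 R ∩ {y | δ ≤ |y - q|}
  have hS : IsCompact S := isCompact_Icc.inter_right
    (isClosed_le continuous_const (by fun_prop))
  have hRS : R ∈ S := ⟨⟨by linarith, le_rfl⟩, by
    show δ ≤ |R - q|
    rw [abs_of_nonneg (by linarith)]
    linarith⟩
  obtain ⟨y₀, hy₀, hmin⟩ := hS.exists_isMinOn ⟨R, hRS⟩ H.continuous_zero.abs.continuousOn
  have hm : 0 < |ε₀ y₀| := by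
    have hne : |y₀| ≠ q := by
      intro heq
      rw [abs_of_nonneg hy₀.1.1] at heq
      have := hy₀.2
      simp only [mem_ofPred_eq, heq, sub_self, abs_zero] at this
      linarith
    rcases lt_or_gt_of_ne hne with h1 | h1
    · exact abs_pos.2 (H.neg _ h1).ne
    · exact abs_pos.2 (H.pos _ h1).ne'
  set m := |ε₀ y₀|
  refine ⟨min (min (a / 2) (m / (q + 1))) (min m (h / 2)), by positivity,
    (min_le_right _ _).trans ((min_le_right _ _).trans (by linarith)), fun y hy => ?_,
    fun y hy => ?_⟩
  · rcases le_total |(|y| - q)| δ with h1 | h1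
    · have h2 := hC (|y| - q) (h1.trans hδ1)
      rw [add_sub_cancel, H.zero_abs] at h2
      have h3 : |(|y| - q) * a| ≤ |ε₀ y| + C * |(|y| - q)| ^ 2 := by
        have := abs_sub_abs_le_abs_sub ((|y| - q) * a) (ε₀ y)
        rw [abs_sub_comm] at this
        linarith
      rw [abs_mul, abs_of_pos ha] at h3
      have h4 : C * |(|y| - q)| ^ 2 ≤ a / 2 * |(|y| - q)| := by
        calc C * |(|y| - q)| ^ 2 = (C * |(|y| - q)|) * |(|y| - q)| := by ring
          _ ≤ (C * δ) * |(|y| - q)| := by gcongr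
          _ ≤ _ := by gcongr
      calc _ ≤ a / 2 * |(|y| - q)| := by
            gcongr
            exact (min_le_left _ _).trans (min_le_left _ _)
        _ ≤ _ := by linarith
    · have h2 : m ≤ |ε₀ (|y|)| := hmin ⟨⟨abs_nonneg y, hy.trans hR⟩, h1⟩
      rw [H.zero_abs] at h2
      have h3 : |(|y| - q)| ≤ q + 1 := abs_le.2 ⟨by linarith [abs_nonneg y], by linarith⟩
      calc _ ≤ m / (q + 1) * (q + 1) := by
            gcongr
            exact (min_le_left _ _).trans (min_le_right _ _)
        _ = m := by field_simp
        _ ≤ _ := h2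
  · have hpos := H.pos y (by linarith)
    rcases le_total |y| R with h1 | h1
    · have h2 : m ≤ |ε₀ (|y|)| := hmin ⟨⟨abs_nonneg y, h1⟩, by
        show δ ≤ |(|y| - q)|
        rw [abs_of_nonneg (by linarith)]; linarith⟩
      rw [H.zero_abs, abs_of_pos hpos] at h2
      exact (min_le_right _ _).trans ((min_le_left _ _).trans h2)
    · refine (min_le_right _ _).trans ((min_le_right _ _).trans ?_)
      have h2 := (abs_le.1 (hC' y)).1
      have h3 : C' * (1 + y ^ 2)⁻¹ ≤ h / 2 := by
        rw [← div_eq_mul_inv, div_le_iff₀ (by positivity)]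
        have h4 : 2 * C' / h ≤ 1 + y ^ 2 := by
          have : 2 * C' / h ≤ |y| := by linarith
          nlinarith [sq_abs y, sq_nonneg (|y| - 1)]
        rw [div_le_iff₀ hh] at h4
        linarith
      linarith

lemma exists_integral_energyWeight_le (H : LowTempFamily J h ζ q E ε₀ ε₁ ε₂) :
    ∃ C, 0 ≤ C ∧ ∀ᶠ T : ℝ in 𝓝[>] (0 : ℝ), Integrable (energyWeight h E ε₀ ε₁ ε₂ T) ∧
      ∫ y, energyWeight h E ε₀ ε₁ ε₂ T y ≤ C := by
  obtain ⟨C, hC0, hC⟩ := H.exists_close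
  obtain ⟨C', hC'0, hC'⟩ := H.exists_abs_zero_sub_le
  have h0 : Integrable fun y => |ε₀ y - h| := by
    refine (integrable_inv_one_add_sq.const_mul C').mono'
      (Continuous.aestronglyMeasurable ?_) (Eventually.of_forall fun y => ?_)
    · have := H.continuous_zero
      fun_prop
    · rw [Real.norm_eq_abs, abs_abs]
      exact hC' y
  have h1 : Integrable fun y => |ε₁ y| := H.integrable_one.abs
  have h2 : Integrable fun y => |ε₂ y| := H.integrable_two.abs
  have h01 : Integrable fun y => |ε₀ y - h| + |ε₁ y| := h0.add h1
  have h012 : Integrable fun y => |ε₀ y - h| + |ε₁ y| + |ε₂ y| := h01.add h2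
  refine ⟨(∫ y, |ε₀ y - h|) + (∫ y, |ε₁ y|) + (∫ y, |ε₂ y|) + C, ?_, ?_⟩
  · have := integral_nonneg (μ := volume) (f := fun y => |ε₀ y - h|) fun _ => abs_nonneg _
    have := integral_nonneg (μ := volume) (f := fun y => |ε₁ y|) fun _ => abs_nonneg _
    have := integral_nonneg (μ := volume) (f := fun y => |ε₂ y|) fun _ => abs_nonneg _
    linarith
  · filter_upwards [hC] with T ⟨_, _, _, _, _, _, hint, hle⟩
    refine ⟨h012.add hint.norm, ?_⟩
    simp only [energyWeight]
    rw [integral_add h012 hint.norm, integral_add h01 h2, integral_add h0 h1]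
    gcongr

/-- Pointwise bounds on the thermal density: exponential concentration at the Fermi points
at finite distance, and a uniformly integrable exponentially small tail. -/
lemma exists_norm_thermalDensity_le (H : LowTempFamily J h ζ q E ε₀ ε₁ ε₂) :
    ∃ c C, 0 < c ∧ 0 ≤ C ∧ ∀ᶠ T : ℝ in 𝓝[>] (0 : ℝ), 0 < T ∧ T ≤ 1 ∧
      Continuous (E T) ∧
      (∀ y, |y| ≤ q + 1 → ‖thermalDensity h q E T y‖
        ≤ C * T * Real.exp (-(c / T * |(|y| - q)|)) + Real.exp (-(c / T))) ∧
      ∀ y, q + 1 < |y| → ‖thermalDensity h q E T y‖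
        ≤ C * Real.exp (-(c / T)) * energyWeight h E ε₀ ε₁ ε₂ T y := by
  obtain ⟨c, hc, hch, hc1, hc2⟩ := H.exists_coercive
  obtain ⟨C, hC0, hC⟩ := H.exists_close
  obtain ⟨C₁, hC₁0, hC₁⟩ := H.exists_norm_thermalExcess_le
  have hh := H.h_pos
  have hq := H.q_pos
  refine ⟨c, C₁ + Real.exp C, hc, by positivity, ?_⟩
  filter_upwards [hC, hC₁] with T ⟨hT, hT1, hcont, hcl, him, _⟩ hexc
  have hL : ‖(T : ℂ) * logOneAddInfty h T‖ ≤ Real.exp (-(c / T)) := by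
    rw [norm_mul, norm_real, norm_real, Real.norm_of_nonneg hT.le,
      Real.norm_of_nonneg (logOneAddInfty_nonneg h T)]
    calc T * logOneAddInfty h T ≤ 1 * Real.exp (-(c / T)) := by
          gcongr
          · exact logOneAddInfty_nonneg h T
          · refine (logOneAddInfty_le h T).trans (Real.exp_le_exp.2 (neg_le_neg ?_))
            gcongr
      _ = _ := one_mul _
  refine ⟨hT, hT1, hcont, fun y hy => ?_, fun y hy => ?_⟩
  · refine (norm_sub_le _ _).trans (add_le_add ((hexc y).trans ?_) hL)
    have h2 : Real.exp (-(|ε₀ y| / T)) ≤ Real.exp (-(c / T * |(|y| - q)|)) := by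
      refine Real.exp_le_exp.2 (neg_le_neg ?_)
      rw [div_mul_eq_mul_div]
      gcongr
      exact hc1 y hy
    gcongr
    linarith [Real.exp_pos C]
  · have hy' : y ∉ Icc (-q) q := fun h => by have := abs_le.2 h; linarith
    have hT0 : (T : ℂ) ≠ 0 := ofReal_ne_zero.2 hT.ne'
    rw [thermalDensity, thermalExcess, indicator_of_notMem hy', add_zero,
      show -E T y / (T : ℂ) = -(E T y / T) from neg_div _ _, logOneAddExp_neg_eq (him y),
      ofReal_logOneAddInfty, ← mul_sub, norm_mul, norm_real, Real.norm_of_nonneg hT.le]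
    have hu : E T y / T ∈ halfStrip (c / T - C) := by
      refine ⟨?_, him y⟩
      have h1 := (abs_re_le_norm (E T y - ε₀ y)).trans (hcl y)
      rw [sub_re, ofReal_re] at h1
      have h2 := (abs_le.1 h1).1
      have h3 := hc2 y hy.le
      rw [div_ofReal_re, div_sub' hT.ne', div_le_div_iff_of_pos_right hT]
      linarith
    have hv : ((h / T : ℝ) : ℂ) ∈ halfStrip (c / T - C) := by
      refine ⟨?_, by simp⟩
      rw [ofReal_re]
      have : c / T ≤ h / T := by gcongr
      linarith
    have h1 := norm_logOneAddExpNeg_sub_le hu hv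
    have h2 : ‖E T y / T - ((h / T : ℝ) : ℂ)‖ = ‖E T y - h‖ / T := by
      push_cast
      rw [← sub_div, norm_div, norm_real, Real.norm_of_nonneg hT.le]
    have h3 : ‖E T y - h‖ ≤ energyWeight h E ε₀ ε₁ ε₂ T y := by
      have : E T y - h = ((ε₀ y - h : ℝ) : ℂ) + (T * ε₁ y : ℝ) + (T ^ 2 * ε₂ y : ℝ)
          + expansionRem E ε₀ ε₁ ε₂ T y := by
        rw [expansionRem]; push_cast; ring
      rw [this, energyWeight]
      refine (norm_add_le _ _).trans (add_le_add_left ((norm_add_le _ _).trans (add_le_add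
        ((norm_add_le _ _).trans (add_le_add ?_ ?_)) ?_)) _)
      · rw [norm_real, Real.norm_eq_abs]
      · rw [norm_real, norm_mul, Real.norm_of_nonneg hT.le, Real.norm_eq_abs]
        exact mul_le_of_le_one_left (abs_nonneg _) hT1
      · rw [norm_real, norm_mul, Real.norm_of_nonneg (by positivity), Real.norm_eq_abs]
        exact mul_le_of_le_one_left (abs_nonneg _) (pow_le_one₀ hT.le hT1)
    rw [h2] at h1
    calc T * _ ≤ T * (Real.exp (-(c / T - C)) * (‖E T y - h‖ / T)) := by gcongr
      _ = Real.exp C * Real.exp (-(c / T)) * ‖E T y - h‖ := by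
        rw [neg_sub, sub_eq_add_neg, Real.exp_add]
        field_simp
      _ ≤ _ := by
        gcongr
        linarith

lemma exists_integral_norm_thermalDensity_le (H : LowTempFamily J h ζ q E ε₀ ε₁ ε₂) :
    ∃ C, 0 ≤ C ∧ ∀ᶠ T : ℝ in 𝓝[>] (0 : ℝ), Integrable (thermalDensity h q E T) ∧
      ∫ y, ‖thermalDensity h q E T y‖ ≤ C * T ^ 2 := by
  obtain ⟨c, C, hc, hC0, hC⟩ := H.exists_norm_thermalDensity_le
  obtain ⟨C', hC'0, hC'⟩ := H.exists_integral_energyWeight_le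
  have hq := H.q_pos
  refine ⟨C * (2 / c + 2 / c) + (2 * (q + 1)) * (Nat.factorial 2 / c ^ 2)
    + C * (Nat.factorial 2 / c ^ 2) * C', by positivity, ?_⟩
  filter_upwards [hC, hC'] with T ⟨hT, hT1, hcont, hn, hf⟩ ⟨hw, hwle⟩
  have hcT : 0 < c / T := by positivity
  set G : ℝ → ℝ := fun y =>
    C * T * (Real.exp (-(c / T * |y - q|)) + Real.exp (-(c / T * |y - -q|)))
      + (Icc (-(q + 1)) (q + 1)).indicator (fun _ => Real.exp (-(c / T))) y
      + C * Real.exp (-(c / T)) * energyWeight h E ε₀ ε₁ ε₂ T y with hG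
  have hw0 : ∀ y, 0 ≤ energyWeight h E ε₀ ε₁ ε₂ T y := fun y => by
    rw [energyWeight]; positivity
  have hle : ∀ y, ‖thermalDensity h q E T y‖ ≤ G y := by
    intro y
    have hind0 : 0 ≤ (Icc (-(q + 1)) (q + 1)).indicator (fun _ => Real.exp (-(c / T))) y :=
      indicator_nonneg (fun _ _ => (Real.exp_pos _).le) y
    rcases le_or_gt |y| (q + 1) with h1 | h1
    · refine (hn y h1).trans ?_
      have hmem : y ∈ Icc (-(q + 1)) (q + 1) := abs_le.1 h1
      have h2 : Real.exp (-(c / T * |(|y| - q)|))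
          ≤ Real.exp (-(c / T * |y - q|)) + Real.exp (-(c / T * |y - -q|)) := by
        rcases abs_cases y with ⟨h3, _⟩ | ⟨h3, _⟩ <;> rw [h3]
        · linarith [Real.exp_pos (-(c / T * |y - -q|))]
        · rw [show -y - q = -(y - -q) by ring, abs_neg]
          linarith [Real.exp_pos (-(c / T * |y - q|))]
      simp only [hG, indicator_of_mem hmem]
      have h3 := mul_le_mul_of_nonneg_left h2 (show 0 ≤ C * T by positivity)
      have h4 : 0 ≤ C * Real.exp (-(c / T)) * energyWeight h E ε₀ ε₁ ε₂ T y :=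
        mul_nonneg (by positivity) (hw0 y)
      linarith
    · refine (hf y h1).trans ?_
      simp only [hG]
      have : 0 ≤ C * T * (Real.exp (-(c / T * |y - q|)) + Real.exp (-(c / T * |y - -q|))) := by
        positivity
      linarith
  have i1 := integrable_exp_neg_mul_abs_sub hcT q
  have i2 := integrable_exp_neg_mul_abs_sub hcT (-q)
  have i3 : Integrable ((Icc (-(q + 1)) (q + 1)).indicator (fun _ => Real.exp (-(c / T)))) := by
    rw [integrable_indicator_iff measurableSet_Icc]
    exact continuous_const.continuousOn.integrableOn_compact isCompact_Icc
  have i12 : Integrable fun y =>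
      C * T * (Real.exp (-(c / T * |y - q|)) + Real.exp (-(c / T * |y - -q|))) :=
    (i1.add i2).const_mul (C * T)
  have i4 := hw.const_mul (C * Real.exp (-(c / T)))
  have hGint : Integrable G := (i12.add i3).add i4
  have hmeas : Measurable (thermalDensity h q E T) :=
    (measurable_thermalExcess hcont).sub_const _
  have hDint : Integrable (thermalDensity h q E T) :=
    hGint.mono' hmeas.aestronglyMeasurable (Eventually.of_forall hle)
  refine ⟨hDint, (integral_mono hDint.norm hGint hle).trans ?_⟩
  have hGval : ∫ y, G y = C * T * (2 / (c / T) + 2 / (c / T)) + (2 * (q + 1)) * Real.exp (-(c / T))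
      + C * Real.exp (-(c / T)) * ∫ y, energyWeight h E ε₀ ε₁ ε₂ T y := by
    have e1 : ∫ y, C * T * (Real.exp (-(c / T * |y - q|)) + Real.exp (-(c / T * |y - -q|)))
        = C * T * (2 / (c / T) + 2 / (c / T)) := by
      rw [integral_const_mul, integral_add i1 i2, integral_exp_neg_mul_abs_sub hcT,
        integral_exp_neg_mul_abs_sub hcT]
    have e3 : ∫ y, (Icc (-(q + 1)) (q + 1)).indicator (fun _ => Real.exp (-(c / T))) y
        = (2 * (q + 1)) * Real.exp (-(c / T)) := by
      rw [integral_indicator measurableSet_Icc, setIntegral_const, smul_eq_mul,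
        Real.volume_real_Icc_of_le (by linarith)]
      ring
    rw [← e1, ← e3, ← integral_const_mul (C * Real.exp (-(c / T)))]
    rw [← integral_add i12 i3]
    exact integral_add (i12.add i3) i4
  rw [hGval]
  have hexp := exp_neg_div_le 2 hc hT
  have t1 : C * T * (2 / (c / T) + 2 / (c / T)) = C * (2 / c + 2 / c) * T ^ 2 := by
    field_simp
  have t2 : (2 * (q + 1)) * Real.exp (-(c / T))
      ≤ (2 * (q + 1)) * (Nat.factorial 2 / c ^ 2 * T ^ 2) := by gcongr
  have t3 : C * Real.exp (-(c / T)) * ∫ y, energyWeight h E ε₀ ε₁ ε₂ T y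
      ≤ C * (Nat.factorial 2 / c ^ 2 * T ^ 2) * C' := by
    gcongr
    exact integral_nonneg hw0
  rw [t1]
  refine (add_le_add (add_le_add le_rfl t2) t3).trans (le_of_eq (by ring))

/-- Integrals against the thermal excess are of order `T²`. -/
lemma exists_norm_integral_mul_thermalExcess_le (H : LowTempFamily J h ζ q E ε₀ ε₁ ε₂) :
    ∃ C, 0 ≤ C ∧ ∀ᶠ T : ℝ in 𝓝[>] (0 : ℝ), ∀ k : ℝ → ℂ, Integrable k → ∀ B, (∀ y, ‖k y‖ ≤ B) →
      ‖∫ y, k y * thermalExcess q E T y‖ ≤ C * T ^ 2 * B + C * T ^ 3 * ∫ y, ‖k y‖ := by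
  obtain ⟨C, hC0, hC⟩ := H.exists_integral_norm_thermalDensity_le
  have hh := H.h_pos
  refine ⟨C + Nat.factorial 2 / h ^ 2, by positivity, ?_⟩
  filter_upwards [hC, self_mem_nhdsWithin] with T ⟨hint, hle⟩ hT k hk B hB
  have hT : 0 < T := hT
  have hB0 : 0 ≤ B := (norm_nonneg _).trans (hB 0)
  have i1 : Integrable fun y => k y * thermalDensity h q E T y :=
    hint.bdd_mul hk.aestronglyMeasurable (Eventually.of_forall hB)
  have i2 : Integrable fun y => k y * (T * logOneAddInfty h T : ℂ) := hk.mul_const _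
  have hsplit : ∫ y, k y * thermalExcess q E T y
      = (∫ y, k y * thermalDensity h q E T y) + (∫ y, k y) * (T * logOneAddInfty h T : ℂ) := by
    rw [← integral_mul_const, ← integral_add i1 i2]
    refine integral_congr_ae (Eventually.of_forall fun y => ?_)
    simp only [thermalDensity]
    ring
  rw [hsplit]
  refine (norm_add_le _ _).trans (add_le_add ?_ ?_)
  · have h1 : ‖∫ y, k y * thermalDensity h q E T y‖ ≤ B * ∫ y, ‖thermalDensity h q E T y‖ := by
      rw [← integral_const_mul]
      refine norm_integral_le_of_norm_le (hint.norm.const_mul B) (Eventually.of_forall fun y => ?_)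
      rw [norm_mul]
      gcongr
      exact hB y
    refine h1.trans ?_
    have h2 : (0 : ℝ) ≤ Nat.factorial 2 / h ^ 2 := by positivity
    calc B * ∫ y, ‖thermalDensity h q E T y‖ ≤ B * (C * T ^ 2) := by gcongr
      _ = C * T ^ 2 * B := by ring
      _ ≤ _ := by gcongr; linarith
  · rw [norm_mul, norm_mul, norm_real, norm_real, Real.norm_of_nonneg hT.le,
      Real.norm_of_nonneg (logOneAddInfty_nonneg h T), mul_comm]
    have h1 := norm_integral_le_integral_norm (μ := volume) k
    have h2 := (logOneAddInfty_le h T).trans (exp_neg_div_le 2 hh hT)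
    have h3 : (0 : ℝ) ≤ Nat.factorial 2 / h ^ 2 := by positivity
    refine mul_le_mul ?_ h1 (norm_nonneg _) (by positivity)
    calc T * logOneAddInfty h T ≤ T * (Nat.factorial 2 / h ^ 2 * T ^ 2) := by gcongr
      _ = Nat.factorial 2 / h ^ 2 * T ^ 3 := by ring
      _ ≤ _ := by gcongr; linarith

/-- There is no term of first order in `T`: the thermal excess is a source of order `T²` in the
Yang-Yang type equation, so `ε₁` solves the homogeneous dressing equation. -/
lemma one_eq_zero (H : LowTempFamily J h ζ q E ε₀ ε₁ ε₂) (x : ℝ) : ε₁ x = 0 := by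
  obtain ⟨C, hC0, hC⟩ := H.exists_dressOp_expansion
  obtain ⟨C₁, hC₁0, hC₁⟩ := H.exists_norm_integral_mul_thermalExcess_le
  obtain ⟨M, hM0, hM⟩ := H.norm_dressOp_ofReal_le
  obtain ⟨N, hN⟩ := H.bounded
  have hs := H.sin_ne
  have hπ := Real.pi_pos
  refine eq_zero_of_kernel_equation hs H.q_pos (fun x => (hN x).1) (fun x => ?_) x
  set B := ∫ y, ‖(realKernel ζ (x - y) : ℂ)‖
  have hB0 : 0 ≤ B := integral_nonneg fun _ => norm_nonneg _
  set A := 1 + (Real.sin ζ ^ 2)⁻¹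
  have hA0 : 0 ≤ A := by positivity
  have key : dressOp ζ q (fun y => (ε₁ y : ℂ)) x = 0 := by
    refine eq_zero_of_eventually_norm_le (C := C + M + (C₁ * A + C₁ * B) / (2 * π)) ?_
    filter_upwards [hC, hC₁, self_mem_nhdsWithin,
      mem_nhdsWithin_of_mem_nhds (Iio_mem_nhds one_pos)] with T h1 h2 hT hT1
    have hT : 0 < T := hT
    have hT1 : T < 1 := hT1
    have h3 := h2 _ (integrable_ofReal_realKernel_sub hs x) A fun y => by
      rw [norm_real]; exact abs_realKernel_le_const hs _
    have h4 := h1 x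
    rw [dressOp_ofReal ζ q ε₀, H.dressing_equation x, sub_self, zero_add] at h4
    set p := dressOp ζ q (fun y => (ε₁ y : ℂ)) x
    set c := (T : ℂ) ^ 2 * dressOp ζ q (fun y => (ε₂ y : ℂ)) x with hc
    set I' := ∫ y, (realKernel ζ (x - y) : ℂ) * thermalExcess q E T y
    have h5 : ‖c‖ ≤ M * T ^ 2 := by
      rw [hc, norm_mul, norm_pow, norm_real, Real.norm_of_nonneg hT.le, mul_comm]
      exact mul_le_mul_of_nonneg_right (hM x).2 (by positivity)
    have hT32 : T ^ 3 ≤ T ^ 2 := pow_le_pow_of_le_one hT.le hT1.le (by norm_num)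
    have h6 : ‖I' / (2 * π)‖ ≤ (C₁ * A + C₁ * B) / (2 * π) * T ^ 2 := by
      rw [norm_div, norm_two_mul_pi, div_mul_eq_mul_div]
      gcongr
      have : C₁ * T ^ 3 * B ≤ C₁ * T ^ 2 * B := by gcongr
      linarith
    have h7 : ‖(T : ℂ) * p‖ ≤ (C + M + (C₁ * A + C₁ * B) / (2 * π)) * T ^ 2 := by
      have h8 : C * T ^ 3 ≤ C * T ^ 2 := by gcongr
      calc ‖(T : ℂ) * p‖ = ‖(T * p + c - I' / (2 * π)) - c + I' / (2 * π)‖ := by congr 1; ring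
        _ ≤ ‖T * p + c - I' / (2 * π)‖ + ‖c‖ + ‖I' / (2 * π)‖ :=
          (norm_add_le _ _).trans (add_le_add_left (norm_sub_le _ _) _)
        _ ≤ _ := by linarith
    rw [norm_mul, norm_real, Real.norm_of_nonneg hT.le] at h7
    have h9 : T * ‖p‖ ≤ T * ((C + M + (C₁ * A + C₁ * B) / (2 * π)) * T) := by
      refine h7.trans (le_of_eq (by ring))
    exact le_of_mul_le_mul_left h9 hT
  rw [dressOp_ofReal] at key
  exact_mod_cast key

/-- The second-order coefficient is Lipschitz continuous: the thermal excess has mass `O(T²)` and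
enters through the Lipschitz kernel. -/
lemma exists_lipschitz_two (H : LowTempFamily J h ζ q E ε₀ ε₁ ε₂) :
    ∃ C, 0 ≤ C ∧ ∀ x x', |ε₂ x - ε₂ x'| ≤ C * |x - x'| := by
  obtain ⟨C, hC0, hC⟩ := H.exists_dressOp_expansion
  obtain ⟨C₁, hC₁0, hC₁⟩ := H.exists_norm_integral_mul_thermalExcess_le
  obtain ⟨N, hN⟩ := H.bounded
  have hN0 : 0 ≤ N := (abs_nonneg _).trans (hN 0).1
  have hs := H.sin_ne
  have hq := H.q_pos
  have hπ := Real.pi_pos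
  obtain ⟨L, hL0, hL⟩ := exists_lipschitz_realKernel hs
  refine ⟨C₁ * L / (2 * π) + L * N * (2 * q) / (2 * π), by positivity, fun x x' => ?_⟩
  have hone : (fun y => (ε₁ y : ℂ)) = fun _ => 0 := funext fun y => by simp [H.one_eq_zero y]
  set k : ℝ → ℂ := fun y => (realKernel ζ (x - y) : ℂ) - realKernel ζ (x' - y) with hk
  have hkint : Integrable k :=
    (integrable_ofReal_realKernel_sub hs x).sub (integrable_ofReal_realKernel_sub hs x')
  have hkb : ∀ y, ‖k y‖ ≤ L * |x - x'| := fun y => by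
    rw [hk]
    simp only
    rw [← ofReal_sub, norm_real, Real.norm_eq_abs]
    refine (hL _ _).trans (le_of_eq ?_)
    congr 2
    ring
  set B := ∫ y, ‖k y‖
  have hB0 : 0 ≤ B := integral_nonneg fun _ => norm_nonneg _
  set p : ℝ → ℂ := dressOp ζ q (fun y => (ε₂ y : ℂ)) with hp
  have key : ‖p x - p x'‖ ≤ C₁ * L / (2 * π) * |x - x'| := by
    refine le_of_eventually_le_mul_add (C := 2 * C + C₁ * B / (2 * π)) ?_
    filter_upwards [hC, hC₁, H.integrable_kernel_mul_thermalExcess, self_mem_nhdsWithin]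
      with T h1 h2 hint hT
    have hT : 0 < T := hT
    have h3 := h2 k hkint _ hkb
    have hdiff : ∫ y, k y * thermalExcess q E T y
        = (∫ y, (realKernel ζ (x - y) : ℂ) * thermalExcess q E T y)
          - ∫ y, (realKernel ζ (x' - y) : ℂ) * thermalExcess q E T y := by
      rw [← integral_sub (hint x) (hint x')]
      simp only [hk, sub_mul]
    -- with `ε₀` solving the dressing equation and `ε₁ = 0`, the source is `T² (1 + K / 2π) ε₂`
    have hz : ∀ x, ‖(T : ℂ) ^ 2 * p x
        - (∫ y, (realKernel ζ (x - y) : ℂ) * thermalExcess q E T y) / (2 * π)‖ ≤ C * T ^ 3 := by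
      intro x
      have h4 := h1 x
      rw [dressOp_ofReal ζ q ε₀, H.dressing_equation x, sub_self, zero_add, hone] at h4
      simpa [dressOp] using h4
    have h5 : ‖(T : ℂ) ^ 2 * (p x - p x')‖ ≤ 2 * C * T ^ 3
        + (C₁ * T ^ 2 * (L * |x - x'|) + C₁ * T ^ 3 * B) / (2 * π) := by
      have e : (T : ℂ) ^ 2 * (p x - p x')
        = ((T : ℂ) ^ 2 * p x
        - (∫ y, (realKernel ζ (x - y) : ℂ) * thermalExcess q E T y) / (2 * π))
        - ((T : ℂ) ^ 2 * p x'
        - (∫ y, (realKernel ζ (x' - y) : ℂ) * thermalExcess q E T y) / (2 * π))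
        + (∫ y, k y * thermalExcess q E T y) / (2 * π) := by
        rw [hdiff]; ring
      rw [e]
      refine (norm_add_le _ _).trans (add_le_add ((norm_sub_le _ _).trans ?_) ?_)
      · linarith [hz x, hz x']
      · rw [norm_div, norm_two_mul_pi]
        gcongr
    rw [norm_mul, norm_pow, norm_real, Real.norm_of_nonneg hT.le] at h5
    have h6 : T ^ 2 * ‖p x - p x'‖ ≤ T ^ 2 * ((2 * C + C₁ * B / (2 * π)) * T
        + C₁ * L / (2 * π) * |x - x'|) := h5.trans (le_of_eq (by ring))
    exact le_of_mul_le_mul_left h6 (by positivity)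
  have htwo : IntervalIntegrable (fun y => (ε₂ y : ℂ)) volume (-q) q :=
    H.integrable_two.ofReal.intervalIntegrable
  have hconv : ‖(∫ y in (-q)..q, k y * (ε₂ y : ℂ)) / (2 * π)‖
      ≤ L * N * (2 * q) / (2 * π) * |x - x'| := by
    have h1 : ‖∫ y in (-q)..q, k y * (ε₂ y : ℂ)‖ ≤ L * |x - x'| * N * |q - -q| :=
      intervalIntegral.norm_integral_le_of_norm_le_const fun y _ => by
        rw [norm_mul]
        gcongr
        · exact hkb y
        · rw [norm_real]; exact (hN y).2
    rw [show q - -q = 2 * q by ring, abs_of_pos (a := 2 * q) (by linarith)] at h1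
    rw [norm_div, norm_two_mul_pi, div_mul_eq_mul_div]
    gcongr
    linarith
  have hfin : ((ε₂ x - ε₂ x' : ℝ) : ℂ)
      = (p x - p x') - (∫ y in (-q)..q, k y * (ε₂ y : ℂ)) / (2 * π) := by
    have : ∫ y in (-q)..q, k y * (ε₂ y : ℂ)
        = (∫ y in (-q)..q, (realKernel ζ (x - y) : ℂ) * (ε₂ y : ℂ))
          - ∫ y in (-q)..q, (realKernel ζ (x' - y) : ℂ) * (ε₂ y : ℂ) := by
      rw [← intervalIntegral.integral_sub (intervalIntegrable_kernel_mul hs x htwo)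
        (intervalIntegrable_kernel_mul hs x' htwo)]
      simp only [hk, sub_mul]
    rw [this]
    simp only [hp, dressOp]
    push_cast
    ring
  rw [← Real.norm_eq_abs, ← norm_real, hfin, add_mul]
  exact (norm_sub_le _ _).trans (add_le_add key hconv)

end LowTempFamily

/-! ### The Sommerfeld expansion -/

lemma integral_log_one_add_exp_neg_Ioi_le (X : ℝ) :
    ∫ u in Ioi X, Real.log (1 + Real.exp (-u)) ≤ Real.exp (-X) := by
  have hint : IntegrableOn (fun u => Real.exp (-u)) (Ioi X) := by
    simpa using integrableOn_exp_neg_mul_Ioi one_pos X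
  refine (integral_mono_of_nonneg (Eventually.of_forall fun u => ?_) hint
    (Eventually.of_forall fun u => ?_)).trans (le_of_eq ?_)
  · exact Real.log_nonneg (by linarith [Real.exp_pos (-u)])
  · have := Real.log_le_sub_one_of_pos (x := 1 + Real.exp (-u)) (by positivity)
    simpa using this
  · exact integral_exp_neg_Ioi X

lemma integrableOn_log_one_add_exp_neg (X : ℝ) :
    IntegrableOn (fun u => Real.log (1 + Real.exp (-u))) (Ioi X) := by
  have hint : IntegrableOn (fun u => Real.exp (-u)) (Ioi X) := by
    simpa using integrableOn_exp_neg_mul_Ioi one_pos X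
  refine Integrable.mono' hint (Measurable.aestronglyMeasurable (by fun_prop))
    (Eventually.of_forall fun u => ?_)
  have := Real.log_le_sub_one_of_pos (x := 1 + Real.exp (-u)) (by positivity)
  rw [Real.norm_of_nonneg (Real.log_nonneg (by linarith [Real.exp_pos (-u)]))]
  simpa using this

lemma abs_fermi_integral_sub_le {a δ T : ℝ} (ha : 0 < a) (hδ : 0 < δ) (hT : 0 < T) :
    |T * (∫ t in (0 : ℝ)..δ, Real.log (1 + Real.exp (-(a * t / T)))) - π ^ 2 * T ^ 2 / (12 * a)|
      ≤ T ^ 2 / a * Real.exp (-(a * δ / T)) := by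
  have hc : a / T ≠ 0 := by positivity
  have h1 : ∫ t in (0 : ℝ)..δ, Real.log (1 + Real.exp (-(a * t / T)))
      = T / a * ∫ u in (0 : ℝ)..(a * δ / T), Real.log (1 + Real.exp (-u)) := by
    have := intervalIntegral.integral_comp_mul_left (a := 0) (b := δ)
      (fun u => Real.log (1 + Real.exp (-u))) hc
    rw [mul_zero, smul_eq_mul, inv_div] at this
    rw [show a * δ / T = a / T * δ by ring, ← this]
    refine intervalIntegral.integral_congr fun t _ => ?_
    rw [div_mul_eq_mul_div]
  have h2 : ∫ u in (0 : ℝ)..(a * δ / T), Real.log (1 + Real.exp (-u))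
      = π ^ 2 / 12 - ∫ u in Ioi (a * δ / T), Real.log (1 + Real.exp (-u)) := by
    rw [← integral_log_one_add_exp_neg, intervalIntegral.integral_Ioi_sub_Ioi
      (integrableOn_log_one_add_exp_neg 0) (by positivity)]
  rw [h1, h2]
  have h3 := integral_log_one_add_exp_neg_Ioi_le (a * δ / T)
  have h4 : 0 ≤ ∫ u in Ioi (a * δ / T), Real.log (1 + Real.exp (-u)) :=
    integral_nonneg fun u => Real.log_nonneg (by linarith [Real.exp_pos (-u)])
  rw [show T * (T / a * (π ^ 2 / 12 - ∫ u in Ioi (a * δ / T), Real.log (1 + Real.exp (-u))))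
      - π ^ 2 * T ^ 2 / (12 * a)
      = -(T ^ 2 / a * ∫ u in Ioi (a * δ / T), Real.log (1 + Real.exp (-u))) by field_simp; ring,
    abs_neg, abs_of_nonneg (by positivity)]
  gcongr

lemma one_add_pow_four_mul_exp_le {a s : ℝ} (ha : 0 < a) (hs : 0 ≤ s) :
    (1 + s) ^ 4 * Real.exp (-(a * s / 2))
      ≤ 24 * (4 / a) ^ 4 * Real.exp (a / 4) * Real.exp (-(a / 4 * s)) := by
  have h := Real.pow_div_factorial_le_exp (a / 4 * (1 + s)) (by positivity) 4
  rw [div_le_iff₀ (by positivity), show ((Nat.factorial 4 : ℕ) : ℝ) = 24 by norm_num [Nat.factorial]]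
    at h
  have h1 : (1 + s) ^ 4 ≤ 24 * (4 / a) ^ 4 * Real.exp (a / 4 * (1 + s)) := by
    calc (1 + s) ^ 4 = (4 / a) ^ 4 * (a / 4 * (1 + s)) ^ 4 := by field_simp
      _ ≤ (4 / a) ^ 4 * (Real.exp (a / 4 * (1 + s)) * 24) := by gcongr
      _ = _ := by ring
  calc (1 + s) ^ 4 * Real.exp (-(a * s / 2))
      ≤ 24 * (4 / a) ^ 4 * Real.exp (a / 4 * (1 + s)) * Real.exp (-(a * s / 2)) := by gcongr
    _ = 24 * (4 / a) ^ 4 * (Real.exp (a / 4 * (1 + s)) * Real.exp (-(a * s / 2))) := by ring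
    _ = 24 * (4 / a) ^ 4 * (Real.exp (a / 4) * Real.exp (-(a / 4 * s))) := by
      rw [← Real.exp_add, ← Real.exp_add]
      congr 2
      ring
    _ = _ := by ring

/-- The algebraic core of the Sommerfeld expansion: second-order Taylor expansions of
`ln (1 + e^{-u})` and `ln (1 + e^{-u'})` at a common point `v`, when the displacements from `v` are
opposite up to higher-order terms. -/
lemma norm_fermi_pair_le {T t N C W C' m w : ℝ} {ρ ρ' u u' v F F' f₀ : ℂ} (hT : 0 < T)
    (hTN : T ≤ N) (ht : 0 ≤ t) (htN : t ≤ N) (hC : 0 ≤ C) (hW : 0 ≤ W)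
    (hw : |w| ≤ W * N ^ 2)
    (hρ : ‖ρ‖ ≤ C * N ^ 3) (hρ' : ‖ρ'‖ ≤ C * N ^ 3) (huv : T * (u - v) = w + ρ)
    (huv' : T * (u' - v) = -(w + ρ')) (hd : ‖u - v‖ ≤ C' * N ^ 2 / T)
    (hd' : ‖u' - v‖ ≤ C' * N ^ 2 / T) (hu : u ∈ halfStrip m) (hu' : u' ∈ halfStrip m)
    (hv : v ∈ halfStrip m) (hF : ‖F‖ ≤ C) (hF' : ‖F'‖ ≤ C) (hFF : ‖F - F'‖ ≤ C * t)
    (hFf : ‖F + F' - 2 * f₀‖ ≤ C * t ^ 2) :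
    ‖T * logOneAddExpNeg u * F + T * logOneAddExpNeg u' * F' - 2 * T * logOneAddExpNeg v * f₀‖
      ≤ Real.exp (-m) * ((C + W * C + 2 * C ^ 2 + 2 * C * C' ^ 2) * (N ^ 4 / T)) := by
  have hN : 0 < N := hT.trans_le hTN
  have hR : ∀ z ∈ halfStrip m, ‖z - v‖ ≤ C' * N ^ 2 / T →
      ‖logOneAddExpNeg z - logOneAddExpNeg v - -(1 + exp v)⁻¹ * (z - v)‖
        ≤ Real.exp (-m) * (C' * N ^ 2 / T) ^ 2 := fun z hz hzd =>
    (norm_logOneAddExpNeg_taylor_le hz hv).trans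
      (mul_le_mul_of_nonneg_left (pow_le_pow_left₀ (norm_nonneg _) hzd 2) (Real.exp_pos _).le)
  have hexpv : Real.exp (-v.re) ≤ Real.exp (-m) := Real.exp_le_exp.2 (neg_le_neg hv.1)
  have hl0 : ‖logOneAddExpNeg v‖ ≤ Real.exp (-m) := (norm_logOneAddExpNeg_le hv.2).trans hexpv
  have hl1 : ‖-(1 + exp v)⁻¹‖ ≤ Real.exp (-m) := by
    rw [norm_neg]
    exact (norm_inv_one_add_exp_le hv.2).trans hexpv
  have hRu := hR u hu hd
  have hRu' := hR u' hu' hd'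
  have hNN : N ^ 3 ≤ N ^ 4 / T := by
    rw [le_div_iff₀ hT, pow_succ N 3]
    exact mul_le_mul_of_nonneg_left hTN (by positivity)
  generalize hRd : logOneAddExpNeg u - logOneAddExpNeg v - -(1 + exp v)⁻¹ * (u - v) = R at hRu
  generalize hRd' : logOneAddExpNeg u' - logOneAddExpNeg v - -(1 + exp v)⁻¹ * (u' - v) = R' at hRu'
  have hsplit : T * logOneAddExpNeg u * F + T * logOneAddExpNeg u' * F'
        - 2 * T * logOneAddExpNeg v * f₀
      = T * logOneAddExpNeg v * (F + F' - 2 * f₀)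
        + -(1 + exp v)⁻¹ * (w * (F - F') + ρ * F - ρ' * F') + T * R * F + T * R' * F' := by
    rw [← hRd, ← hRd']
    linear_combination -(1 + exp v)⁻¹ * F * huv - (1 + exp v)⁻¹ * F' * huv'
  have b1 : ‖T * logOneAddExpNeg v * (F + F' - 2 * f₀)‖ ≤ Real.exp (-m) * (C * (N ^ 4 / T)) := by
    rw [norm_mul, norm_mul, norm_real, Real.norm_of_nonneg hT.le]
    calc T * ‖logOneAddExpNeg v‖ * ‖F + F' - 2 * f₀‖
        ≤ N * Real.exp (-m) * (C * N ^ 2) := by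
          gcongr
          exact hFf.trans (by gcongr)
      _ = Real.exp (-m) * (C * N ^ 3) := by ring
      _ ≤ _ := by gcongr
  have b2 : ‖-(1 + exp v)⁻¹ * (w * (F - F') + ρ * F - ρ' * F')‖
      ≤ Real.exp (-m) * ((W * C + 2 * C ^ 2) * (N ^ 4 / T)) := by
    rw [norm_mul]
    refine mul_le_mul hl1 ?_ (norm_nonneg _) (Real.exp_pos _).le
    calc ‖w * (F - F') + ρ * F - ρ' * F'‖ ≤ |w| * ‖F - F'‖ + ‖ρ‖ * ‖F‖ + ‖ρ'‖ * ‖F'‖ := by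
          refine (norm_sub_le _ _).trans (add_le_add ((norm_add_le _ _).trans (add_le_add ?_ ?_)) ?_)
          · rw [norm_mul, norm_real, Real.norm_eq_abs]
          · rw [norm_mul]
          · rw [norm_mul]
      _ ≤ W * N ^ 2 * (C * N) + C * N ^ 3 * C + C * N ^ 3 * C := by
          gcongr
          exact hFF.trans (by gcongr)
      _ = (W * C + 2 * C ^ 2) * N ^ 3 := by ring
      _ ≤ _ := by gcongr
  have b3 : ∀ r G : ℂ, ‖r‖ ≤ Real.exp (-m) * (C' * N ^ 2 / T) ^ 2 → ‖G‖ ≤ C →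
      ‖T * r * G‖ ≤ Real.exp (-m) * (C * C' ^ 2 * (N ^ 4 / T)) := fun r G hr hG => by
    rw [norm_mul, norm_mul, norm_real, Real.norm_of_nonneg hT.le]
    calc T * ‖r‖ * ‖G‖ ≤ T * (Real.exp (-m) * (C' * N ^ 2 / T) ^ 2) * C := by gcongr
      _ = _ := by field_simp
  rw [hsplit]
  refine (norm_add_le _ _).trans ((add_le_add ((norm_add_le _ _).trans (add_le_add
    ((norm_add_le _ _).trans (add_le_add b1 b2)) (b3 R F hRu hF)))
    (b3 R' F' hRu' hF')).trans (le_of_eq ?_))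
  ring

/-- The pointwise estimate behind the Sommerfeld expansion. The contributions of the two points at
distance `t` on either side of a Fermi point are added, so that the terms even in `t` of the energy
and the term odd in `t` of the test function cancel at leading order. What remains is of order
`(t + T)⁴ / T` times an exponentially decaying function of `t / T`. -/
lemma exists_fermi_pair_estimate {a δ₀ C : ℝ} (b e : ℝ) (ha : 0 < a) (hδ₀ : 0 < δ₀) (hC : 0 ≤ C) :
    ∃ δ K τ : ℝ, 0 < δ ∧ δ ≤ δ₀ ∧ δ ≤ 1 ∧ 0 ≤ K ∧ 0 < τ ∧
      ∀ T, 0 < T → T ≤ τ → ∀ t, 0 ≤ t → t ≤ δ → ∀ A B F F' f₀ : ℂ,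
      |(A / T).im| ≤ 1 → |(B / T).im| ≤ 1 →
      ‖A - ((a * t + b * t ^ 2 + T ^ 2 * e : ℝ) : ℂ)‖ ≤ C * (t + T) ^ 3 →
      ‖B - ((-(a * t) + b * t ^ 2 + T ^ 2 * e : ℝ) : ℂ)‖ ≤ C * (t + T) ^ 3 →
      ‖F‖ ≤ C → ‖F'‖ ≤ C → ‖F - F'‖ ≤ C * t → ‖F + F' - 2 * f₀‖ ≤ C * t ^ 2 →
      ‖T * logOneAddExpNeg (A / T) * F + T * logOneAddExpNeg (-(B / T)) * F'
        - 2 * T * logOneAddExpNeg ((a * t / T : ℝ) : ℂ) * f₀‖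
        ≤ K * T ^ 3 * Real.exp (-(a / 4 * (t / T))) := by
  have hC'0 : 0 ≤ |b| + |e| + 2 * C := by positivity
  have hW0 : 0 ≤ |b| + |e| := by positivity
  generalize hW : |b| + |e| = W at hC'0 hW0
  generalize hC' : W + 2 * C = C' at hC'0
  refine ⟨min (min δ₀ 1) (a / (4 * (C' + 1))),
    Real.exp 1 * (C + W * C + 2 * C ^ 2 + 2 * C * C' ^ 2) * (24 * (4 / a) ^ 4 * Real.exp (a / 4)),
    min 1 (1 / (2 * (C' + 1))), by positivity, (min_le_left _ _).trans (min_le_left _ _),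
    (min_le_left _ _).trans (min_le_right _ _), by positivity, by positivity, ?_⟩
  intro T hT hTτ t ht htδ A B F F' f₀ hAi hBi hA hB hF hF' hFF hFf
  have hT1 : T ≤ 1 := hTτ.trans (min_le_left _ _)
  have ht1 : t ≤ 1 := htδ.trans ((min_le_left _ _).trans (min_le_right _ _))
  have hTC : 2 * C' * T ≤ 1 := by
    have h1 := hTτ.trans (min_le_right _ _)
    rw [le_div_iff₀ (by positivity)] at h1
    linarith
  have htC : 2 * C' * t ≤ a / 2 := by
    have h1 := htδ.trans (min_le_right _ _)
    rw [le_div_iff₀ (by positivity)] at h1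
    linarith
  have hT0 : (T : ℂ) ≠ 0 := ofReal_ne_zero.2 hT.ne'
  have hTN : T ≤ t + T := by linarith
  have htN : t ≤ t + T := by linarith
  have hN2 : t + T ≤ 2 := by linarith
  have hNm : C' * (t + T) ^ 2 / T ≤ a * t / (2 * T) + 1 := by
    have h1 : (t + T) ^ 2 ≤ 2 * t ^ 2 + 2 * T ^ 2 := by nlinarith [sq_nonneg (t - T)]
    rw [div_add_one (by positivity), div_le_div_iff₀ hT (by positivity)]
    have h2 : C' * (t + T) ^ 2 ≤ C' * (2 * t ^ 2 + 2 * T ^ 2) := by gcongr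
    have h3 : 2 * C' * t * t ≤ a / 2 * t := mul_le_mul_of_nonneg_right htC ht
    have h4 : 2 * C' * T * T ≤ 1 * T := mul_le_mul_of_nonneg_right hTC hT.le
    have h5 : C' * (t + T) ^ 2 ≤ a / 2 * t + T := by linarith
    calc C' * (t + T) ^ 2 * (2 * T) ≤ (a / 2 * t + T) * (2 * T) := by gcongr
      _ ≤ _ := by nlinarith
  have hexp : (t + T) ^ 4 / T = T ^ 3 * (1 + t / T) ^ 4 := by
    field_simp; ring
  have hmexp : Real.exp (-(a * t / (2 * T) - 1)) = Real.exp 1 * Real.exp (-(a * (t / T) / 2)) := by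
    rw [← Real.exp_add]
    congr 1
    field_simp
    ring
  have hpoly := one_add_pow_four_mul_exp_le ha (s := t / T) (by positivity)
  have hwN : |b * t ^ 2 + T ^ 2 * e| ≤ W * (t + T) ^ 2 := by
    have h1 : t ^ 2 ≤ (t + T) ^ 2 := pow_le_pow_left₀ ht htN 2
    have h2 : T ^ 2 ≤ (t + T) ^ 2 := pow_le_pow_left₀ hT.le hTN 2
    calc |b * t ^ 2 + T ^ 2 * e| ≤ |b| * t ^ 2 + T ^ 2 * |e| := by
          refine (abs_add_le _ _).trans (le_of_eq ?_)
          rw [abs_mul, abs_mul, abs_of_nonneg (sq_nonneg t), abs_of_nonneg (sq_nonneg T)]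
      _ ≤ |b| * (t + T) ^ 2 + (t + T) ^ 2 * |e| := by gcongr
      _ = W * (t + T) ^ 2 := by rw [← hW]; ring
  rw [add_assoc (a * t)] at hA
  rw [add_assoc (-(a * t))] at hB
  generalize b * t ^ 2 + T ^ 2 * e = w at hA hB hwN
  have hN3 : C * (t + T) ^ 3 ≤ 2 * C * (t + T) ^ 2 := by
    calc C * (t + T) ^ 3 = C * (t + T) ^ 2 * (t + T) := by ring
      _ ≤ C * (t + T) ^ 2 * 2 := mul_le_mul_of_nonneg_left hN2 (by positivity)
      _ = _ := by ring
  have hs : ∀ z r : ℂ, ‖(T : ℂ) * z‖ = ‖(w : ℂ) + r‖ → ‖r‖ ≤ C * (t + T) ^ 3 →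
      ‖z‖ ≤ C' * (t + T) ^ 2 / T := fun z r hz hr => by
    rw [norm_mul, norm_real, Real.norm_of_nonneg hT.le] at hz
    rw [le_div_iff₀ hT, mul_comm, hz]
    calc ‖(w : ℂ) + r‖ ≤ |w| + ‖r‖ := by
          refine (norm_add_le _ _).trans ?_
          rw [norm_real, Real.norm_eq_abs]
      _ ≤ W * (t + T) ^ 2 + 2 * C * (t + T) ^ 2 := add_le_add hwN (hr.trans hN3)
      _ = _ := by rw [← hC']; ring
  have huv : T * (A / T - ((a * t / T : ℝ) : ℂ)) = w + (A - ((a * t + w : ℝ) : ℂ)) := by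
    push_cast; field_simp; ring
  have huv' : T * (-(B / T) - ((a * t / T : ℝ) : ℂ)) = -(w + (B - ((-(a * t) + w : ℝ) : ℂ))) := by
    push_cast; field_simp; ring
  have hd := hs _ _ (by rw [huv]) hA
  have hd' := hs _ _ (by rw [huv', norm_neg]) hB
  have hre : ∀ z : ℂ, ‖z - ((a * t / T : ℝ) : ℂ)‖ ≤ C' * (t + T) ^ 2 / T →
      a * t / (2 * T) - 1 ≤ z.re := fun z hz => by
    have h1 := (abs_re_le_norm _).trans (hz.trans hNm)
    rw [sub_re, ofReal_re] at h1
    have h2 := (abs_le.1 h1).1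
    have h3 : a * t / T = 2 * (a * t / (2 * T)) := by field_simp
    linarith
  have hvS : ((a * t / T : ℝ) : ℂ) ∈ halfStrip (a * t / (2 * T) - 1) := by
    refine ⟨?_, by simp⟩
    rw [ofReal_re]
    have : a * t / (2 * T) ≤ a * t / T := by gcongr; linarith
    linarith
  refine (norm_fermi_pair_le hT hTN ht htN hC hW0 hwN hA hB huv huv' hd hd'
    ⟨hre _ hd, hAi⟩ ⟨hre _ hd', by rw [neg_im, abs_neg]; exact hBi⟩ hvS hF hF' hFF hFf).trans ?_
  rw [hexp, hmexp]
  have hK : 0 ≤ C + W * C + 2 * C ^ 2 + 2 * C * C' ^ 2 := by positivity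
  generalize C + W * C + 2 * C ^ 2 + 2 * C * C' ^ 2 = K₀ at hK
  calc Real.exp 1 * Real.exp (-(a * (t / T) / 2)) * (K₀ * (T ^ 3 * (1 + t / T) ^ 4))
      = Real.exp 1 * K₀ * T ^ 3 * ((1 + t / T) ^ 4 * Real.exp (-(a * (t / T) / 2))) := by ring
    _ ≤ Real.exp 1 * K₀ * T ^ 3
        * (24 * (4 / a) ^ 4 * Real.exp (a / 4) * Real.exp (-(a / 4 * (t / T)))) :=
        mul_le_mul_of_nonneg_left hpoly (by positivity)
    _ = _ := by ring

lemma integral_symm_interval {g : ℝ → ℂ} (hg : Integrable g) (p δ : ℝ) :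
    ∫ x in (p - δ)..(p + δ), g x = ∫ t in (0 : ℝ)..δ, (g (p + t) + g (p - t)) := by
  have i1 : IntervalIntegrable (fun t => g (p + t)) volume 0 δ :=
    (hg.comp_add_left p).intervalIntegrable
  have i2 : IntervalIntegrable (fun t => g (p - t)) volume 0 δ :=
    (hg.comp_sub_left p).intervalIntegrable
  rw [intervalIntegral.integral_add i1 i2, intervalIntegral.integral_comp_add_left,
    intervalIntegral.integral_comp_sub_left, add_zero, sub_zero,
    ← intervalIntegral.integral_add_adjacent_intervals (b := p) hg.intervalIntegrable
      hg.intervalIntegrable]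
  exact add_comm _ _

lemma exists_test_function_bounds {f : ℝ → ℂ} (hf : ContDiff ℝ 2 f) {M : ℝ}
    (hM : ∀ x, ‖f x‖ ≤ M) (p : ℝ) :
    ∃ C, 0 ≤ C ∧ M ≤ C ∧ ∀ t, |t| ≤ 1 → ‖f (p + t) - f (p - t)‖ ≤ C * |t| ∧
      ‖f (p + t) + f (p - t) - 2 * f p‖ ≤ C * |t| ^ 2 := by
  obtain ⟨C, hC0, hC⟩ := exists_taylor_two hf p
  have hM0 : 0 ≤ M := (norm_nonneg _).trans (hM p)
  have hn := norm_nonneg (deriv f p)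
  refine ⟨M + 2 * C + 2 * ‖deriv f p‖, by positivity, by linarith, fun t ht => ?_⟩
  have h1 := hC t ht
  have h2 := hC (-t) (by rwa [abs_neg])
  rw [abs_neg, ← sub_eq_add_neg] at h2
  have hsq : |t| ^ 2 ≤ |t| := by nlinarith [abs_nonneg t]
  constructor
  · calc ‖f (p + t) - f (p - t)‖
        = ‖(f (p + t) - f p - t • deriv f p) - (f (p - t) - f p - (-t) • deriv f p)
          + (2 * t) • deriv f p‖ := by congr 1; module
      _ ≤ C * |t| ^ 2 + C * |t| ^ 2 + 2 * |t| * ‖deriv f p‖ := by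
          refine (norm_add_le _ _).trans (add_le_add ((norm_sub_le _ _).trans (add_le_add h1 h2)) ?_)
          rw [norm_smul, norm_mul, Real.norm_eq_abs, Real.norm_eq_abs, abs_two]
      _ ≤ _ := by
          have : C * |t| ^ 2 ≤ C * |t| := by gcongr
          have : 0 ≤ M * |t| := by positivity
          linarith
  · calc ‖f (p + t) + f (p - t) - 2 * f p‖
        = ‖(f (p + t) - f p - t • deriv f p) + (f (p - t) - f p - (-t) • deriv f p)‖ := by
          rw [neg_smul]; congr 1; ring
      _ ≤ C * |t| ^ 2 + C * |t| ^ 2 := (norm_add_le _ _).trans (add_le_add h1 h2)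
      _ ≤ _ := by
          have : 0 ≤ M * |t| ^ 2 := by positivity
          have : 0 ≤ 2 * ‖deriv f p‖ * |t| ^ 2 := by positivity
          linarith

lemma thermalDensity_of_lt {h q : ℝ} {E : ℝ → ℝ → ℂ} {T y : ℝ} (him : |(E T y / T).im| ≤ 1)
    (hy : q < |y|) :
    thermalDensity h q E T y = T * logOneAddExpNeg (E T y / T) - T * logOneAddInfty h T := by
  have hy' : y ∉ Icc (-q) q := fun h => by have := abs_le.2 h; linarith
  rw [thermalDensity, thermalExcess, indicator_of_notMem hy', add_zero,
    show -E T y / (T : ℂ) = -(E T y / T) from neg_div _ _, logOneAddExp_neg_eq him]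

lemma thermalDensity_of_le {h q : ℝ} {E : ℝ → ℝ → ℂ} {T y : ℝ} (hT : T ≠ 0)
    (him : |(E T y / T).im| ≤ 1) (hy : |y| ≤ q) :
    thermalDensity h q E T y = T * logOneAddExpNeg (-(E T y / T)) - T * logOneAddInfty h T := by
  have hT0 : (T : ℂ) ≠ 0 := ofReal_ne_zero.2 hT
  rw [thermalDensity, thermalExcess, indicator_of_mem (show y ∈ Icc (-q) q from abs_le.1 hy),
    show -E T y / (T : ℂ) = -(E T y / T) from neg_div _ _, logOneAddExp_neg_eq him,
    logOneAddExpNeg_eq_neg_add him]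
  field_simp
  ring

namespace LowTempFamily

variable {J h ζ q : ℝ} {E : ℝ → ℝ → ℂ} {ε₀ ε₁ ε₂ : ℝ → ℝ}

lemma zero_mul_sign (H : LowTempFamily J h ζ q E ε₀ ε₁ ε₂) {σ : ℝ} (hσ : |σ| = 1) (x : ℝ) :
    ε₀ (σ * x) = ε₀ x := by
  rw [← H.zero_abs (σ * x), abs_mul, hσ, one_mul, H.zero_abs]

/-- Taylor expansion of the energy around a Fermi point, jointly in the distance and in `T`. -/
lemma exists_energy_taylor (H : LowTempFamily J h ζ q E ε₀ ε₁ ε₂) {σ : ℝ} (hσ : |σ| = 1) :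
    ∃ b C : ℝ, 0 ≤ C ∧ ∀ᶠ T : ℝ in 𝓝[>] (0 : ℝ), ∀ t : ℝ, |t| ≤ 1 →
      ‖E T (σ * (q + t)) - ((deriv ε₀ q * t + b * t ^ 2 + T ^ 2 * ε₂ (σ * q) : ℝ) : ℂ)‖
        ≤ C * (|t| + T) ^ 3 := by
  obtain ⟨b, C₀, hC₀0, hC₀⟩ := exists_taylor_three (H.contDiff_zero 3) q
  obtain ⟨C₁, hC₁0, hC₁⟩ := H.exists_close
  obtain ⟨L, hL0, hL⟩ := H.exists_lipschitz_two
  refine ⟨b, C₀ + L + C₁, by positivity, ?_⟩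
  filter_upwards [hC₁] with T ⟨hT, _, _, _, _, hrem, _⟩ t ht
  have h1 := hC₀ t ht
  rw [H.zero_fermi, sub_zero, smul_eq_mul, smul_eq_mul, Real.norm_eq_abs] at h1
  have h2 := hrem (σ * (q + t))
  have h3 : |ε₂ (σ * (q + t)) - ε₂ (σ * q)| ≤ L * |t| := by
    refine (hL _ _).trans (le_of_eq ?_)
    rw [show σ * (q + t) - σ * q = σ * t by ring, abs_mul, hσ, one_mul]
  have hdec : E T (σ * (q + t)) - ((deriv ε₀ q * t + b * t ^ 2 + T ^ 2 * ε₂ (σ * q) : ℝ) : ℂ)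
      = ((ε₀ (q + t) - t * deriv ε₀ q - t ^ 2 * b : ℝ) : ℂ)
        + ((T ^ 2 * (ε₂ (σ * (q + t)) - ε₂ (σ * q)) : ℝ) : ℂ)
        + expansionRem E ε₀ ε₁ ε₂ T (σ * (q + t)) := by
    rw [expansionRem, H.one_eq_zero, H.zero_mul_sign hσ]
    push_cast
    ring
  have ht0 := abs_nonneg t
  have e1 : |t| ^ 3 ≤ (|t| + T) ^ 3 := by gcongr; linarith
  have e2 : T ^ 2 * |t| ≤ (|t| + T) ^ 3 := by
    calc T ^ 2 * |t| ≤ (|t| + T) ^ 2 * (|t| + T) := by gcongr <;> linarith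
      _ = _ := by ring
  have e3 : T ^ 3 ≤ (|t| + T) ^ 3 := by gcongr; linarith
  rw [hdec]
  calc _ ≤ C₀ * |t| ^ 3 + T ^ 2 * (L * |t|) + C₁ * T ^ 3 := by
        refine (norm_add_le _ _).trans (add_le_add ((norm_add_le _ _).trans (add_le_add ?_ ?_)) h2)
        · rw [norm_real, Real.norm_eq_abs]; exact h1
        · rw [norm_real, norm_mul, Real.norm_of_nonneg (by positivity), Real.norm_eq_abs]
          gcongr
    _ = C₀ * |t| ^ 3 + L * (T ^ 2 * |t|) + C₁ * T ^ 3 := by ring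
    _ ≤ C₀ * (|t| + T) ^ 3 + L * (|t| + T) ^ 3 + C₁ * (|t| + T) ^ 3 := by gcongr
    _ = _ := by ring

lemma exists_thermalDensity_pair_le (H : LowTempFamily J h ζ q E ε₀ ε₁ ε₂) {f : ℝ → ℂ}
    (hf : ContDiff ℝ 2 f) {M : ℝ} (hM : ∀ x, ‖f x‖ ≤ M) {σ : ℝ} (hσ : |σ| = 1) {δ₀ : ℝ}
    (hδ₀ : 0 < δ₀) (hδ₀q : δ₀ ≤ q) :
    ∃ δ K : ℝ, 0 < δ ∧ δ ≤ δ₀ ∧ δ ≤ 1 ∧ 0 ≤ K ∧ ∀ᶠ T : ℝ in 𝓝[>] (0 : ℝ), ∀ t, 0 < t → t ≤ δ →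
      ‖thermalDensity h q E T (σ * (q + t)) * f (σ * (q + t))
        + thermalDensity h q E T (σ * (q - t)) * f (σ * (q - t))
        - 2 * T * (Real.log (1 + Real.exp (-(deriv ε₀ q * t / T))) : ℝ) * f (σ * q)‖
      ≤ K * T ^ 3 * Real.exp (-(deriv ε₀ q / 4 * (t / T))) + 2 * M * Real.exp (-(h / T)) := by
  obtain ⟨b, C₀, hC₀0, hC₀⟩ := H.exists_energy_taylor hσ
  obtain ⟨C₁, hC₁0, hMC₁, hC₁⟩ := exists_test_function_bounds hf hM (σ * q)
  have hM0 : 0 ≤ M := (norm_nonneg _).trans (hM 0)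
  obtain ⟨δ, K, τ, hδ, hδδ₀, hδ1, hK, hτ, hpair⟩ := exists_fermi_pair_estimate b (ε₂ (σ * q))
    H.deriv_pos hδ₀ (show 0 ≤ C₀ + C₁ by positivity)
  obtain ⟨C₂, _, hC₂⟩ := H.exists_close
  refine ⟨δ, K, hδ, hδδ₀, hδ1, hK, ?_⟩
  filter_upwards [hC₀, hC₂, mem_nhdsWithin_of_mem_nhds (Iio_mem_nhds hτ)]
    with T htay ⟨hT, hT1, _, _, him, _⟩ hTτ t ht htδ
  have hq := H.q_pos
  have ht1 : |t| ≤ 1 := by rw [abs_of_pos ht]; linarith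
  have houter : q < |σ * (q + t)| := by
    rw [abs_mul, hσ, one_mul, abs_of_pos (by linarith)]; linarith
  have hinner : |σ * (q - t)| ≤ q := by
    rw [abs_mul, hσ, one_mul, abs_le]; constructor <;> linarith
  have hA := htay t ht1
  have hB := htay (-t) (by rwa [abs_neg])
  rw [abs_of_pos ht] at hA
  rw [abs_neg, abs_of_pos ht, ← sub_eq_add_neg, mul_neg, neg_sq] at hB
  obtain ⟨hF1, hF2⟩ := hC₁ (σ * t) (by rwa [abs_mul, hσ, one_mul])
  rw [abs_mul, hσ, one_mul, abs_of_pos ht, ← mul_add, ← mul_sub] at hF1 hF2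
  have hC01 : C₀ ≤ C₀ + C₁ := by linarith
  have hC11 : C₁ ≤ C₀ + C₁ := by linarith
  have hest := hpair T hT (le_of_lt hTτ) t ht.le htδ (E T (σ * (q + t))) (E T (σ * (q - t)))
    (f (σ * (q + t))) (f (σ * (q - t))) (f (σ * q)) (him _) (him _)
    (hA.trans (mul_le_mul_of_nonneg_right hC01 (by positivity)))
    (hB.trans (mul_le_mul_of_nonneg_right hC01 (by positivity)))
    ((hM _).trans (hMC₁.trans hC11)) ((hM _).trans (hMC₁.trans hC11))
    (hF1.trans (mul_le_mul_of_nonneg_right hC11 ht.le))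
    (hF2.trans (mul_le_mul_of_nonneg_right hC11 (by positivity)))
  rw [logOneAddExpNeg_ofReal] at hest
  rw [thermalDensity_of_lt (him _) houter, thermalDensity_of_le hT.ne' (him _) hinner]
  have hL : ‖(T : ℂ) * logOneAddInfty h T * (f (σ * (q + t)) + f (σ * (q - t)))‖
      ≤ 2 * M * Real.exp (-(h / T)) := by
    rw [norm_mul, norm_mul, norm_real, norm_real, Real.norm_of_nonneg hT.le,
      Real.norm_of_nonneg (logOneAddInfty_nonneg h T)]
    calc T * logOneAddInfty h T * ‖f (σ * (q + t)) + f (σ * (q - t))‖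
        ≤ 1 * Real.exp (-(h / T)) * (M + M) := by
          gcongr
          · exact logOneAddInfty_nonneg h T
          · exact logOneAddInfty_le h T
          · exact (norm_add_le _ _).trans (add_le_add (hM _) (hM _))
      _ = _ := by ring
  refine le_trans (le_of_eq ?_) ((norm_sub_le _ _).trans (add_le_add hest hL))
  congr 1
  ring

lemma integrable_thermalDensity_mul {f : ℝ → ℂ} (hf : Continuous f) {M : ℝ}
    (hM : ∀ x, ‖f x‖ ≤ M) {T : ℝ} (hD : Integrable (thermalDensity h q E T)) :
    Integrable fun y => thermalDensity h q E T y * f y :=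
  hD.mul_bdd hf.aestronglyMeasurable (Eventually.of_forall hM)

/-- The contribution of a neighbourhood of a single Fermi point `σ q`, `σ = ±1`. The integral over
the symmetric neighbourhood is folded to `t ∈ [0, δ]`; the pair estimate replaces the integrand by
`2 T ln (1 + e^{-a t / T}) f(σ q)`, `a = ε₀'(q)`, up to an error of order `T³ e^{-a t / 4T}` and an
exponentially small one. -/
lemma exists_near_fermi_isBigO (H : LowTempFamily J h ζ q E ε₀ ε₁ ε₂) {f : ℝ → ℂ}
    (hf : ContDiff ℝ 2 f) {M : ℝ} (hM : ∀ x, ‖f x‖ ≤ M) {σ : ℝ} (hσ : σ = 1 ∨ σ = -1) {δ₀ : ℝ}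
    (hδ₀ : 0 < δ₀) (hδ₀q : δ₀ ≤ q) :
    ∃ δ : ℝ, 0 < δ ∧ δ ≤ δ₀ ∧ δ ≤ 1 ∧ (fun T : ℝ =>
      (∫ x in (σ * q - δ)..(σ * q + δ), thermalDensity h q E T x * f x)
        - π ^ 2 * (T : ℂ) ^ 2 / (6 * (deriv ε₀ q : ℝ)) * f (σ * q))
      =O[𝓝[>] 0] fun T : ℝ => T ^ 4 := by
  have hσ1 : |σ| = 1 := by rcases hσ with rfl | rfl <;> simp
  obtain ⟨δ, K, hδ, hδδ₀, hδ1, hK, hpair⟩ := H.exists_thermalDensity_pair_le hf hM hσ1 hδ₀ hδ₀q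
  obtain ⟨C, _, hC⟩ := H.exists_integral_norm_thermalDensity_le
  have ha := H.deriv_pos
  have hh := H.h_pos
  have hM0 : 0 ≤ M := (norm_nonneg _).trans (hM 0)
  set a := deriv ε₀ q
  refine ⟨δ, hδ, hδδ₀, hδ1, Asymptotics.IsBigO.of_bound
    (K * (4 / a) + 2 * M * (Nat.factorial 4 / h ^ 4)
      + 2 * M / a * (Nat.factorial 4 / (a * δ) ^ 4)) ?_⟩
  filter_upwards [hpair, hC, self_mem_nhdsWithin, mem_nhdsWithin_of_mem_nhds (Iio_mem_nhds one_pos)]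
    with T hp ⟨hD, _⟩ hT hT1
  have hT : 0 < T := hT
  have hT1 : T < 1 := hT1
  have hg := integrable_thermalDensity_mul hf.continuous hM hD
  set g : ℝ → ℂ := fun y => thermalDensity h q E T y * f y with hgdef
  set l : ℝ → ℝ := fun t => Real.log (1 + Real.exp (-(a * t / T))) with hl
  have hint1 : ∫ x in (σ * q - δ)..(σ * q + δ), g x
      = ∫ t in (0 : ℝ)..δ, (g (σ * (q + t)) + g (σ * (q - t))) := by
    rw [integral_symm_interval hg]
    refine intervalIntegral.integral_congr fun t _ => ?_
    rcases hσ with rfl | rfl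
    · simp
    · rw [add_comm (g _)]
      congr 2 <;> ring
  have hi1 : IntervalIntegrable (fun t => g (σ * (q + t)) + g (σ * (q - t))) volume 0 δ := by
    rcases hσ with rfl | rfl
    · simp only [one_mul]
      exact ((hg.comp_add_left q).add (hg.comp_sub_left q)).intervalIntegrable
    · have e1 : ∀ t : ℝ, -1 * (q + t) = -q - t := fun t => by ring
      have e2 : ∀ t : ℝ, -1 * (q - t) = -q + t := fun t => by ring
      simp only [e1, e2]
      exact ((hg.comp_sub_left (-q)).add (hg.comp_add_left (-q))).intervalIntegrable
  have hlc : Continuous l := by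
    refine Continuous.log (by fun_prop) fun t => ?_
    positivity
  have hi2 : IntervalIntegrable (fun t => 2 * (T : ℂ) * (l t : ℂ) * f (σ * q)) volume 0 δ :=
    Continuous.intervalIntegrable (by fun_prop) _ _
  have hint2 : ∫ t in (0 : ℝ)..δ, 2 * (T : ℂ) * (l t : ℂ) * f (σ * q)
      = 2 * ((T * ∫ t in (0 : ℝ)..δ, l t : ℝ) : ℂ) * f (σ * q) := by
    rw [intervalIntegral.integral_mul_const, intervalIntegral.integral_const_mul,
      intervalIntegral.integral_ofReal]
    push_cast
    ring
  have hexpint : ∫ t in (0 : ℝ)..δ, Real.exp (-(a / 4 * (t / T))) ≤ 4 / a * T := by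
    have hk : 0 < a / (4 * T) := by positivity
    have e : ∀ t, Real.exp (-(a / 4 * (t / T))) = Real.exp (-(a / (4 * T) * t)) := fun t => by
      congr 2; field_simp
    simp only [e]
    rw [intervalIntegral.integral_of_le hδ.le]
    refine (setIntegral_mono_set (integrableOn_exp_neg_mul_Ioi hk 0)
      (Eventually.of_forall fun t => (Real.exp_pos _).le)
      (Eventually.of_forall fun t ht => ht.1)).trans (le_of_eq ?_)
    rw [integral_exp_neg_mul_Ioi hk]
    field_simp
  have hb1 : ‖(∫ t in (0 : ℝ)..δ, (g (σ * (q + t)) + g (σ * (q - t))))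
      - ∫ t in (0 : ℝ)..δ, 2 * (T : ℂ) * (l t : ℂ) * f (σ * q)‖
      ≤ K * T ^ 3 * (4 / a * T) + 2 * M * Real.exp (-(h / T)) := by
    rw [← intervalIntegral.integral_sub hi1 hi2]
    refine (intervalIntegral.norm_integral_le_of_norm_le hδ.le
      (g := fun t => K * T ^ 3 * Real.exp (-(a / 4 * (t / T))) + 2 * M * Real.exp (-(h / T)))
      (Eventually.of_forall fun t ht => hp t ht.1 ht.2)
      (Continuous.intervalIntegrable (by fun_prop) _ _)).trans ?_
    rw [intervalIntegral.integral_add (Continuous.intervalIntegrable (by fun_prop) _ _)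
      (Continuous.intervalIntegrable (by fun_prop) _ _), intervalIntegral.integral_const_mul,
      intervalIntegral.integral_const, smul_eq_mul, sub_zero]
    refine add_le_add (mul_le_mul_of_nonneg_left hexpint (by positivity)) ?_
    exact mul_le_of_le_one_left (by positivity) hδ1
  have hb2 := abs_fermi_integral_sub_le ha hδ hT
  have hb3 : ‖2 * ((T * ∫ t in (0 : ℝ)..δ, l t : ℝ) : ℂ) * f (σ * q)
      - π ^ 2 * (T : ℂ) ^ 2 / (6 * (a : ℝ)) * f (σ * q)‖
      ≤ 2 * M / a * Real.exp (-(a * δ / T)) := by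
    have hac : (a : ℂ) ≠ 0 := ofReal_ne_zero.2 ha.ne'
    have e : 2 * ((T * ∫ t in (0 : ℝ)..δ, l t : ℝ) : ℂ) * f (σ * q)
        - π ^ 2 * (T : ℂ) ^ 2 / (6 * (a : ℝ)) * f (σ * q)
        = 2 * ((T * (∫ t in (0 : ℝ)..δ, l t) - π ^ 2 * T ^ 2 / (12 * a) : ℝ) : ℂ) * f (σ * q) := by
      push_cast
      field_simp
      ring
    rw [e, norm_mul, norm_mul, norm_real, Real.norm_eq_abs, RCLike.norm_ofNat]
    calc 2 * |T * (∫ t in (0 : ℝ)..δ, l t) - π ^ 2 * T ^ 2 / (12 * a)| * ‖f (σ * q)‖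
        ≤ 2 * (1 / a * Real.exp (-(a * δ / T))) * M := by
          gcongr
          · refine hb2.trans ?_
            gcongr
            exact pow_le_one₀ hT.le hT1.le
          · exact hM _
      _ = _ := by ring
  have x1 := exp_neg_div_le 4 hh hT
  have x2 := exp_neg_div_le 4 (show 0 < a * δ by positivity) hT
  rw [hint1, Real.norm_of_nonneg (by positivity)]
  calc _ = ‖((∫ t in (0 : ℝ)..δ, (g (σ * (q + t)) + g (σ * (q - t))))
      - ∫ t in (0 : ℝ)..δ, 2 * (T : ℂ) * (l t : ℂ) * f (σ * q))
      + (2 * ((T * ∫ t in (0 : ℝ)..δ, l t : ℝ) : ℂ) * f (σ * q)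
      - π ^ 2 * (T : ℂ) ^ 2 / (6 * (a : ℝ)) * f (σ * q))‖ := by rw [hint2]; congr 1; ring
    _ ≤ (K * T ^ 3 * (4 / a * T) + 2 * M * (Nat.factorial 4 / h ^ 4 * T ^ 4))
        + 2 * M / a * (Nat.factorial 4 / (a * δ) ^ 4 * T ^ 4) :=
      (norm_add_le _ _).trans (add_le_add (hb1.trans (by gcongr)) (hb3.trans (by gcongr)))
    _ = _ := by ring

/-- The Sommerfeld expansion: the thermal density acts on smooth test functions as
`π² T² / (6 ε₀'(q)) (δ_q + δ_{-q}) + O(T⁴)`. -/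
lemma sommerfeld_isBigO (H : LowTempFamily J h ζ q E ε₀ ε₁ ε₂) {f : ℝ → ℂ}
    (hf : ContDiff ℝ 2 f) {M : ℝ} (hM : ∀ x, ‖f x‖ ≤ M) :
    (fun T : ℝ => (∫ x, thermalDensity h q E T x * f x)
        - π ^ 2 * (T : ℂ) ^ 2 / (6 * (deriv ε₀ q : ℝ)) * (f q + f (-q)))
      =O[𝓝[>] 0] fun T : ℝ => T ^ 4 := by
  have hq := H.q_pos
  have hM0 : 0 ≤ M := (norm_nonneg _).trans (hM 0)
  obtain ⟨δ, hδ, hδq, hδ1, hO⟩ := H.exists_near_fermi_isBigO hf hM (Or.inl rfl) (half_pos hq)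
    (by linarith)
  obtain ⟨δ', hδ', hδq', hδ1', hO'⟩ := H.exists_near_fermi_isBigO hf hM (Or.inr rfl) (half_pos hq)
    (by linarith)
  simp only [one_mul, neg_one_mul] at hO hO'
  obtain ⟨c, C, hc, hC0, hC⟩ := H.exists_norm_thermalDensity_le
  obtain ⟨C', hC'0, hC'⟩ := H.exists_integral_energyWeight_le
  obtain ⟨C₂, _, hC₂⟩ := H.exists_integral_norm_thermalDensity_le
  set s := Ioc (q - δ) (q + δ) with hs
  set s' := Ioc (-q - δ') (-q + δ') with hs'
  set d := min δ δ' with hd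
  have hd0 : 0 < d := lt_min hδ hδ'
  have hd1 : d ≤ 1 := (min_le_left _ _).trans hδ1
  have hdisj : Disjoint s s' := by
    rw [Set.disjoint_left]
    rintro x ⟨h1, _⟩ ⟨_, h2⟩
    linarith
  -- outside both neighbourhoods the density is exponentially small
  have haway : (fun T : ℝ => ∫ x in (s ∪ s')ᶜ, thermalDensity h q E T x * f x)
      =O[𝓝[>] 0] fun T : ℝ => T ^ 4 := by
    refine (Asymptotics.IsBigO.of_bound (M * (C + 1) * (2 * (q + 1) + C')) ?_).trans
      (exp_neg_div_isBigO 4 (show 0 < c * d by positivity))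
    filter_upwards [hC, hC'] with T ⟨hT, hT1, _, hn, hfar⟩ ⟨hw, hwle⟩
    have hexp : Real.exp (-(c / T)) ≤ Real.exp (-(c * d / T)) := by
      refine Real.exp_le_exp.2 (neg_le_neg ?_)
      gcongr
      exact mul_le_of_le_one_right hc.le hd1
    have hi0 : ∀ y, 0 ≤ (Icc (-(q + 1)) (q + 1)).indicator (fun _ => (1 : ℝ)) y := fun y =>
      indicator_nonneg (fun _ _ => zero_le_one) y
    have hw0 : ∀ y, 0 ≤ energyWeight h E ε₀ ε₁ ε₂ T y := fun y => by
      rw [energyWeight]; positivity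
    have hii : Integrable ((Icc (-(q + 1)) (q + 1)).indicator (fun _ => (1 : ℝ))) := by
      rw [integrable_indicator_iff measurableSet_Icc]
      exact continuous_const.continuousOn.integrableOn_compact isCompact_Icc
    set G : ℝ → ℝ := fun y => M * (C + 1) * Real.exp (-(c * d / T))
      * ((Icc (-(q + 1)) (q + 1)).indicator (fun _ => (1 : ℝ)) y
        + energyWeight h E ε₀ ε₁ ε₂ T y) with hG
    have hGint : Integrable G := (hii.add hw).const_mul _
    have hG0 : ∀ y, 0 ≤ G y := fun y =>
      mul_nonneg (by positivity) (add_nonneg (hi0 y) (hw0 y))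
    have hle : ∀ y ∈ (s ∪ s')ᶜ, ‖thermalDensity h q E T y * f y‖ ≤ G y := by
      intro y hy
      rw [norm_mul, mul_comm]
      have key : ‖thermalDensity h q E T y‖ ≤ (C + 1) * Real.exp (-(c * d / T))
          * ((Icc (-(q + 1)) (q + 1)).indicator (fun _ => (1 : ℝ)) y
            + energyWeight h E ε₀ ε₁ ε₂ T y) := by
        rcases le_or_gt |y| (q + 1) with h1 | h1
        · have hdist : d ≤ |(|y| - q)| := by
            by_contra hcon
            rw [not_le] at hcon
            have h2 := abs_lt.1 hcon
            have h3 : d ≤ δ := min_le_left _ _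
            have h4 : d ≤ δ' := min_le_right _ _
            refine hy ?_
            rcases abs_cases y with ⟨h5, _⟩ | ⟨h5, _⟩ <;> rw [h5] at h2
            · exact Or.inl ⟨by linarith, by linarith⟩
            · exact Or.inr ⟨by linarith, by linarith⟩
          have h2 : Real.exp (-(c / T * |(|y| - q)|)) ≤ Real.exp (-(c * d / T)) := by
            refine Real.exp_le_exp.2 (neg_le_neg ?_)
            rw [mul_div_right_comm]
            gcongr
          rw [indicator_of_mem (show y ∈ Icc (-(q + 1)) (q + 1) from abs_le.1 h1)]
          calc _ ≤ C * T * Real.exp (-(c / T * |(|y| - q)|)) + Real.exp (-(c / T)) := hn y h1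
            _ ≤ C * 1 * Real.exp (-(c * d / T)) + Real.exp (-(c * d / T)) := by gcongr
            _ = (C + 1) * Real.exp (-(c * d / T)) * 1 := by ring
            _ ≤ _ := by
              gcongr
              linarith [hw0 y]
        · calc _ ≤ C * Real.exp (-(c / T)) * energyWeight h E ε₀ ε₁ ε₂ T y := hfar y h1
            _ ≤ (C + 1) * Real.exp (-(c * d / T)) * energyWeight h E ε₀ ε₁ ε₂ T y := by
              have := hw0 y
              gcongr
              linarith
            _ ≤ _ := by
              gcongr
              linarith [hi0 y]
      calc ‖f y‖ * ‖thermalDensity h q E T y‖ ≤ M * _ :=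
            mul_le_mul (hM y) key (norm_nonneg _) hM0
        _ = G y := by rw [hG]; ring
    have hval : ∫ y, G y = M * (C + 1) * Real.exp (-(c * d / T))
        * (2 * (q + 1) + ∫ y, energyWeight h E ε₀ ε₁ ε₂ T y) := by
      rw [hG, integral_const_mul, integral_add hii hw, integral_indicator measurableSet_Icc,
        setIntegral_const, smul_eq_mul, Real.volume_real_Icc_of_le (by linarith)]
      ring
    rw [Real.norm_of_nonneg (Real.exp_pos _).le]
    have hms : MeasurableSet (s ∪ s')ᶜ := (measurableSet_Ioc.union measurableSet_Ioc).compl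
    calc _ ≤ ∫ y in (s ∪ s')ᶜ, G y :=
          norm_integral_le_of_norm_le hGint.integrableOn
            ((ae_restrict_iff' hms).2 (Eventually.of_forall hle))
      _ ≤ ∫ y, G y := setIntegral_le_integral hGint (Eventually.of_forall hG0)
      _ ≤ M * (C + 1) * Real.exp (-(c * d / T)) * (2 * (q + 1) + C') := by rw [hval]; gcongr
      _ = _ := by ring
  refine ((hO.add hO').add haway).congr' ?_ EventuallyEq.rfl
  filter_upwards [hC₂] with T ⟨hD, _⟩
  have hg := integrable_thermalDensity_mul hf.continuous hM hD
  rw [← integral_add_compl (measurableSet_Ioc.union measurableSet_Ioc : MeasurableSet (s ∪ s')) hg,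
    setIntegral_union hdisj measurableSet_Ioc hg.integrableOn hg.integrableOn,
    intervalIntegral.integral_of_le (by linarith), intervalIntegral.integral_of_le (by linarith)]
  ring

/-- The Sommerfeld expansion in terms of the logarithm. -/
lemma sommerfeld_log_isBigO (H : LowTempFamily J h ζ q E ε₀ ε₁ ε₂) {f : ℝ → ℂ}
    (hf : ContDiff ℝ 2 f) {M : ℝ} (hM : ∀ x, ‖f x‖ ≤ M) :
    (∀ᶠ T : ℝ in 𝓝[>] (0 : ℝ),
      Integrable fun x => logOneAddExp (-E T x / T) - (logOneAddInfty h T : ℂ)) ∧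
    (fun T : ℝ => T * (∫ x, (logOneAddExp (-E T x / T) - (logOneAddInfty h T : ℂ)) * f x)
        + (∫ x in (-q)..q, f x * E T x)
        - π ^ 2 * (T : ℂ) ^ 2 / (6 * (deriv ε₀ q : ℝ)) * (f q + f (-q)))
      =O[𝓝[>] 0] fun T : ℝ => T ^ 4 := by
  obtain ⟨C, _, hC⟩ := H.exists_integral_norm_thermalDensity_le
  have hq := H.q_pos
  have hind : ∀ᶠ T : ℝ in 𝓝[>] (0 : ℝ), Integrable ((Icc (-q) q).indicator (E T)) := by
    filter_upwards [H.continuous] with T hcont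
    rw [integrable_indicator_iff measurableSet_Icc]
    exact hcont.continuousOn.integrableOn_compact isCompact_Icc
  have hfun : ∀ T x : ℝ, (T : ℂ) * (logOneAddExp (-E T x / T) - (logOneAddInfty h T : ℂ))
      = thermalDensity h q E T x - (Icc (-q) q).indicator (E T) x := fun T x => by
    rw [thermalDensity, thermalExcess]; ring
  constructor
  · filter_upwards [hC, hind, self_mem_nhdsWithin] with T ⟨hD, _⟩ hi hT
    have hT0 : (T : ℂ) ≠ 0 := ofReal_ne_zero.2 (ne_of_gt hT)
    have := (hD.sub hi).const_mul (T : ℂ)⁻¹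
    refine this.congr (Eventually.of_forall fun x => ?_)
    simp only [Pi.sub_apply]
    rw [← hfun, inv_mul_cancel_left₀ hT0]
  · refine (H.sommerfeld_isBigO hf hM).congr' ?_ EventuallyEq.rfl
    filter_upwards [hC, hind] with T ⟨hD, _⟩ hi
    have hg := integrable_thermalDensity_mul hf.continuous hM hD
    have hg' : Integrable fun x => (Icc (-q) q).indicator (E T) x * f x :=
      hi.mul_bdd hf.continuous.aestronglyMeasurable (Eventually.of_forall hM)
    have e1 : ∫ x, (Icc (-q) q).indicator (E T) x * f x = ∫ x in (-q)..q, f x * E T x := by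
      have : ∀ x, (Icc (-q) q).indicator (E T) x * f x
          = (Icc (-q) q).indicator (fun x => f x * E T x) x := fun x => by
        by_cases hx : x ∈ Icc (-q) q <;> simp [hx, mul_comm]
      simp only [this]
      rw [integral_indicator measurableSet_Icc, integral_Icc_eq_integral_Ioc,
        intervalIntegral.integral_of_le (by linarith)]
    have e2 : T * (∫ x, (logOneAddExp (-E T x / T) - (logOneAddInfty h T : ℂ)) * f x)
        = (∫ x, thermalDensity h q E T x * f x) - ∫ x in (-q)..q, f x * E T x := by
      rw [← e1, ← integral_sub hg hg', ← integral_const_mul]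
      refine integral_congr_ae (Eventually.of_forall fun x => ?_)
      simp only
      rw [← mul_assoc, hfun, sub_mul]
    rw [e2]
    ring

end LowTempFamily

/-! ### The hyperbolic cotangent on horizontal lines -/

lemma norm_sinh_sq (z : ℂ) : ‖sinh z‖ ^ 2 = Real.sinh z.re ^ 2 + Real.sin z.im ^ 2 := by
  have h := sinh_add_I_mul_sinh_sub_I z.re z.im
  have h1 : (z.re : ℂ) + I * z.im = z := by rw [mul_comm]; exact re_add_im z
  have h2 : (z.re : ℂ) - I * z.im = (starRingEnd ℂ) z := by
    conv_rhs => rw [← re_add_im z]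
    simp [mul_comm, sub_eq_add_neg]
  rw [h1, h2, sinh_conj, mul_conj, ofReal_inj] at h
  rw [← normSq_eq_norm_sq, h]

lemma abs_sin_im_le_norm_sinh (z : ℂ) : |Real.sin z.im| ≤ ‖sinh z‖ := by
  rw [← abs_of_nonneg (norm_nonneg (sinh z)), ← sq_le_sq, norm_sinh_sq]
  linarith [sq_nonneg (Real.sinh z.re)]

lemma sinh_ne_zero_of_sin_im_ne_zero {z : ℂ} (hz : Real.sin z.im ≠ 0) : sinh z ≠ 0 := by
  intro h
  have h1 := norm_sinh_sq z
  rw [h, norm_zero] at h1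
  have : 0 < Real.sin z.im ^ 2 := by positivity
  nlinarith [sq_nonneg (Real.sinh z.re)]

lemma sinh_ne_zero_of_abs_im_lt {z : ℂ} (hz : z ≠ 0) (him : |z.im| < π) : sinh z ≠ 0 := by
  by_cases h0 : z.im = 0
  · intro h
    have h1 := norm_sinh_sq z
    rw [h, norm_zero, h0, Real.sin_zero] at h1
    have h2 : Real.sinh z.re = 0 := by nlinarith [sq_nonneg (Real.sinh z.re)]
    exact hz (Complex.ext (Real.sinh_eq_zero.1 h2) h0)
  · refine sinh_ne_zero_of_sin_im_ne_zero fun h => h0 ?_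
    have := abs_lt.1 him
    exact (Real.sin_eq_zero_iff_of_lt_of_lt this.1 this.2).1 h

lemma norm_ccoth_le {m : ℝ} (hm : 0 < m) {z : ℂ} (hz : m ≤ |Real.sin z.im|) :
    ‖ccoth z‖ ≤ 1 + m⁻¹ := by
  have hs : m ≤ ‖sinh z‖ := hz.trans (abs_sin_im_le_norm_sinh z)
  have hs0 : 0 < ‖sinh z‖ := hm.trans_le hs
  have hsne : sinh z ≠ 0 := norm_pos_iff.1 hs0
  have h1 : ccoth z ^ 2 = 1 + (sinh z)⁻¹ ^ 2 := by
    rw [ccoth, div_pow, cosh_sq, inv_pow]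
    field_simp
  have h2 : ‖ccoth z‖ ^ 2 ≤ 1 + m⁻¹ ^ 2 := by
    rw [← norm_pow, h1]
    refine (norm_add_le _ _).trans ?_
    rw [norm_one, norm_pow, norm_inv]
    gcongr
  have : 0 < m⁻¹ := by positivity
  nlinarith [norm_nonneg (ccoth z)]

lemma ccoth_sub {a b : ℂ} (ha : sinh a ≠ 0) (hb : sinh b ≠ 0) :
    ccoth a - ccoth b = sinh (b - a) / (sinh a * sinh b) := by
  rw [ccoth, ccoth, sinh_sub]
  field_simp

lemma contDiff_ccoth_add {s : ℂ} (hs : Real.sin s.im ≠ 0) {n : WithTop ℕ∞} :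
    ContDiff ℝ n fun x : ℝ => ccoth (x + s) := by
  have h1 : ContDiff ℝ n fun x : ℝ => (x : ℂ) + s := ofRealCLM.contDiff.add contDiff_const
  simp only [ccoth, div_eq_mul_inv]
  refine ((contDiff_cosh.restrict_scalars ℝ).comp h1).mul
    (ContDiff.inv ((contDiff_sinh.restrict_scalars ℝ).comp h1) fun x => ?_)
  exact sinh_ne_zero_of_sin_im_ne_zero (by simpa using hs)

lemma norm_ccoth_sub_le {m : ℝ} (hm : 0 < m) {s s' : ℂ} (hre : s.re = s'.re)
    (hs : m ≤ |Real.sin s.im|) (hs' : m ≤ |Real.sin s'.im|) (x : ℝ) :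
    ‖ccoth (x + s) - ccoth (x + s')‖ ≤ (Real.sinh (x + s.re) ^ 2 + m ^ 2)⁻¹ := by
  have hlow : ∀ t : ℂ, t.re = s.re → m ≤ |Real.sin t.im| →
      √(Real.sinh (x + s.re) ^ 2 + m ^ 2) ≤ ‖sinh (x + t)‖ := fun t ht htm => by
    rw [← abs_of_nonneg (norm_nonneg (sinh _))]
    refine Real.sqrt_le_iff.2 ⟨abs_nonneg _, ?_⟩
    rw [sq_abs, norm_sinh_sq, add_re, add_im, ofReal_re, ofReal_im, zero_add, ht]
    have : m ^ 2 ≤ Real.sin t.im ^ 2 := by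
      rw [← sq_abs (Real.sin _)]
      gcongr
    linarith
  have hpos : 0 < √(Real.sinh (x + s.re) ^ 2 + m ^ 2) := Real.sqrt_pos.2 (by positivity)
  have h1 := hlow s rfl hs
  have h2 := hlow s' hre.symm hs'
  rw [ccoth_sub (norm_pos_iff.1 (hpos.trans_le h1)) (norm_pos_iff.1 (hpos.trans_le h2)),
    norm_div, norm_mul]
  have h3 : (x : ℂ) + s' - (x + s) = ((s'.im - s.im : ℝ) : ℂ) * I := by
    apply Complex.ext <;> simp [hre]
  rw [h3, sinh_mul_I, norm_mul, norm_I, mul_one, ← ofReal_sin, norm_real]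
  calc _ ≤ 1 / (√(Real.sinh (x + s.re) ^ 2 + m ^ 2) * √(Real.sinh (x + s.re) ^ 2 + m ^ 2)) := by
        gcongr
        exact Real.abs_sin_le_one _
    _ = _ := by rw [Real.mul_self_sqrt (by positivity), one_div]

lemma integrable_ccoth_sub {s s' : ℂ} (hre : s.re = s'.re)
    (hs : Real.sin s.im ≠ 0) (hs' : Real.sin s'.im ≠ 0) :
    Integrable fun x : ℝ => ccoth (x + s) - ccoth (x + s') := by
  set m := min |Real.sin s.im| |Real.sin s'.im|
  have hm : 0 < m := lt_min (abs_pos.2 hs) (abs_pos.2 hs')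
  refine ((integrable_inv_sinh_sq_add_sq hm.ne').comp_add_right s.re).mono'
    (((contDiff_ccoth_add hs (n := 0)).continuous.sub
      (contDiff_ccoth_add hs' (n := 0)).continuous).aestronglyMeasurable)
    (Eventually.of_forall fun x => ?_)
  exact norm_ccoth_sub_le hm hre (min_le_left _ _) (min_le_right _ _) x

lemma tendsto_ccoth_atTop : Tendsto ccoth (comap re atTop) (𝓝 1) := by
  have h1 : Tendsto (fun z : ℂ => exp (-(2 * z))) (comap re atTop) (𝓝 0) := by
    rw [tendsto_zero_iff_norm_tendsto_zero]
    have : Tendsto (fun z : ℂ => Real.exp (-(2 * z.re))) (comap re atTop) (𝓝 0) :=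
      (Real.tendsto_exp_neg_atTop_nhds_zero.comp
        (tendsto_id.const_mul_atTop (two_pos : (0 : ℝ) < 2))).comp tendsto_comap
    refine this.congr fun z => ?_
    rw [norm_exp]
    simp
  have h2 : Tendsto (fun z : ℂ => (1 + exp (-(2 * z))) / (1 - exp (-(2 * z)))) (comap re atTop)
      (𝓝 ((1 + 0) / (1 - 0))) :=
    (h1.const_add 1).div (h1.const_sub 1) (by simp)
  simp only [add_zero, sub_zero, div_one] at h2
  refine h2.congr fun z => ?_
  have h3 : exp (-(2 * z)) = exp (-z) * exp (-z) := by rw [← exp_add]; congr 1; ring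
  have h4 : exp z * exp (-z) = 1 := by rw [← exp_add, add_neg_cancel, exp_zero]
  have h5 : (1 + exp (-(2 * z))) = exp (-z) * (2 * cosh z) := by
    rw [two_cosh, h3]; linear_combination -h4
  have h6 : (1 - exp (-(2 * z))) = exp (-z) * (2 * sinh z) := by
    rw [two_sinh, h3]; linear_combination -h4
  rw [h5, h6, mul_div_mul_left _ _ (exp_ne_zero _), mul_div_mul_left _ _ two_ne_zero, ccoth]

lemma tendsto_tanh_atTop : Tendsto Real.tanh atTop (𝓝 1) := by
  have h1 : Tendsto (fun x : ℝ => (ccoth x)⁻¹) atTop (𝓝 1⁻¹) :=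
    (tendsto_ccoth_atTop.comp
      (tendsto_comap_iff.2 (tendsto_id.congr fun x => (ofReal_re x).symm))).inv₀ one_ne_zero
  have h2 := (continuous_re.tendsto _).comp h1
  rw [inv_one, one_re] at h2
  refine h2.congr fun x => ?_
  rw [Function.comp_apply, ccoth, inv_div, ← tanh_eq_sinh_div_cosh, ← ofReal_tanh, ofReal_re]

lemma tendsto_tanh_atBot : Tendsto Real.tanh atBot (𝓝 (-1)) := by
  refine (tendsto_tanh_atTop.comp tendsto_neg_atBot_atTop).neg.congr fun x => ?_
  rw [Function.comp_apply, Real.tanh_neg, neg_neg]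

lemma arctan_cot_of_pos {y : ℝ} (h0 : 0 < y) (hπ : y < π) :
    Real.arctan (Real.cos y / Real.sin y) = π / 2 - y := by
  rw [← Real.cot_eq_cos_div_sin, ← Real.tan_inv_eq_cot, ← Real.tan_pi_div_two_sub,
    Real.arctan_tan (by linarith) (by linarith)]

lemma arctan_cot_of_neg {y : ℝ} (hπ : -π < y) (h0 : y < 0) :
    Real.arctan (Real.cos y / Real.sin y) = -(π / 2) - y := by
  have := arctan_cot_of_pos (y := y + π) (by linarith) (by linarith)
  rw [Real.cos_add_pi, Real.sin_add_pi, neg_div_neg_eq] at this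
  rw [this]
  ring

lemma integral_realKernel {y : ℝ} (hs : Real.sin y ≠ 0) :
    ∫ x, realKernel y x = 4 * Real.arctan (Real.cos y / Real.sin y) := by
  have hT : Tendsto Real.tanh atTop (𝓝 1) := tendsto_tanh_atTop
  have hB : Tendsto Real.tanh atBot (𝓝 (-1)) := tendsto_tanh_atBot
  have h := integral_of_hasDerivAt_of_tendsto
    (fun x => hasDerivAt_two_mul_arctan_cot_mul_tanh hs x) (integrable_realKernel hs)
    (((Real.continuous_arctan.tendsto _).comp (hB.const_mul _)).const_mul 2)
    (((Real.continuous_arctan.tendsto _).comp (hT.const_mul _)).const_mul 2)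
  rw [h, mul_neg_one, mul_one, Real.arctan_neg]
  ring

lemma ccoth_add_ccoth_neg {y : ℝ} (hs : Real.sin y ≠ 0) (x : ℝ) :
    ccoth (x + I * y) + ccoth (-x + I * y) = -I * (realKernel y x : ℂ) := by
  have h := sinh_add_I_mul_sinh_sub_I x y
  have hw : ((Real.sinh x ^ 2 + Real.sin y ^ 2 : ℝ) : ℂ) ≠ 0 :=
    ofReal_ne_zero.2 (sinh_sq_add_sq_pos hs x).ne'
  have h1 : sinh ((x : ℂ) + I * y) ≠ 0 := left_ne_zero_of_mul (h ▸ hw)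
  have h2 : sinh ((x : ℂ) - I * y) ≠ 0 := right_ne_zero_of_mul (h ▸ hw)
  have h3 : ccoth (-x + I * y) = -ccoth (x - I * y) := by
    rw [show -(x : ℂ) + I * y = -(x - I * y) by ring, ccoth, ccoth, sinh_neg, cosh_neg, div_neg]
  rw [h3, ← sub_eq_add_neg, ccoth_sub h1 h2, h,
    show (x : ℂ) - I * y - (x + I * y) = -((2 * y : ℝ) : ℂ) * I by push_cast; ring,
    sinh_mul_I, sin_neg, realKernel]
  push_cast
  ring

/-- The integral of the difference of `coth` on two lines on either side of the pole at `0`, by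
symmetrization in `x`. -/
lemma integral_ccoth_sub {s s' : ℂ} (hre : s.re = s'.re) (h1 : -π < s.im) (h2 : s.im < 0)
    (h3 : 0 < s'.im) (h4 : s'.im < π) :
    ∫ x : ℝ, (ccoth (x + s) - ccoth (x + s')) = 2 * π * I - 2 * I * (s'.im - s.im) := by
  have hs : Real.sin s.im ≠ 0 := (Real.sin_neg_of_neg_of_neg_pi_lt h2 h1).ne
  have hs' : Real.sin s'.im ≠ 0 := (Real.sin_pos_of_pos_of_lt_pi h3 h4).ne'
  set g : ℝ → ℂ := fun x => ccoth (x + I * s.im) - ccoth (x + I * s'.im) with hg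
  have hgint : Integrable g :=
    integrable_ccoth_sub (s := I * s.im) (s' := I * s'.im) (by simp) (by simpa) (by simpa)
  have e1 : ∫ x : ℝ, (ccoth (x + s) - ccoth (x + s')) = ∫ x, g x := by
    rw [← integral_add_right_eq_self g s.re]
    refine integral_congr_ae (Eventually.of_forall fun x => ?_)
    have a1 : (x : ℂ) + s = ((x + s.re : ℝ) : ℂ) + I * s.im := by
      apply Complex.ext <;> simp
    have a2 : (x : ℂ) + s' = ((x + s.re : ℝ) : ℂ) + I * s'.im := by
      apply Complex.ext <;> simp [hre]
    simp only [hg]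
    rw [a1, a2]
  have e2 : 2 * ∫ x, g x = ∫ x, (g x + g (-x)) := by
    rw [integral_add hgint hgint.comp_neg, integral_neg_eq_self g]
    ring
  have e3 : ∀ x, g x + g (-x) = ((realKernel s.im x - realKernel s'.im x : ℝ) : ℂ) * -I := by
    intro x
    have b1 := ccoth_add_ccoth_neg hs x
    have b2 := ccoth_add_ccoth_neg hs' x
    simp only [hg]
    push_cast
    linear_combination b1 - b2
  simp only [e3] at e2
  rw [integral_mul_const, integral_complex_ofReal, integral_sub (integrable_realKernel hs)
    (integrable_realKernel hs'), integral_realKernel hs, integral_realKernel hs',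
    arctan_cot_of_neg h1 h2, arctan_cot_of_pos h3 h4] at e2
  rw [e1]
  push_cast at e2
  linear_combination e2 / 2

lemma tendsto_ccoth_atBot : Tendsto ccoth (comap re atBot) (𝓝 (-1)) := by
  have h : Tendsto (fun z : ℂ => -z) (comap re atBot) (comap re atTop) := by
    rw [tendsto_comap_iff]
    exact tendsto_neg_atBot_atTop.comp tendsto_comap
  refine (tendsto_ccoth_atTop.comp h).neg.congr fun z => ?_
  simp [ccoth, div_neg]

/-! ### Shifting a horizontal line of integration -/

lemma tendsto_intervalIntegral_vertical {G : ℂ → ℂ} {a b : ℝ} (hab : a ≤ b) {l : Filter ℝ} {c : ℂ}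
    (hG : ContinuousOn G {ω | a ≤ ω.im ∧ ω.im ≤ b})
    (hlim : Tendsto G (comap re l ⊓ 𝓟 {ω | a ≤ ω.im ∧ ω.im ≤ b}) (𝓝 c)) :
    Tendsto (fun R : ℝ => ∫ y in a..b, G (R + y * I)) l (𝓝 ((b - a) * c)) := by
  rw [Metric.tendsto_nhds] at hlim ⊢
  intro δ hδ
  have hδ' : 0 < δ / (b - a + 1) := by have : 0 ≤ b - a := sub_nonneg.2 hab; positivity
  have h := hlim _ hδ'
  rw [eventually_inf_principal, eventually_comap] at h
  filter_upwards [h] with R hR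
  have hmem : ∀ y ∈ uIcc a b, ((R : ℂ) + y * I) ∈ {ω : ℂ | a ≤ ω.im ∧ ω.im ≤ b} := fun y hy => by
    rw [uIcc_of_le hab] at hy
    simpa using hy
  have hint : IntervalIntegrable (fun y : ℝ => G (R + y * I)) volume a b := by
    refine ContinuousOn.intervalIntegrable (hG.comp ?_ hmem)
    fun_prop
  have hsub : (∫ y in a..b, G (R + y * I)) - (b - a) * c = ∫ y in a..b, (G (R + y * I) - c) := by
    rw [intervalIntegral.integral_sub hint intervalIntegrable_const,
      intervalIntegral.integral_const, real_smul]
    push_cast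
    ring
  rw [dist_eq_norm, hsub]
  calc _ ≤ δ / (b - a + 1) * |b - a| := by
        refine intervalIntegral.norm_integral_le_of_norm_le_const fun y hy => ?_
        have := hR (R + y * I) (by simp) (hmem y (uIoc_subset_uIcc hy))
        rw [dist_eq_norm] at this
        exact this.le
    _ < δ := by
        have : 0 ≤ b - a := sub_nonneg.2 hab
        rw [abs_of_nonneg this, div_mul_eq_mul_div, div_lt_iff₀ (by linarith)]
        nlinarith

/-- Cauchy's theorem on an infinite strip: the vertical sides survive in the limit when the
function has different limits at the two ends. -/
lemma integral_sub_eq_of_differentiableOn_strip {G : ℂ → ℂ} {a b : ℝ} (hab : a ≤ b) {c c' : ℂ}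
    (hG : DifferentiableOn ℂ G {ω | a ≤ ω.im ∧ ω.im ≤ b})
    (hc : Tendsto G (comap re atTop ⊓ 𝓟 {ω | a ≤ ω.im ∧ ω.im ≤ b}) (𝓝 c))
    (hc' : Tendsto G (comap re atBot ⊓ 𝓟 {ω | a ≤ ω.im ∧ ω.im ≤ b}) (𝓝 c'))
    (hint : Integrable fun x : ℝ => G (x + a * I) - G (x + b * I)) :
    ∫ x : ℝ, (G (x + a * I) - G (x + b * I)) = -I * ((b - a) * (c - c')) := by
  have h1 := intervalIntegral_tendsto_integral hint tendsto_neg_atTop_atBot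
    (tendsto_id (α := ℝ) (x := atTop))
  have h2 := ((tendsto_intervalIntegral_vertical hab hG.continuousOn hc).sub
    ((tendsto_intervalIntegral_vertical hab hG.continuousOn hc').comp
      tendsto_neg_atTop_atBot)).const_mul (-I)
  refine tendsto_nhds_unique h1 ?_
  rw [mul_sub ((b : ℂ) - a) c c']
  refine h2.congr fun R => ?_
  have h3 := Complex.integral_boundary_rect_eq_zero_of_differentiableOn G
    (((-R : ℝ) : ℂ) + a * I) ((R : ℂ) + b * I) (hG.mono fun ω hω => by
      have := (mem_reProdIm.1 hω).2
      rw [show (((-R : ℝ) : ℂ) + a * I).im = a by simp, show ((R : ℂ) + b * I).im = b by simp,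
        uIcc_of_le hab] at this
      exact this)
  simp only [add_re, add_im, ofReal_re, ofReal_im, mul_re, mul_im, I_re, I_im, mul_zero, mul_one,
    sub_zero, add_zero, zero_add, smul_eq_mul] at h3
  have hi : ∀ t : ℝ, t ∈ Icc a b → IntervalIntegrable (fun x : ℝ => G (x + t * I)) volume (-R) R :=
    fun t ht => by
      refine ContinuousOn.intervalIntegrable (hG.continuousOn.comp (by fun_prop) fun x _ => ?_)
      simpa using ht
  simp only [id, Function.comp_apply]
  rw [intervalIntegral.integral_sub (hi a (left_mem_Icc.2 hab)) (hi b (right_mem_Icc.2 hab))]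
  linear_combination -h3

lemma differentiable_dslope_sinh : Differentiable ℂ (dslope sinh 0) := by
  rw [← differentiableOn_univ, Complex.differentiableOn_dslope univ_mem]
  exact differentiable_sinh.differentiableOn

lemma dslope_sinh_ne_zero {z : ℂ} (hz : |z.im| < π) : dslope sinh 0 z ≠ 0 := by
  rcases eq_or_ne z 0 with h0 | h0
  · rw [h0, dslope_same, Complex.deriv_sinh, cosh_zero]
    exact one_ne_zero
  · rw [dslope_of_ne _ h0, slope_def_field, sinh_zero, sub_zero, sub_zero]
    exact div_ne_zero (sinh_ne_zero_of_abs_im_lt h0 hz) h0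

lemma ccoth_eq_inv_mul {z : ℂ} (hz : z ≠ 0) : ccoth z = z⁻¹ * (cosh z / dslope sinh 0 z) := by
  rw [dslope_of_ne _ hz, slope_def_field, sinh_zero, sub_zero, sub_zero, ccoth]
  field_simp

lemma circleIntegral_ccoth_mul {g : ℂ → ℂ} {c : ℂ} {r : ℝ} (hr : 0 < r) (hrπ : r < π)
    (hg : DifferentiableOn ℂ g (Metric.closedBall c r)) :
    ∮ z in C(c, r), ccoth (z - c) * g z = 2 * π * I * g c := by
  have hlin : Differentiable ℂ fun z : ℂ => z - c := by fun_prop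
  have hd : DifferentiableOn ℂ (fun z => cosh (z - c) / dslope sinh 0 (z - c) * g z)
      (Metric.closedBall c r) := by
    refine (((differentiable_cosh.comp hlin).differentiableOn).div
      ((differentiable_dslope_sinh.comp hlin).differentiableOn) fun z hz => ?_).mul hg
    refine dslope_sinh_ne_zero ((abs_im_le_norm _).trans_lt (lt_of_le_of_lt ?_ hrπ))
    simpa [dist_eq_norm] using hz
  have h := (hd.diffContOnCl_ball subset_rfl).circleIntegral_sub_inv_smul
    (Metric.mem_ball_self hr)
  rw [sub_self, cosh_zero, dslope_same, Complex.deriv_sinh, cosh_zero, div_one, one_mul,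
    smul_eq_mul] at h
  rw [← h]
  refine circleIntegral.integral_congr hr.le fun z hz => ?_
  have hne : z - c ≠ 0 := sub_ne_zero.2 (ne_of_mem_of_not_mem hz (by simp [hr.ne]))
  simp only [smul_eq_mul]
  rw [ccoth_eq_inv_mul hne, mul_assoc]

/-- Shifting the line of integration of `L ω * coth (ω - p)` picks up the residue at `p` and, since
`coth → ±1`, a contribution `∓ L∞` of each end of the strip. The pole is removed by subtracting
`L p * coth (ω - p)`, whose integral is known. -/
lemma integral_sub_mul_ccoth {L : ℂ → ℂ} {Linf p : ℂ} {a b : ℝ} (ha : 0 < a) (hab : a < b)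
    (hb : b < π / 2) (hp : -(π / 2) ≤ p.im) (hp' : p.im < π / 2) (hpa : p.im ≠ a) (hpb : p.im ≠ b)
    (hL : DifferentiableOn ℂ L {ω | a ≤ ω.im ∧ ω.im ≤ b})
    (hlim : Tendsto L (comap (fun ω : ℂ => |ω.re|) atTop ⊓ 𝓟 {ω | a ≤ ω.im ∧ ω.im ≤ b}) (𝓝 Linf))
    (hia : Integrable fun x : ℝ => L (x + a * I) - Linf)
    (hib : Integrable fun x : ℝ => L (x + b * I) - Linf) :
    Integrable (fun x : ℝ =>
      L (x + a * I) * ccoth (x + a * I - p) - L (x + b * I) * ccoth (x + b * I - p)) ∧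
    ∫ x : ℝ, (L (x + a * I) * ccoth (x + a * I - p) - L (x + b * I) * ccoth (x + b * I - p))
      = (if a < p.im ∧ p.im < b then 2 * π * I * L p else 0) - 2 * I * (b - a) * Linf := by
  set S : Set ℂ := {ω | a ≤ ω.im ∧ ω.im ≤ b} with hS
  have hsin : ∀ t : ℝ, a ≤ t → t ≤ b → t ≠ p.im → Real.sin (t * I - p : ℂ).im ≠ 0 := by
    intro t h1 h2 h3 h
    have h4 : (t * I - p : ℂ).im = t - p.im := by simp
    rw [h4, Real.sin_eq_zero_iff_of_lt_of_lt (by linarith) (by linarith)] at h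
    exact h3 (sub_eq_zero.1 h)
  have hsa := hsin a le_rfl hab.le (Ne.symm hpa)
  have hsb := hsin b hab.le le_rfl (Ne.symm hpb)
  have hbd : ∀ t : ℝ, Real.sin (t * I - p : ℂ).im ≠ 0 → Integrable (fun x : ℝ =>
      L (x + t * I) - Linf) →
      Integrable fun x : ℝ => (L (x + t * I) - Linf) * ccoth (x + (t * I - p)) := by
    intro t ht hi
    refine Integrable.mul_bdd (c := 1 + |Real.sin (t * I - p : ℂ).im|⁻¹) hi
      (contDiff_ccoth_add ht (n := 0)).continuous.aestronglyMeasurable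
      (Eventually.of_forall fun x => norm_ccoth_le (abs_pos.2 ht) ?_)
    simp
  have hcint : Integrable fun x : ℝ => ccoth (x + (a * I - p)) - ccoth (x + (b * I - p)) :=
    integrable_ccoth_sub (by simp) hsa hsb
  have hF : Integrable (fun x : ℝ =>
      L (x + a * I) * ccoth (x + a * I - p) - L (x + b * I) * ccoth (x + b * I - p)) := by
    refine (((hbd a hsa hia).sub (hbd b hsb hib)).add (hcint.const_mul Linf)).congr
      (Eventually.of_forall fun x => ?_)
    simp only [Pi.add_apply, Pi.sub_apply, add_sub_assoc]
    ring
  refine ⟨hF, ?_⟩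
  have hc1 : Tendsto (fun ω : ℂ => ccoth (ω - p)) (comap re atTop) (𝓝 1) := by
    refine tendsto_ccoth_atTop.comp (tendsto_comap_iff.2 ?_)
    exact (tendsto_atTop_add_const_right _ (-p.re) tendsto_comap).congr fun z => by
      simp [sub_eq_add_neg]
  have hc2 : Tendsto (fun ω : ℂ => ccoth (ω - p)) (comap re atBot) (𝓝 (-1)) := by
    refine tendsto_ccoth_atBot.comp (tendsto_comap_iff.2 ?_)
    exact (tendsto_atBot_add_const_right _ (-p.re) tendsto_comap).congr fun z => by
      simp [sub_eq_add_neg]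
  have hL1 : Tendsto L (comap re atTop ⊓ 𝓟 S) (𝓝 Linf) := by
    refine hlim.mono_left (inf_le_inf_right _ ?_)
    rw [← tendsto_iff_comap]
    exact tendsto_abs_atTop_atTop.comp tendsto_comap
  have hL2 : Tendsto L (comap re atBot ⊓ 𝓟 S) (𝓝 Linf) := by
    refine hlim.mono_left (inf_le_inf_right _ ?_)
    rw [← tendsto_iff_comap]
    exact tendsto_abs_atBot_atTop.comp tendsto_comap
  -- `G` is the regular part of `(L ω - d) * coth (ω - p)`, where `d = 0` unless `p` is in the strip
  have key : ∀ (d : ℂ) (G : ℂ → ℂ), DifferentiableOn ℂ G S →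
      (∀ ω, ω ≠ p → G ω = (L ω - d) * ccoth (ω - p)) →
      ∫ x : ℝ, (L (x + a * I) * ccoth (x + a * I - p) - L (x + b * I) * ccoth (x + b * I - p))
        = d * (∫ x : ℝ, (ccoth (x + (a * I - p)) - ccoth (x + (b * I - p))))
          - 2 * I * (b - a) * (Linf - d) := by
    intro d G hG hGeq
    have hne : ∀ (t : ℝ), p.im ≠ t → ∀ x : ℝ, (x : ℂ) + t * I ≠ p := fun t ht x h => by
      apply ht
      rw [← h]
      simp
    have hGsub : ∀ x : ℝ, G (x + a * I) - G (x + b * I)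
        = (L (x + a * I) * ccoth (x + a * I - p) - L (x + b * I) * ccoth (x + b * I - p))
          - d * (ccoth (x + (a * I - p)) - ccoth (x + (b * I - p))) := fun x => by
      rw [hGeq _ (hne a hpa x), hGeq _ (hne b hpb x), add_sub_assoc, add_sub_assoc]
      ring
    have hev : ∀ (l : Filter ℝ) (_ : ∀ᶠ x in l, x ≠ p.re),
        (fun ω => (L ω - d) * ccoth (ω - p)) =ᶠ[comap re l ⊓ 𝓟 S] G := by
      intro l hl
      refine (Eventually.filter_mono inf_le_left ?_)
      filter_upwards [tendsto_comap.eventually hl] with ω hω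
      refine (hGeq ω fun h => hω (by rw [h])).symm
    have hG1 : Tendsto G (comap re atTop ⊓ 𝓟 S) (𝓝 ((Linf - d) * 1)) :=
      ((hL1.sub_const d).mul (hc1.mono_left inf_le_left)).congr'
        (hev _ (eventually_ne_atTop _))
    have hG2 : Tendsto G (comap re atBot ⊓ 𝓟 S) (𝓝 ((Linf - d) * -1)) :=
      ((hL2.sub_const d).mul (hc2.mono_left inf_le_left)).congr'
        (hev _ (eventually_ne_atBot _))
    have h := integral_sub_eq_of_differentiableOn_strip hab.le hG hG1 hG2
      (by simp only [hGsub]; exact hF.sub (hcint.const_mul d))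
    simp only [hGsub] at h
    rw [integral_sub hF (hcint.const_mul d), integral_const_mul] at h
    linear_combination h
  by_cases hin : a < p.im ∧ p.im < b
  · have hnhds : S ∈ 𝓝 p := by
      have : {ω : ℂ | a < ω.im ∧ ω.im < b} ∈ 𝓝 p :=
        ((isOpen_lt continuous_const continuous_im).inter
          (isOpen_lt continuous_im continuous_const)).mem_nhds hin
      exact mem_of_superset this fun ω hω => ⟨hω.1.le, hω.2.le⟩
    rw [key (L p) (fun ω => dslope L p ω * (cosh (ω - p) / dslope sinh 0 (ω - p))) ?_ ?_, if_pos hin,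
      integral_ccoth_sub (by simp) (by simp; linarith) (by simpa using hin.1)
        (by simpa using hin.2) (by simp; linarith)]
    · simp only [sub_im, mul_im, ofReal_re, ofReal_im, I_re, I_im]
      push_cast
      ring
    · have hlin : Differentiable ℂ fun ω : ℂ => ω - p := by fun_prop
      exact ((Complex.differentiableOn_dslope hnhds).2 hL).mul
        (((differentiable_cosh.comp hlin).differentiableOn).div
          ((differentiable_dslope_sinh.comp hlin).differentiableOn) fun ω hω => by
            refine dslope_sinh_ne_zero ?_
            rw [sub_im, abs_lt]
            constructor <;> linarith [hω.1, hω.2, hin.1, hin.2])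
    · intro ω hω
      have h0 : ω - p ≠ 0 := sub_ne_zero.2 hω
      rw [dslope_of_ne _ hω, slope_def_field, ccoth_eq_inv_mul h0]
      ring
  · rw [key 0 (fun ω => L ω * ccoth (ω - p)) ?_ ?_, if_neg hin]
    · ring
    · have hlin : Differentiable ℂ fun ω : ℂ => ω - p := by fun_prop
      refine hL.mul (((differentiable_cosh.comp hlin).differentiableOn).div
        ((differentiable_sinh.comp hlin).differentiableOn) fun ω hω => ?_)
      refine sinh_ne_zero_of_sin_im_ne_zero ?_
      have h1 := hsin ω.im hω.1 hω.2 fun h => hin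
        ⟨lt_of_le_of_ne (h ▸ hω.1) (Ne.symm hpa), lt_of_le_of_ne (h ▸ hω.2) hpb⟩
      simpa using h1
    · intro ω _
      rw [sub_zero]

/-! ### The boundary-field dependent function at fixed temperature -/

lemma tendsto_logOneAdd {h T : ℝ} (hh : 0 < h) (hT : 0 < T) {l : ℂ → ℂ} {F : Filter ℂ}
    (hl : Tendsto l F (𝓝 (-(h : ℂ) / T))) :
    Tendsto (logOneAdd l) F (𝓝 (logOneAddInfty h T : ℂ)) := by
  have hv : (-(h : ℂ) / T) = ((-h / T : ℝ) : ℂ) := by push_cast; rfl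
  have hre : (-(h : ℂ) / T).re < 0 := by
    rw [hv, ofReal_re]
    exact div_neg_of_neg_of_pos (neg_neg_of_pos hh) hT
  have hval : log (1 + exp (-(h : ℂ) / T)) = (logOneAddInfty h T : ℂ) := by
    rw [logOneAddInfty, hv, ← ofReal_exp, ofReal_log (by positivity)]
    push_cast
    rfl
  have hc : ContinuousAt (fun u : ℂ => log (1 + exp u)) (-(h : ℂ) / T) := by
    refine ContinuousAt.clog (by fun_prop) (Or.inl ?_)
    rw [hv, ← ofReal_exp, add_re, one_re, ofReal_re]
    positivity
  have h1 := hc.tendsto.comp hl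
  rw [hval] at h1
  refine h1.congr' ?_
  filter_upwards [hl.eventually ((isOpen_lt continuous_re continuous_const).mem_nhds hre)]
    with ω hω
  have hω : (l ω).re < 0 := hω
  rw [Function.comp_apply, logOneAdd, logOneAddExp, if_neg hω.not_gt]

/-- The contour integral after its upper line has been moved to `ℝ + iζ/2`. -/
lemma contourInt_logOneAdd_mul_ccoth {h ζ T αd αu : ℝ} {l : ℂ → ℂ} {ξ : ℂ} (hh : 0 < h)
    (hT : 0 < T) (hζπ : ζ < π) (hu0 : 0 < αu) (huζ : αu < ζ / 2)
    (hdown : Integrable fun x : ℝ => logOneAdd l ((x : ℂ) - I * αd) - (logOneAddInfty h T : ℂ))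
    (hupi : Integrable fun x : ℝ => logOneAdd l ((x : ℂ) + I * αu) - (logOneAddInfty h T : ℂ))
    (hmid : Integrable fun x : ℝ =>
      logOneAdd l ((x : ℂ) + I * ζ / 2) - (logOneAddInfty h T : ℂ))
    (hup : UpperLineDeformable h ζ T αu l)
    (h1 : -(π / 2) < ξ.im) (h2 : ξ.im ≤ π / 2) (hξu : -ξ.im ≠ αu) (hξζ : ξ.im ≠ -(ζ / 2))
    (hsd : Real.sin (ξ - I * αd).im ≠ 0) (hsζ : Real.sin (ξ + I * ζ / 2).im ≠ 0) :
    contourInt αd αu (fun ω => logOneAdd l ω * ccoth (ω + ξ))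
      = (∫ x : ℝ, (logOneAdd l ((x : ℂ) - I * αd) - (logOneAddInfty h T : ℂ))
            * ccoth (x + (ξ - I * αd)))
        + logOneAddInfty h T
          * (∫ x : ℝ, (ccoth (x + (ξ - I * αd)) - ccoth (x + (ξ + I * ζ / 2))))
        - (∫ x : ℝ, (logOneAdd l ((x : ℂ) + I * ζ / 2) - (logOneAddInfty h T : ℂ))
            * ccoth (x + (ξ + I * ζ / 2)))
        - (if αu < (-ξ).im ∧ (-ξ).im < ζ / 2 then 2 * π * I * logOneAdd l (-ξ) else 0)
        + 2 * I * ((ζ : ℂ) / 2 - αu) * logOneAddInfty h T := by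
  have ea : ∀ x : ℝ, (x : ℂ) + αu * I = x + I * αu := fun x => by ring
  have eb : ∀ x : ℝ, (x : ℂ) + ((ζ / 2 : ℝ) : ℂ) * I = x + I * ζ / 2 := fun x => by
    push_cast
    ring
  obtain ⟨hFi, hF⟩ := integral_sub_mul_ccoth (L := logOneAdd l) (p := -ξ)
    (Linf := (logOneAddInfty h T : ℂ)) hu0 huζ (by linarith)
    (by rw [neg_im]; linarith) (by rw [neg_im]; linarith) (by rwa [neg_im])
    (by rw [neg_im]; intro h; exact hξζ (by linarith)) hup.1.differentiableOn
    (tendsto_logOneAdd hh hT hup.2)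
    (by simpa only [ea] using hupi) (by simpa only [eb] using hmid)
  simp only [ea, eb, sub_neg_eq_add] at hFi hF
  have hbd : ∀ (s : ℂ) (g : ℝ → ℂ), Real.sin s.im ≠ 0 → Integrable g →
      Integrable fun x : ℝ => g x * ccoth (x + s) := fun s g hs hg =>
    Integrable.mul_bdd (c := 1 + |Real.sin s.im|⁻¹) hg
      (contDiff_ccoth_add hs (n := 0)).continuous.aestronglyMeasurable
      (Eventually.of_forall fun x => norm_ccoth_le (abs_pos.2 hs) (by simp))
  have i1 := hbd _ _ hsd hdown
  have i2 := hbd _ _ hsζ hmid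
  have i3 : Integrable fun x : ℝ => (logOneAddInfty h T : ℂ)
      * (ccoth (x + (ξ - I * αd)) - ccoth (x + (ξ + I * ζ / 2))) :=
    (integrable_ccoth_sub (by simp) hsd hsζ).const_mul _
  have hsplit : ∀ x : ℝ,
      logOneAdd l ((x : ℂ) - I * αd) * ccoth ((x : ℂ) - I * αd + ξ)
        - logOneAdd l ((x : ℂ) + I * αu) * ccoth ((x : ℂ) + I * αu + ξ)
      = (((logOneAdd l ((x : ℂ) - I * αd) - (logOneAddInfty h T : ℂ)) * ccoth (x + (ξ - I * αd))
          + (logOneAddInfty h T : ℂ)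
            * (ccoth (x + (ξ - I * αd)) - ccoth (x + (ξ + I * ζ / 2))))
          - (logOneAdd l ((x : ℂ) + I * ζ / 2) - (logOneAddInfty h T : ℂ))
            * ccoth (x + (ξ + I * ζ / 2)))
        - (logOneAdd l ((x : ℂ) + I * αu) * ccoth ((x : ℂ) + I * αu + ξ)
          - logOneAdd l ((x : ℂ) + I * ζ / 2) * ccoth ((x : ℂ) + I * ζ / 2 + ξ)) := fun x => by
    rw [show (x : ℂ) - I * αd + ξ = x + (ξ - I * αd) by ring,
      show (x : ℂ) + I * ζ / 2 + ξ = x + (ξ + I * ζ / 2) by ring]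
    ring
  rw [contourInt]
  simp only [hsplit]
  have hlin : ∀ {f g k m : ℝ → ℂ}, Integrable f → Integrable g → Integrable k → Integrable m →
      ∫ x, (f x + g x - k x - m x) = (∫ x, f x) + (∫ x, g x) - (∫ x, k x) - ∫ x, m x :=
    fun hf hg hk hm => by
      rw [integral_sub ?_ hm, integral_sub ?_ hk, integral_add hf hg]
      exacts [hf.add hg, (hf.add hg).sub hk]
  rw [hlin i1 i3 i2 hFi, integral_const_mul, hF]
  push_cast
  ring

lemma norm_log_one_add_exp_le {w : ℂ} (hw : Real.exp w.re ≤ 1 / 2) :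
    ‖log (1 + exp w)‖ ≤ 3 / 2 * Real.exp w.re := by
  rw [← norm_exp] at hw ⊢
  exact norm_log_one_add_half_le_self hw

/-- The residue at `-ξ` collected inside `𝒞` and above its upper line is `-ε(-iζ/2 - ξ)` where
`Re ε` is negative, and exponentially small where it is positive. -/
lemma norm_residue_add_energy_le {ζ T αd αu c : ℝ} {l : ℂ → ℂ} {ξ : ℂ} (hT : 0 < T)
    (hd0 : 0 < αd) (hu0 : 0 < αu) (huζ : αu < ζ / 2) (hξu : -ξ.im ≠ αu) (hc : 0 < c)
    (hsmall : Real.exp (-(c / T)) ≤ 1 / 2)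
    (hneg : 0 < -ξ.im ∧ -ξ.im < ζ / 2 → (epsT ζ T l (-(I * ζ / 2) - ξ)).re ≤ -c)
    (hpos : -αd < -ξ.im ∧ -ξ.im ≤ 0 → c ≤ (epsT ζ T l (-(I * ζ / 2) - ξ)).re) :
    ‖(T : ℂ) * deltaXi αd αu ξ * logOneAdd l (-ξ)
        + T * (if αu < (-ξ).im ∧ (-ξ).im < ζ / 2 then logOneAdd l (-ξ) else 0)
        + (if 0 < -ξ.im ∧ -ξ.im < ζ / 2 then epsT ζ T l (-(I * ζ / 2) - ξ) else 0)‖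
      ≤ T * (3 / 2 * Real.exp (-(c / T))) := by
  have heps : epsT ζ T l (-(I * ζ / 2) - ξ) = -T * l (-ξ) := by
    rw [epsT]
    congr 2
    ring
  have hre : (epsT ζ T l (-(I * ζ / 2) - ξ)).re = -(T * (l (-ξ)).re) := by
    rw [heps, neg_mul, neg_re, re_ofReal_mul]
  rw [hre] at hneg hpos
  have hlog : ∀ w : ℂ, w.re ≤ -(c / T) →
      ‖(T : ℂ) * log (1 + exp w)‖ ≤ T * (3 / 2 * Real.exp (-(c / T))) := fun w hw => by
    have := Real.exp_le_exp.2 hw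
    rw [norm_mul, norm_real, Real.norm_of_nonneg hT.le]
    gcongr
    refine (norm_log_one_add_exp_le (this.trans hsmall)).trans ?_
    gcongr
  have hcT : 0 < c / T := div_pos hc hT
  have hdelta : deltaXi αd αu ξ = if -αd < (-ξ).im ∧ (-ξ).im < αu then 1 else 0 := by
    rw [deltaXi]
  simp only [neg_im] at hdelta ⊢
  by_cases hA : 0 < -ξ.im ∧ -ξ.im < ζ / 2
  · have h1 := hneg hA
    have h2 : c / T ≤ (l (-ξ)).re := by
      rw [div_le_iff₀ hT]
      linarith
    have h3 : logOneAdd l (-ξ) = l (-ξ) + log (1 + exp (-l (-ξ))) := by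
      rw [logOneAdd, logOneAddExp, if_pos (hcT.trans_le h2)]
    have h4 : deltaXi αd αu ξ * logOneAdd l (-ξ)
        + (if αu < -ξ.im ∧ -ξ.im < ζ / 2 then logOneAdd l (-ξ) else 0) = logOneAdd l (-ξ) := by
      rcases lt_or_gt_of_ne hξu with hlt | hgt
      · rw [hdelta, if_pos ⟨by linarith, hlt⟩, if_neg fun h => by linarith [h.1]]
        ring
      · rw [hdelta, if_neg (fun h => by linarith [h.2]), if_pos ⟨hgt, hA.2⟩]
        ring
    rw [mul_assoc, ← mul_add, h4, if_pos hA, heps, h3,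
      show (T : ℂ) * (l (-ξ) + log (1 + exp (-l (-ξ)))) + -T * l (-ξ)
        = T * log (1 + exp (-l (-ξ))) by ring]
    refine hlog _ ?_
    rw [neg_re]
    linarith
  · rw [if_neg hA, add_zero, if_neg fun h => hA ⟨hu0.trans h.1, h.2⟩, mul_zero, add_zero, mul_assoc]
    by_cases hB : -αd < -ξ.im ∧ -ξ.im < αu
    · have h0 : -ξ.im ≤ 0 := by
        by_contra! h
        exact hA ⟨h, hB.2.trans huζ⟩
      have h1 := hpos ⟨hB.1, h0⟩
      have h2 : (l (-ξ)).re ≤ -(c / T) := by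
        rw [← neg_div, le_div_iff₀ hT]
        linarith
      rw [hdelta, if_pos hB, one_mul, logOneAdd, logOneAddExp, if_neg (by linarith)]
      exact hlog _ h2
    · rw [hdelta, if_neg hB, zero_mul, mul_zero, norm_zero]
      positivity

lemma le_abs_sin {y k : ℝ} (hk : 0 ≤ k) (h1 : k ≤ |y|) (h2 : |y| ≤ π - k) :
    2 / π * k ≤ |Real.sin y| := by
  have hπ := Real.pi_pos
  have key : ∀ t : ℝ, k ≤ t → t ≤ π / 2 → 2 / π * k ≤ Real.sin t := fun t h3 h4 =>
    le_trans (by gcongr) (Real.mul_le_sin (hk.trans h3) h4)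
  have habs : |Real.sin y| = Real.sin |y| := by
    rw [Real.abs_sin_eq_sin_abs_of_abs_le_pi (by linarith)]
  rw [habs]
  rcases le_total |y| (π / 2) with h | h
  · exact key _ h1 h
  · rw [← Real.sin_pi_sub]
    exact key _ (by linarith) (by linarith)

/-- The combination of the values of `coth` at the two Fermi points in the `T²` term. -/
lemma ccoth_add_ccoth_fermi {q : ℝ} {s : ℂ} (h1 : sinh (q + s) ≠ 0) (h2 : sinh (q - s) ≠ 0) :
    ccoth (q + s) + ccoth (((-q : ℝ) : ℂ) + s)
      = -(sinh (2 * s) / (sinh (q + s) * sinh (q - s))) := by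
  have h3 : ccoth (((-q : ℝ) : ℂ) + s) = -ccoth (q - s) := by
    rw [show ((-q : ℝ) : ℂ) + s = -(q - s) by push_cast; ring, ccoth, ccoth, sinh_neg, cosh_neg,
      div_neg]
  rw [h3, ← sub_eq_add_neg, ccoth_sub h1 h2,
    show (q : ℂ) - s - (q + s) = -(2 * s) by ring, sinh_neg, neg_div]

/-! ### The low-temperature expansion of the boundary-field dependent function -/

/-- The functions `ε` on the real line attached to solutions of the non-linear integral equation
satisfy the assumptions of the low-temperature analysis. -/
lemma lowTempFamily_epsT {J h ζ q : ℝ} (hζ : 0 < ζ) (hζπ : ζ < π) (hh : 0 < h)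
    {αd αu : ℝ → ℝ} {loga : ℝ → ℂ → ℂ}
    (hcontour : ∀ᶠ T : ℝ in 𝓝[>] (0 : ℝ), AdmissibleContour ζ (αd T) (αu T))
    (hsol : ∀ᶠ T : ℝ in 𝓝[>] (0 : ℝ), IsNLIESolution J h ζ T (αd T) (αu T) (loga T))
    (hYY : YangYangUpToInfinity J h ζ loga) {ε₀ ε₁ ε₂ : ℝ → ℝ}
    (hexp : HasLowTExpansion ζ loga ε₀ ε₁ ε₂) (hq : 0 < q) (hneg : ∀ x : ℝ, |x| < q → ε₀ x < 0)
    (hpos : ∀ x : ℝ, q < |x| → 0 < ε₀ x) (hsimple : deriv ε₀ q ≠ 0) :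
    LowTempFamily J h ζ q (fun T x => epsT ζ T (loga T) x) ε₀ ε₁ ε₂ where
  sin_ne := (Real.sin_pos_of_pos_of_lt_pi hζ hζπ).ne'
  sin_half_ne := (Real.sin_pos_of_pos_of_lt_pi (by linarith) (by linarith)).ne'
  h_pos := hh
  q_pos := hq
  continuous := by
    filter_upwards [hcontour, hsol] with T hc hs
    have hmaps : ∀ x : ℝ, (x : ℂ) + I * ζ / 2 ∈
        {ω : ℂ | ω ≠ 0 ∧ -αd T ≤ ω.im ∧ ω.im ≤ ζ / 2} := fun x => by
      have him : ((x : ℂ) + I * ζ / 2).im = ζ / 2 := by simp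
      refine ⟨fun h0 => ?_, ?_, him.le⟩
      · rw [h0, zero_im] at him
        linarith
      · rw [him]
        linarith [hc.1]
    have h1 : Continuous fun x : ℝ => loga T ((x : ℂ) + I * ζ / 2) :=
      hs.analytic.continuousOn.comp_continuous (by fun_prop) hmaps
    exact continuous_const.mul h1
  integrable_one := hexp.1
  integrable_two := hexp.2.1
  bounded := hexp.2.2.1
  expansion := hexp.2.2.2
  yangYang := by
    obtain ⟨C, hC⟩ := hYY 3
    refine ⟨C, ?_⟩
    simpa only [bareEnergy_ofReal, kernelK_ofReal_sub] using hC
  neg := hneg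
  pos := hpos
  deriv_ne := hsimple

lemma LowTempFamily.isDressedEnergy {J h ζ q : ℝ} {E : ℝ → ℝ → ℂ} {ε₀ ε₁ ε₂ : ℝ → ℝ}
    (H : LowTempFamily J h ζ q E ε₀ ε₁ ε₂) : IsDressedEnergy J h ζ q ε₀ := by
  refine ⟨fun x => ?_, H.zero_at_fermi (abs_of_pos H.q_pos),
    H.zero_at_fermi (by rw [abs_neg, abs_of_pos H.q_pos])⟩
  rw [bareEnergy_ofReal, ← H.dressing_equation x, ← dressOp_ofReal, dressOp]
  simp only [kernelK_ofReal_sub]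

/-- The lower line of `𝒞` and the constant `ln (1 + e^{-h/T})` at the ends of the strip contribute a negligible
amount to the contour integral. -/
lemma isBigO_lower_line {h ζ : ℝ} (hh : 0 < h) {αd αu : ℝ → ℝ} {loga : ℝ → ℂ → ℂ}
    (hcontour : ∀ᶠ T : ℝ in 𝓝[>] (0 : ℝ), AdmissibleContour ζ (αd T) (αu T))
    (hint : ∀ᶠ T : ℝ in 𝓝[>] (0 : ℝ), Integrable fun x : ℝ =>
      logOneAdd (loga T) ((x : ℂ) - I * αd T) - (logOneAddInfty h T : ℂ))
    (hdown : LowerLineNegligible h αd loga) {ξ : ℂ} {m : ℝ} (hm : 0 < m)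
    (hmd : ∀ᶠ T : ℝ in 𝓝[>] (0 : ℝ), m ≤ |Real.sin (ξ - I * αd T).im|)
    (hmζ : m ≤ |Real.sin (ξ + I * ζ / 2).im|) (n : ℕ) :
    (fun T : ℝ => (∫ x : ℝ, (logOneAdd (loga T) ((x : ℂ) - I * αd T) - (logOneAddInfty h T : ℂ))
            * ccoth (x + (ξ - I * αd T)))
        + logOneAddInfty h T
          * (∫ x : ℝ, (ccoth (x + (ξ - I * αd T)) - ccoth (x + (ξ + I * ζ / 2))))
        + 2 * I * ((ζ : ℂ) / 2 - αu T) * logOneAddInfty h T)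
      =O[𝓝[>] 0] fun T : ℝ => T ^ n := by
  have hinf : (fun T : ℝ => (logOneAddInfty h T : ℂ)) =O[𝓝[>] 0] fun T : ℝ => T ^ n := by
    refine (Asymptotics.IsBigO.of_bound 1 (Eventually.of_forall fun T => ?_)).trans
      (exp_neg_div_isBigO n hh)
    rw [norm_real, Real.norm_of_nonneg (logOneAddInfty_nonneg h T), one_mul,
      Real.norm_of_nonneg (Real.exp_pos _).le]
    exact logOneAddInfty_le h T
  refine (Asymptotics.IsBigO.add ?_ ?_).add ?_
  · obtain ⟨C, hC⟩ := hdown n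
    refine Asymptotics.IsBigO.of_bound ((1 + m⁻¹) * C) ?_
    filter_upwards [hC, hmd, hint, self_mem_nhdsWithin] with T hCT hmT hiT hT
    have hT : 0 < T := hT
    rw [Real.norm_of_nonneg (by positivity), mul_assoc]
    calc _ ≤ ∫ x : ℝ, (1 + m⁻¹) * ‖logOneAdd (loga T) ((x : ℂ) - I * αd T)
            - (logOneAddInfty h T : ℂ)‖ := by
          refine norm_integral_le_of_norm_le (hiT.norm.const_mul _)
            (Eventually.of_forall fun x => ?_)
          rw [norm_mul, mul_comm]
          gcongr
          exact norm_ccoth_le hm (by simpa using hmT)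
      _ ≤ _ := by
          rw [integral_const_mul]
          have := hCT.2
          gcongr
  · have hbdd : (fun T : ℝ => ∫ x : ℝ, (ccoth (x + (ξ - I * αd T)) - ccoth (x + (ξ + I * ζ / 2))))
        =O[𝓝[>] 0] fun _ : ℝ => (1 : ℝ) := by
      refine Asymptotics.IsBigO.of_bound (∫ x : ℝ, (Real.sinh (x + ξ.re) ^ 2 + m ^ 2)⁻¹) ?_
      filter_upwards [hmd] with T hmT
      rw [norm_one, mul_one]
      refine norm_integral_le_of_norm_le
        ((integrable_inv_sinh_sq_add_sq hm.ne').comp_add_right ξ.re)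
        (Eventually.of_forall fun x => ?_)
      simpa using norm_ccoth_sub_le hm (s := ξ - I * αd T) (s' := ξ + I * ζ / 2) (by simp) hmT hmζ x
    simpa using hinf.mul hbdd
  · have hbdd : (fun T : ℝ => 2 * I * ((ζ : ℂ) / 2 - αu T)) =O[𝓝[>] 0] fun _ : ℝ => (1 : ℝ) := by
      refine Asymptotics.IsBigO.of_bound ζ ?_
      filter_upwards [hcontour] with T hc
      rw [norm_one, mul_one, show (ζ : ℂ) / 2 - αu T = ((ζ / 2 - αu T : ℝ) : ℂ) by push_cast; rfl,
        norm_mul, norm_mul, norm_I, norm_real, Real.norm_of_nonneg (by linarith [hc.2.2.1])]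
      norm_num
      linarith [hc.2.1]
    simpa using hbdd.mul hinf

theorem mainTheorem7 (J h ζ : ℝ) (hJ : 0 < J) (hζ : 0 < ζ) (hζπ : ζ < π)
    (hh : 0 < h) (hhc : h < 8 * J * Real.cos (ζ / 2) ^ 2)
    (αd αu : ℝ → ℝ) (loga : ℝ → ℂ → ℂ)
    (hcontour : ∀ᶠ T in 𝓝[>] (0 : ℝ), AdmissibleContour ζ (αd T) (αu T))
    (hsol : ∀ᶠ T in 𝓝[>] (0 : ℝ), IsNLIESolution J h ζ T (αd T) (αu T) (loga T))
    (hup : ∀ᶠ T in 𝓝[>] (0 : ℝ), UpperLineDeformable h ζ T (αu T) (loga T))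
    (hdown : LowerLineNegligible h αd loga)
    (hYY : YangYangUpToInfinity J h ζ loga)
    (ε₀ ε₁ ε₂ : ℝ → ℝ) (hexp : HasLowTExpansion ζ loga ε₀ ε₁ ε₂)
    (q : ℝ) (hq : 0 < q) (hneg : ∀ x : ℝ, |x| < q → ε₀ x < 0)
    (hpos : ∀ x : ℝ, q < |x| → 0 < ε₀ x) (hsimple : deriv ε₀ q ≠ 0) :
    IsDressedEnergy J h ζ q ε₀ ∧
    ∀ ξ : ℂ, AdmissibleXi ζ αd αu ξ → SignCondition ζ αd loga ξ →
      ∃ r₀ > 0, ∀ r : ℝ, 0 < r → r < r₀ →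
        (fun T : ℝ => boundaryB J (-I * ζ) T (αd T) (αu T) (loga T) ξ
          - (T * (J * sinh (-I * ζ) / T) * ccoth ξ
            + intCxi ζ q (epsT ζ T (loga T)) ξ r
            - I * (π * (T : ℂ) ^ 2 / (12 * ((deriv ε₀ q : ℝ) : ℂ)))
              * (sinh (2 * ξ + I * ζ)
                / (sinh (q + ξ + I * ζ / 2) * sinh (q - ξ - I * ζ / 2)))))
        =O[𝓝[>] 0] (fun T : ℝ => T ^ 4) := by
  have H := lowTempFamily_epsT hζ hζπ hh hcontour hsol hYY hexp hq hneg hpos hsimple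
  refine ⟨H.isDressedEnergy, fun ξ hξ hsign => ?_⟩
  obtain ⟨hξ1, hξ2, hξ0, hξζ, hξu, d, hd, hξd⟩ := hξ
  obtain ⟨c, hc, hsign⟩ := hsign
  have hπ := Real.pi_pos
  set s : ℂ := ξ + I * ζ / 2 with hs
  have hsim : s.im = ξ.im + ζ / 2 := by simp [hs]
  have hsζ : Real.sin s.im ≠ 0 := by
    rw [hsim]
    intro h0
    rw [Real.sin_eq_zero_iff_of_lt_of_lt (by linarith) (by linarith)] at h0
    exact hξζ (by linarith)
  -- a lower bound for `|sinh|` on the lower line of `𝒞`, uniform in `T`, and on `ℝ + iζ/2`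
  obtain ⟨m, hm, hmd, hmζ⟩ : ∃ m > 0,
      (∀ᶠ T : ℝ in 𝓝[>] (0 : ℝ), m ≤ |Real.sin (ξ - I * αd T).im|) ∧ m ≤ |Real.sin s.im| := by
    set k := min d (min (ξ.im + π / 2) (π / 2)) with hk
    have hk0 : 0 < k := lt_min hd (lt_min (by linarith) (by linarith))
    have hkd : k ≤ d := min_le_left _ _
    have hk1 : k ≤ ξ.im + π / 2 := (min_le_right _ _).trans (min_le_left _ _)
    have hk2 : k ≤ π / 2 := (min_le_right _ _).trans (min_le_right _ _)
    refine ⟨min (2 / π * k) |Real.sin s.im|, lt_min (by positivity) (abs_pos.2 hsζ), ?_,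
      min_le_right _ _⟩
    filter_upwards [hξd, hcontour] with T hT hcT
    have him : (ξ - I * αd T).im = ξ.im - αd T := by simp
    have h1 := hcT.2.2.2.trans_le (min_le_left _ _)
    have h2 := hcT.2.2.2.trans_le (min_le_right _ _)
    rw [him]
    refine (min_le_left _ _).trans (le_abs_sin hk0.le (hkd.trans hT) (abs_le.2 ⟨?_, ?_⟩)) <;>
      linarith [hcT.1, hcT.2.1]
  have hξ4 := isBigO_lower_line hh hcontour (hsol.mono fun T hT => hT.integrable_down) hdown hm hmd
    hmζ 4
  obtain ⟨hmid, hsom⟩ := H.sommerfeld_log_isBigO (f := fun x : ℝ => ccoth (x + s))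
    (contDiff_ccoth_add hsζ) (M := 1 + |Real.sin s.im|⁻¹)
    (fun x => norm_ccoth_le (abs_pos.2 hsζ) (by simp))
  -- the circle has to stay in the strip where `ln 𝔞` is analytic, away from the origin
  refine ⟨if 0 < -ξ.im ∧ -ξ.im < ζ / 2 then min 1 (min (-ξ.im) (ζ / 2 + ξ.im)) else 1, ?_,
    fun r hr hrr => ?_⟩
  · split_ifs with hA
    · exact lt_min one_pos (lt_min hA.1 (by linarith [hA.2]))
    · exact one_pos
  -- `R` collects the residues at `-ξ` and the circle; the other two errors are the lower line of
  -- `𝒞` and the remainder of the Sommerfeld expansion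
  set R : ℝ → ℂ := fun T => (T : ℂ) * deltaXi (αd T) (αu T) ξ * logOneAdd (loga T) (-ξ)
        + T * (if αu T < (-ξ).im ∧ (-ξ).im < ζ / 2 then logOneAdd (loga T) (-ξ) else 0)
        + (if 0 < -ξ.im ∧ -ξ.im < ζ / 2 then epsT ζ T (loga T) (-(I * ζ / 2) - ξ) else 0) with hR
  have hRO : R =O[𝓝[>] 0] fun T : ℝ => T ^ 4 := by
    refine Asymptotics.IsBigO.trans (Asymptotics.IsBigO.of_bound (3 / 2) ?_)
      (exp_neg_div_isBigO 4 hc)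
    have hsmall : ∀ᶠ T : ℝ in 𝓝[>] (0 : ℝ), Real.exp (-(c / T)) ≤ 1 / 2 := by
      have hlim : Tendsto (fun T : ℝ => T ^ 1) (𝓝[>] 0) (𝓝 0) := by
        have : Tendsto (fun T : ℝ => T ^ 1) (𝓝 0) (𝓝 (0 ^ 1)) := (continuous_pow 1).tendsto 0
        rw [zero_pow one_ne_zero] at this
        exact this.mono_left nhdsWithin_le_nhds
      exact ((exp_neg_div_isBigO 1 hc).trans_tendsto hlim).eventually_le_const (by norm_num)
    have hT1 : ∀ᶠ T : ℝ in 𝓝[>] (0 : ℝ), T < 1 :=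
      nhdsWithin_le_nhds (eventually_lt_nhds one_pos)
    filter_upwards [hsmall, hcontour, hξu, hsign, self_mem_nhdsWithin, hT1]
      with T h1 h2 h3 h4 hT hT1
    have hT : 0 < T := hT
    refine (norm_residue_add_energy_le hT h2.1 h2.2.1 h2.2.2.1 h3 hc h1 h4.1 h4.2).trans ?_
    rw [Real.norm_of_nonneg (Real.exp_pos _).le]
    exact mul_le_of_le_one_left (by positivity) hT1.le
  have hTO : (fun T : ℝ => (T : ℂ)) =O[𝓝[>] 0] fun _ : ℝ => (1 : ℝ) := by
    refine Asymptotics.IsBigO.of_bound 1 ?_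
    have hT1 : ∀ᶠ T : ℝ in 𝓝[>] (0 : ℝ), T < 1 :=
      nhdsWithin_le_nhds (eventually_lt_nhds one_pos)
    filter_upwards [hT1, self_mem_nhdsWithin] with T h1 hT
    have hT : 0 < T := hT
    rw [norm_real, Real.norm_of_nonneg hT.le, norm_one, mul_one]
    exact h1.le
  have hlow := (hTO.mul hξ4).const_mul_left (2 * I * π)⁻¹
  simp only [one_mul] at hlow
  refine ((hRO.neg_left.add hlow).sub (hsom.const_mul_left (2 * I * π)⁻¹)).congr' ?_
    EventuallyEq.rfl
  filter_upwards [hcontour, hsol, hup, hξu, hmid, hmd, self_mem_nhdsWithin]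
    with T hcT hsT hupT huT hmidT hmdT hT
  have hT : 0 < T := hT
  have hTC : (T : ℂ) ≠ 0 := ofReal_ne_zero.2 hT.ne'
  have hLmid : ∀ x : ℝ, logOneAddExp (-epsT ζ T (loga T) x / T)
      = logOneAdd (loga T) ((x : ℂ) + I * ζ / 2) := fun x => by
    rw [logOneAdd, epsT]
    congr 1
    field_simp
  simp only [hLmid] at hmidT ⊢
  have hcont := contourInt_logOneAdd_mul_ccoth hh hT hζπ hcT.2.1 hcT.2.2.1 hsT.integrable_down
    hsT.integrable_up hmidT hupT hξ1 hξ2 huT hξζ (abs_pos.1 (hm.trans_le hmdT)) hsζ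
  have hcirc : (if 0 < -ξ.im ∧ -ξ.im < ζ / 2 then
        ∮ z in C(-(I * ζ / 2) - ξ, r), ccoth (z + ξ + I * ζ / 2) * epsT ζ T (loga T) z else 0)
      = 2 * π * I * (if 0 < -ξ.im ∧ -ξ.im < ζ / 2 then
          epsT ζ T (loga T) (-(I * ζ / 2) - ξ) else 0) := by
    by_cases hA : 0 < -ξ.im ∧ -ξ.im < ζ / 2
    · rw [if_pos hA] at hrr
      have hr1 : r < 1 := hrr.trans_le (min_le_left _ _)
      have hr2 : r < -ξ.im := hrr.trans_le ((min_le_right _ _).trans (min_le_left _ _))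
      have hr3 : r < ζ / 2 + ξ.im := hrr.trans_le ((min_le_right _ _).trans (min_le_right _ _))
      rw [if_pos hA, if_pos hA, ← circleIntegral_ccoth_mul hr
        (hr1.trans (by linarith [Real.pi_gt_three])) (g := epsT ζ T (loga T))]
      · refine circleIntegral.integral_congr hr.le fun z _ => ?_
        rw [show z + ξ + I * ζ / 2 = z - (-(I * ζ / 2) - ξ) by ring]
      · have hmaps : MapsTo (fun z : ℂ => z + I * ζ / 2) (Metric.closedBall (-(I * ζ / 2) - ξ) r)
            {ω : ℂ | ω ≠ 0 ∧ -αd T ≤ ω.im ∧ ω.im ≤ ζ / 2} := by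
          intro z hz
          have h1 : ‖z + I * ζ / 2 + ξ‖ ≤ r := by
            rw [mem_closedBall_iff_norm] at hz
            convert! hz using 2
            ring
          have h2 := abs_le.1 ((abs_im_le_norm _).trans h1)
          rw [add_im] at h2
          refine ⟨fun h0 => ?_, ?_, ?_⟩
          · have h0 : z + I * ζ / 2 = 0 := h0
            rw [h0, zero_im] at h2
            linarith [h2.2]
          · linarith [hcT.1]
          · linarith
        exact (hsT.analytic.differentiableOn.comp (by fun_prop) hmaps).const_mul _
    · rw [if_neg hA, if_neg hA, mul_zero]
  have hne : ∀ x : ℝ, sinh (x + s) ≠ 0 := fun x =>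
    sinh_ne_zero_of_sin_im_ne_zero (by simpa using hsζ)
  have hne' : sinh (q - s) ≠ 0 := by
    have := hne (-q)
    rw [show ((-q : ℝ) : ℂ) + s = -(q - s) by push_cast; ring, sinh_neg] at this
    exact neg_ne_zero.1 this
  have hcirc2 : ∫ x in (-q)..q, ccoth (x + ξ + I * ζ / 2) * epsT ζ T (loga T) x
      = ∫ x in (-q)..q, ccoth (x + s) * epsT ζ T (loga T) x := by
    simp only [hs, add_assoc]
  have hderiv : ((deriv ε₀ q : ℝ) : ℂ) ≠ 0 := ofReal_ne_zero.2 hsimple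
  have hπC : (π : ℂ) ≠ 0 := ofReal_ne_zero.2 hπ.ne'
  rw [ccoth_add_ccoth_fermi (hne q) hne', boundaryB, hcont, intCxi, hcirc, hcirc2,
    show (q : ℂ) + ξ + I * ζ / 2 = q + s by rw [hs]; ring,
    show (q : ℂ) - ξ - I * ζ / 2 = q - s by rw [hs]; ring,
    show 2 * ξ + I * ζ = 2 * s by rw [hs]; ring]
  have hif : (if αu T < (-ξ).im ∧ (-ξ).im < ζ / 2 then 2 * π * I * logOneAdd (loga T) (-ξ) else 0)
      = 2 * π * I *
        (if αu T < (-ξ).im ∧ (-ξ).im < ζ / 2 then logOneAdd (loga T) (-ξ) else 0) := by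
    rw [mul_ite, mul_zero]
  rw [hif]
  simp only [hR]
  generalize (∫ x : ℝ, (logOneAdd (loga T) ((x : ℂ) - I * αd T) - (logOneAddInfty h T : ℂ))
    * ccoth (x + (ξ - I * αd T))) = A
  generalize (∫ x : ℝ, (ccoth (x + (ξ - I * αd T)) - ccoth (x + s))) = B
  generalize (∫ x : ℝ, (logOneAdd (loga T) ((x : ℂ) + I * ζ / 2) - (logOneAddInfty h T : ℂ))
    * ccoth (x + s)) = D
  generalize (if αu T < (-ξ).im ∧ (-ξ).im < ζ / 2 then logOneAdd (loga T) (-ξ) else 0) = F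
  generalize (if 0 < -ξ.im ∧ -ξ.im < ζ / 2 then epsT ζ T (loga T) (-(I * ζ / 2) - ξ) else 0) = G
  generalize (∫ x in (-q)..q, ccoth (x + s) * epsT ζ T (loga T) x) = N
  generalize sinh (2 * s) / (sinh (q + s) * sinh (q - s)) = Q
  field_simp
  ring_nf
  simp only [I_sq]
  ring
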